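/- **Theorem 2.2.** Let $n\ge 1$, let $p,q>1$, and if $n\ge 3$ let also $p,q\le n/(n-2)$. Let $0<T\le\infty$ and, for $k=1,2$, let $g_k$ be a real function that is positive on $(0,T)$ and integrable on $(0,s)$ for every finite $s<T$. For an integer $r\ge 0$ put $$\mathcal L_r(t)=\underbrace{\ln\cdots\ln}_{r+1}\bigl(\underbrace{\exp\cdots\exp}_{r}(1)+t\bigr),\qquad t\ge 0,$$ and write $(g\ast|w|^{\rho})(t,x)=\int_0^t g(t-\tau)|w(\tau,x)|^{\rho}\,d\tau$. Assume that one of the following holds. 1. $g_1,g_2$ are nonincreasing on $(0,T)$, and there are $r\in\mathbb N_0$, $t_0\in[0,T)$, $c>0$ such that for all $t\in(0,T)$ with $t\ge t_0$: $g_k(t)\ge c\,t^{-1}$ for $k=1,2$, and $$g_1(t)g_2(t)\max\bigl\{g_1(t)^{q-1}t^{2q+1/p},\;g_2(t)^{p-1}t^{2p+1/q}\bigr\}\ \ge\ c\,t^{\frac{n-1}{2}(pq-1)-3}\,\mathcal L_r(t).$$ 2. There are $t_0\in[0,T)$, $C>0$ with $g_k(t)\le C\,t^{-1}$ for all $t\in(0,T)$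 with $t\ge t_0$; $g_k\in C^2([0,T))$ with $g_k''(0)>0$ (one-sided at $0$), $k=1,2$; and $$\max\Bigl\{\frac{p+2+q^{-1}}{pq-1},\frac{q+2+p^{-1}}{pq-1}\Bigr\}>\frac{n-1}{2}.$$ Let $(u_0,u_1),(v_0,v_1)\in H^1(\mathbb R^n)\times L^2(\mathbb R^n)$ be nonnegative (all four functions), vanishing almost everywhere outside the ball $|x|\le R$ for some $R>0$, with neither $u_1$ nor $v_1$ equal to $0$ almost everywhere. Let $(u,v)$ be an energy solution on $[0,T)$ of $$u_{tt}-\Delta u=g_1\ast|v|^p,\quad v_{tt}-\Delta v=g_2\ast|u|^q,\quad (u,u_t,v,v_t)(0,\cdot)=(u_0,u_1,v_0,v_1),$$ that is: $u,v\in C([0,T),H^1(\mathbb R^n))\cap C^1([0,T),L^2(\mathbb R^n))$; $g_1\ast|v|^p$ and $g_2\ast|u|^q$ lie in $L^1_{\rm loc}([0,T)\times\mathbb R^n)$; $u(0)=u_0$, $v(0)=v_0$; and for all $\phi\in C_0^\infty([0,T)\times\mathbb R^n)$ and $t\in(0,T)$ $$\int_0^t\!\!\int_{\mathbb R^n}(-u_t\phi_s+\nabla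 u\cdot\nabla\phi)\,dx\,ds+\int_{\mathbb R^n}u_t(t,x)\phi(t,x)\,dx=\int_{\mathbb R^n}u_1(x)\phi(0,x)\,dx+\int_0^t\!\!\int_{\mathbb R^n}(g_1\ast|v|^p)\phi\,dx\,ds,$$ and the same relation with $(u,u_1,g_1\ast|v|^p)$ replaced by $(v,v_1,g_2\ast|u|^q)$. Then, for every $t\in[0,T)$, $u(t,\cdot)$ and $v(t,\cdot)$ vanish almost everywhere on $\{|x|>R+t\}$, and the solution blows up in finite time, that is, $T<\infty$. -/

import Mathlib

open MeasureTheory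
open scoped ContDiff

/-- Euclidean space `ℝⁿ`. -/
abbrev EucSp (n : ℕ) : Type := EuclideanSpace ℝ (Fin n)

/-- The time interval `[0, T)`, where `T` may be `∞`. -/
def timeInterval (T : EReal) : Set ℝ := {t | 0 ≤ t ∧ (t : EReal) < T}

/-- `ln (ln (⋯ ln (exp (exp (⋯ exp 1)) + t)))` with `r + 1` logarithms and `r` exponentials. -/
noncomputable def slowLog (r : ℕ) (t : ℝ) : ℝ :=
  Real.log^[r + 1] (Real.exp^[r] 1 + t)

/-- `Du` is the weak gradient of `u` on `ℝⁿ`, tested against `C_c^∞(ℝⁿ)`. -/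
def HasWeakGradient {n : ℕ} (u : EucSp n → ℝ) (Du : EucSp n → EucSp n) : Prop :=
  ∀ φ : EucSp n → ℝ, ContDiff ℝ ∞ φ → HasCompactSupport φ →
    ∫ x, u x • gradient φ x = -∫ x, φ x • Du x

/-- `u ∈ H¹(ℝⁿ)`. -/
def MemH1 {n : ℕ} (u : EucSp n → ℝ) : Prop :=
  MemLp u 2 volume ∧ ∃ Du : EucSp n → EucSp n, MemLp Du 2 volume ∧ HasWeakGradient u Du

/-- The memory term `(g ∗ |w|^r)(t, x) = ∫₀ᵗ g(t - τ) |w(τ, x)|^r dτ`. -/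
noncomputable def memoryTerm {n : ℕ} (g : ℝ → ℝ) (r : ℝ) (w : ℝ → EucSp n → ℝ)
    (t : ℝ) (x : EucSp n) : ℝ :=
  ∫ τ in (0 : ℝ)..t, g (t - τ) * |w τ x| ^ r

/-- `g ∗ |w|^r ∈ L¹_loc([0,T) × ℝⁿ)`. The first field says that the integral defining the memory
term converges at almost every `(t, x)`, so that the second one speaks about its true value. -/
structure MemoryTermL1Loc {n : ℕ} (T : EReal) (g : ℝ → ℝ) (r : ℝ) (w : ℝ → EucSp n → ℝ) :
    Prop where
  ae_integrable : ∀ᵐ z ∂((volume.restrict (timeInterval T)).prod (volume : Measure (EucSp n))),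
    IntervalIntegrable (fun τ => g (z.1 - τ) * |w τ z.2| ^ r) volume 0 z.1
  locallyIntegrable : LocallyIntegrableOn (fun z : ℝ × EucSp n => memoryTerm g r w z.1 z.2)
    (timeInterval T ×ˢ Set.univ) (volume.prod volume)

/-- `w ∈ C([0,T), H¹(ℝⁿ)) ∩ C¹([0,T), L²(ℝⁿ))` with time derivative `wt` and spatial weak
gradient `Dw`. The function `w` of `(t, x)` is a jointly measurable representative of the
`L²`-valued curve `W`, so that pointwise expressions in `(t, x)` make sense almost everywhere. -/
structure IsEnergyCurve {n : ℕ} (T : EReal) (w wt : ℝ → EucSp n → ℝ)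
    (Dw : ℝ → EucSp n → EucSp n) : Prop where
  aestronglyMeasurable : AEStronglyMeasurable (fun z : ℝ × EucSp n => w z.1 z.2)
    ((volume.restrict (timeInterval T)).prod volume)
  weakGradient : ∀ t ∈ timeInterval T, HasWeakGradient (w t) (Dw t)
  continuous_gradient : ∃ DW : ℝ → Lp (EucSp n) 2 (volume : Measure (EucSp n)),
    ContinuousOn DW (timeInterval T) ∧ ∀ t ∈ timeInterval T, Dw t =ᵐ[volume] DW t
  contDiff_L2 : ∃ W Wt : ℝ → Lp ℝ 2 (volume : Measure (EucSp n)),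
    (∀ t ∈ timeInterval T, w t =ᵐ[volume] W t ∧ wt t =ᵐ[volume] Wt t) ∧
    (∀ t ∈ timeInterval T, HasDerivWithinAt W (Wt t) (timeInterval T) t) ∧
    ContinuousOn Wt (timeInterval T)

/-- The integral relation satisfied on `[0,T)` by an energy solution of `w_tt - Δw = F`,
`w_t(0) = w₁`, for a curve with time derivative `wt` and gradient `Dw`. The elements of
`C_0^∞([0,T) × ℝⁿ)` are the restrictions to `t ≥ 0` of compactly supported smooth functions on
`ℝ × ℝⁿ` whose support lies in `{t < T}`; they need not vanish at `t = 0`. -/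
def WaveIntegralRelation {n : ℕ} (T : EReal) (w₁ : EucSp n → ℝ) (wt : ℝ → EucSp n → ℝ)
    (Dw : ℝ → EucSp n → EucSp n) (F : ℝ → EucSp n → ℝ) : Prop :=
  ∀ φ : ℝ × EucSp n → ℝ, ContDiff ℝ ∞ φ → HasCompactSupport φ →
    tsupport φ ⊆ {z | (z.1 : EReal) < T} →
    ∀ t : ℝ, 0 < t → (t : EReal) < T →
      (∫ s in (0 : ℝ)..t, ∫ x, (-(wt s x) * deriv (fun σ => φ (σ, x)) s
          + inner ℝ (Dw s x) (gradient (fun y => φ (s, y)) x)))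
        + ∫ x, wt t x * φ (t, x)
      = (∫ x, w₁ x * φ (0, x)) + ∫ s in (0 : ℝ)..t, ∫ x, F s x * φ (s, x)

/-- `(u, v)` is an energy solution on `[0,T)` of
`u_tt - Δu = g₁ ∗ |v|^p`, `v_tt - Δv = g₂ ∗ |u|^q`, `(u, u_t, v, v_t)(0) = (u₀, u₁, v₀, v₁)`. -/
def IsEnergySolution {n : ℕ} (T : EReal) (g₁ g₂ : ℝ → ℝ) (p q : ℝ)
    (u₀ u₁ v₀ v₁ : EucSp n → ℝ) (u v : ℝ → EucSp n → ℝ) : Prop :=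
  ∃ (ut vt : ℝ → EucSp n → ℝ) (Du Dv : ℝ → EucSp n → EucSp n),
    IsEnergyCurve T u ut Du ∧ IsEnergyCurve T v vt Dv ∧
    MemoryTermL1Loc T g₁ p v ∧ MemoryTermL1Loc T g₂ q u ∧
    u 0 =ᵐ[volume] u₀ ∧ v 0 =ᵐ[volume] v₀ ∧
    WaveIntegralRelation T u₁ ut Du (memoryTerm g₁ p v) ∧
    WaveIntegralRelation T v₁ vt Dv (memoryTerm g₂ q u)

/-- An admissible memory kernel on `(0,T)`: positive, and integrable on `(0,s]` for each `s < T`. -/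
structure IsMemoryKernel (T : EReal) (g : ℝ → ℝ) : Prop where
  pos : ∀ t : ℝ, 0 < t → (t : EReal) < T → 0 < g t
  integrable : ∀ s : ℝ, 0 < s → (s : EReal) < T → IntegrableOn g (Set.Ioc 0 s) volume

/-- Slow decay: both kernels are nonincreasing, `g_k ≳ t⁻¹` for `t ≥ t₀`, and the interplay
condition holds for `t ≥ t₀`. -/
def SlowDecayCondition (n : ℕ) (T : EReal) (g₁ g₂ : ℝ → ℝ) (p q : ℝ) (r : ℕ) : Prop :=
  AntitoneOn g₁ {t : ℝ | 0 < t ∧ (t : EReal) < T} ∧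
  AntitoneOn g₂ {t : ℝ | 0 < t ∧ (t : EReal) < T} ∧
  ∃ t₀ ∈ timeInterval T, ∃ c : ℝ, 0 < c ∧
    ∀ t : ℝ, 0 < t → t₀ ≤ t → (t : EReal) < T →
      c * t⁻¹ ≤ g₁ t ∧ c * t⁻¹ ≤ g₂ t ∧
      c * (t ^ (((n : ℝ) - 1) / 2 * (p * q - 1) - 3) * slowLog r t) ≤
        g₁ t * g₂ t *
          max (g₁ t ^ (q - 1) * t ^ (2 * q + 1 / p)) (g₂ t ^ (p - 1) * t ^ (2 * p + 1 / q))

/-- Fast decay: `g_k ≲ t⁻¹` for `t ≥ t₀`, `g_k ∈ C²([0,T))` with `g_k''(0) > 0` (one-sided at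
`0`), and the exponents satisfy `α_W(p, q) > (n - 1) / 2`. -/
def FastDecayCondition (n : ℕ) (T : EReal) (g₁ g₂ : ℝ → ℝ) (p q : ℝ) : Prop :=
  (∃ t₀ ∈ timeInterval T, ∃ C : ℝ, 0 < C ∧
    ∀ t : ℝ, 0 < t → t₀ ≤ t → (t : EReal) < T → g₁ t ≤ C * t⁻¹ ∧ g₂ t ≤ C * t⁻¹) ∧
  ContDiffOn ℝ 2 g₁ (timeInterval T) ∧ ContDiffOn ℝ 2 g₂ (timeInterval T) ∧
  0 < iteratedDerivWithin 2 g₁ (timeInterval T) 0 ∧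
  0 < iteratedDerivWithin 2 g₂ (timeInterval T) 0 ∧
  ((n : ℝ) - 1) / 2 < max ((p + 2 + q⁻¹) / (p * q - 1)) ((q + 2 + p⁻¹) / (p * q - 1))

/-! Finite speed of propagation rests on energy estimates with weight exp(2μρ), where ρ is a smooth
bounded 1-Lipschitz approximation of |x|. The wave operator alone lets the weighted energy grow at
rate 2μ. The source adds little: in e^{μρ}|v|^p the weight is put on a single factor v, and the
Sobolev embedding H¹ → L^{2p}, which is where p, q ≤ n/(n-2) enters, bounds the product by a
weighted H¹ norm of v. The derivative falling on the weight costs a factor μ there; the energy pays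
for it with an extra term κ(2μ)²‖e^{μρ}v‖². The total rate is 2μ(1+κ) + c with c independent of μ
and ρ (`exists_energy_growth`). Data supported in |x| ≤ R give initial energy of order μ²e^{2μR}, up
to the error in ρ, so μ → ∞ forces vanishing beyond speed 1+κ, and κ → 0, ρ → |x| give the cone
(`ae_eq_zero_of_lt_norm`).

For the blow-up, suppose T = ∞. Compact support legitimizes the moments y = ∫ u e^{⟨x,ξ⟩}, which
satisfy y'' = |ξ|²y + (a nonnegative term), whence y ≥ c e^{t|ξ|}. Hölder's inequality against
e^{⟨x,ξ⟩ - t|ξ|}, integrated over 1 ≤ |ξ| ≤ 2, turns this into the seed ∫|u|^q ≥ δ t^{(n-1)(1-q/2)}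
(`exists_le_integral_rpow`): inside the cone this weight has mass at most of order t^{(n-1)/2} in x
but t^{-(n-1)/2} in ξ. At ξ = 0 the same moments give U'' = g₁ ∗ B and V'' = g₂ ∗ A for U = ∫u, V =
∫v, A = ∫|u|^q, B = ∫|v|^p, while Hölder on the ball of radius t + R bounds A below by
t^{-n(q-1)}|U|^q and B by t^{-n(p-1)}|V|^p. These facts are collected in `IsMemorySystem`.

Fix τ and run this loop on windows [τ(1-2^{-j-1}), τ]. Each turn raises a lower bound m for B to the
power pq, up to geometric losses. Since B(τ) is finite, the first bound cannot be large, and in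
logarithms this reads q ln G₁ + ln G₂ + (2q + 1/p + 3 - (n-1)/2·(pq-1)) ln τ ≤ K with K independent
of τ (`IsMemorySystem.exists_log_le`). Here G_k measures the mass of g_k through ∫₀ˢ g_k ≥ G_k s³/τ²
on [0, τ]. Nonincreasing kernels allow G_k = g_k(τ), and slow decay makes the left side at least ln
𝓛_r(τ) plus a constant, which is unbounded. Kernels with g_k''(0) > 0 allow G_k = c_k/τ, and the
coefficient of ln τ becomes q + 2 + 1/p - (n-1)/2·(pq-1). Exchanging the components gives the other
member of each maximum. -/

/-! ### Test functions and their images in L² -/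

/-- Smooth compactly supported functions on `ℝⁿ`. -/
structure TestFun (n : ℕ) where
  toFun : EucSp n → ℝ
  smooth : ContDiff ℝ ∞ toFun
  compact : HasCompactSupport toFun

/-- `L²(ℝⁿ; F)`. -/
abbrev L2Sp (n : ℕ) (F : Type) [NormedAddCommGroup F] : Type :=
  Lp F 2 (volume : Measure (EucSp n))

/-- `D` is the weak gradient of `w`, tested in each direction separately. -/
def IsWeakGrad {n : ℕ} (w : EucSp n → ℝ) (D : EucSp n → EucSp n) : Prop :=
  ∀ (φ : TestFun n) (e : EucSp n),
    ∫ x, w x * fderiv ℝ φ.toFun x e = -∫ x, φ.toFun x * inner ℝ (D x) e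

theorem contDiff_gradient {n : ℕ} {f : EucSp n → ℝ} (hf : ContDiff ℝ ∞ f) :
    ContDiff ℝ ∞ (gradient f) := by
  have h : ContDiff ℝ ∞ (fderiv ℝ f) := hf.fderiv_right (by simp)
  exact ((InnerProductSpace.toDual ℝ (EucSp n)).symm.contDiff).comp h

theorem HasCompactSupport.gradient {n : ℕ} {f : EucSp n → ℝ} (hf : HasCompactSupport f) :
    HasCompactSupport (gradient f) := by
  have h : HasCompactSupport (fderiv ℝ f) := hf.fderiv ℝ
  exact h.comp_left (g := (InnerProductSpace.toDual ℝ (EucSp n)).symm) (map_zero _)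

namespace TestFun

variable {n : ℕ}

theorem memLp (φ : TestFun n) (r : ENNReal) : MemLp φ.toFun r volume :=
  φ.smooth.continuous.memLp_of_hasCompactSupport φ.compact

theorem memLp_gradient (φ : TestFun n) (r : ENNReal) : MemLp (gradient φ.toFun) r volume :=
  (contDiff_gradient φ.smooth).continuous.memLp_of_hasCompactSupport φ.compact.gradient

/-- A test function as an element of `L²`. -/
noncomputable def toL2 (φ : TestFun n) : L2Sp n ℝ := (φ.memLp 2).toLp

/-- The gradient of a test function as an element of `L²`. -/
noncomputable def gradL2 (φ : TestFun n) : L2Sp n (EucSp n) := (φ.memLp_gradient 2).toLp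

theorem coeFn_toL2 (φ : TestFun n) : φ.toL2 =ᵐ[volume] φ.toFun := (φ.memLp 2).coeFn_toLp

theorem coeFn_gradL2 (φ : TestFun n) : φ.gradL2 =ᵐ[volume] gradient φ.toFun :=
  (φ.memLp_gradient 2).coeFn_toLp

/-- The directional derivative of a test function. -/
noncomputable def dir (φ : TestFun n) (e : EucSp n) : TestFun n where
  toFun x := fderiv ℝ φ.toFun x e
  smooth := (φ.smooth.fderiv_right (m := ∞) (by simp)).clm_apply contDiff_const
  compact := by
    have h : HasCompactSupport (fderiv ℝ φ.toFun) := φ.compact.fderiv ℝ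
    exact h.comp_left (g := fun L : EucSp n →L[ℝ] ℝ => L e) rfl

/-- The product of a test function and a smooth function. -/
def mul (φ : TestFun n) (a : EucSp n → ℝ) (ha : ContDiff ℝ ∞ a) : TestFun n where
  toFun x := a x * φ.toFun x
  smooth := ha.mul φ.smooth
  compact := φ.compact.mul_left

theorem inner_toL2 (φ : TestFun n) (w : L2Sp n ℝ) :
    inner ℝ w φ.toL2 = ∫ x, w x * φ.toFun x := by
  rw [L2.inner_def]
  apply integral_congr_ae
  filter_upwards [φ.coeFn_toL2] with x hx
  simp [hx, mul_comm]

theorem inner_gradL2 (φ : TestFun n) (D : L2Sp n (EucSp n)) :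
    inner ℝ D φ.gradL2 = ∫ x, inner ℝ (D x) (gradient φ.toFun x) := by
  rw [L2.inner_def]
  apply integral_congr_ae
  filter_upwards [φ.coeFn_gradL2] with x hx
  simp [hx]

end TestFun

/-! ### Weak gradients, direction by direction -/

variable {n : ℕ}

theorem IsWeakGrad.congr {w w' : EucSp n → ℝ} {D D' : EucSp n → EucSp n} (h : IsWeakGrad w D)
    (hw : w =ᵐ[volume] w') (hD : D =ᵐ[volume] D') : IsWeakGrad w' D' := by
  intro φ e
  have h1 : ∫ x, w' x * fderiv ℝ φ.toFun x e = ∫ x, w x * fderiv ℝ φ.toFun x e := by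
    apply integral_congr_ae
    filter_upwards [hw] with x hx; simp [hx]
  have h2 : ∫ x, φ.toFun x * inner ℝ (D' x) e = ∫ x, φ.toFun x * inner ℝ (D x) e := by
    apply integral_congr_ae
    filter_upwards [hD] with x hx; simp [hx]
  rw [h1, h2]
  exact h φ e

theorem integrable_mul_of_L2 {f g : EucSp n → ℝ} (hf : MemLp f 2 volume) (hg : MemLp g 2 volume) :
    Integrable (fun x => f x * g x) volume :=
  MemLp.integrable_mul hf hg

theorem memLp_inner_const {D : EucSp n → EucSp n} (hD : MemLp D 2 volume) (e : EucSp n) :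
    MemLp (fun x => inner ℝ (D x) e) 2 volume := by
  refine (hD.norm.mul_const ‖e‖).mono ?_ ?_
  · exact hD.1.inner aestronglyMeasurable_const
  · filter_upwards with x
    simpa using abs_real_inner_le_norm (D x) e

/-- The vector identity is paired with `e`; products of L² functions are integrable, so the pairing
passes under both integrals. -/
theorem HasWeakGradient.isWeakGrad {w : EucSp n → ℝ} {D : EucSp n → EucSp n}
    (h : HasWeakGradient w D) (hw : MemLp w 2 volume) (hD : MemLp D 2 volume) :
    IsWeakGrad w D := by
  intro φ e
  have h1 := congrArg (fun z => inner ℝ e z) (h φ.toFun φ.smooth φ.compact)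
  simp only [inner_neg_right] at h1
  have i1 : Integrable (fun x => w x • gradient φ.toFun x) volume := by
    rw [← memLp_one_iff_integrable]
    exact (φ.memLp_gradient 2).smul hw
  have i2 : Integrable (fun x => φ.toFun x • D x) volume := by
    rw [← memLp_one_iff_integrable]
    exact hD.smul (φ.memLp 2)
  rw [← integral_inner i1, ← integral_inner i2] at h1
  simp only [inner_smul_right] at h1
  have e1 : ∀ x, inner ℝ e (gradient φ.toFun x) = fderiv ℝ φ.toFun x e := fun x => by
    rw [real_inner_comm, inner_gradient_left]
  have e2 : ∀ x, inner ℝ e (D x) = inner ℝ (D x) e := fun x => real_inner_comm _ _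
  simp only [e1, e2] at h1
  exact h1

/-- Leibniz rule, obtained by testing with `a φ`. No bound on `a` is needed because `φ` has compact
support. -/
theorem IsWeakGrad.mul_smooth {w : EucSp n → ℝ} {D : EucSp n → EucSp n} (h : IsWeakGrad w D)
    (hw : MemLp w 2 volume) (hD : MemLp D 2 volume) {a : EucSp n → ℝ} (ha : ContDiff ℝ ∞ a) :
    IsWeakGrad (fun x => a x * w x) (fun x => a x • D x + w x • gradient a x) := by
  intro φ e
  have h1 := h (φ.mul a ha) e
  have e1 : ∀ x, fderiv ℝ (φ.mul a ha).toFun x e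
      = a x * fderiv ℝ φ.toFun x e + φ.toFun x * fderiv ℝ a x e := by
    intro x
    have := fderiv_fun_mul (ha.differentiable (by simp) x) (φ.smooth.differentiable (by simp) x)
    simp only [TestFun.mul]
    rw [this]
    simp
  have hda : Continuous fun x => fderiv ℝ a x e :=
    (ha.continuous_fderiv (by simp)).clm_apply continuous_const
  have i1 : Integrable (fun x => w x * (a x * fderiv ℝ φ.toFun x e)) volume :=
    integrable_mul_of_L2 hw (((φ.dir e).mul a ha).memLp 2)
  have i2 : Integrable (fun x => w x * (φ.toFun x * fderiv ℝ a x e)) volume :=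
    integrable_mul_of_L2 hw ((φ.smooth.continuous.mul hda).memLp_of_hasCompactSupport
      φ.compact.mul_right)
  have i3 : Integrable (fun x => (a x * φ.toFun x) * inner ℝ (D x) e) volume :=
    integrable_mul_of_L2 ((φ.mul a ha).memLp 2) (memLp_inner_const hD e)
  simp only [e1, mul_add] at h1
  rw [integral_add i1 i2] at h1
  have e2 : ∀ x, φ.toFun x * inner ℝ (a x • D x + w x • gradient a x) e
      = (a x * φ.toFun x) * inner ℝ (D x) e + w x * (φ.toFun x * fderiv ℝ a x e) := by
    intro x
    rw [inner_add_left, inner_smul_left, inner_smul_left, inner_gradient_left]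
    simp; ring
  simp only [e2]
  rw [integral_add i3 i2]
  have e3 : ∀ x, a x * w x * fderiv ℝ φ.toFun x e = w x * (a x * fderiv ℝ φ.toFun x e) := by
    intro x; ring
  simp only [e3]
  simp only [TestFun.mul] at h1
  linarith

theorem IsWeakGrad.add {w w' : EucSp n → ℝ} {D D' : EucSp n → EucSp n} (h : IsWeakGrad w D)
    (h' : IsWeakGrad w' D') (hw : MemLp w 2 volume) (hD : MemLp D 2 volume)
    (hw' : MemLp w' 2 volume) (hD' : MemLp D' 2 volume) :
    IsWeakGrad (fun x => w x + w' x) (fun x => D x + D' x) := by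
  intro φ e
  simp only [add_mul, inner_add_left, mul_add]
  have i1 : Integrable (fun x => w x * fderiv ℝ φ.toFun x e) volume :=
    integrable_mul_of_L2 hw ((φ.dir e).memLp 2)
  have i2 : Integrable (fun x => w' x * fderiv ℝ φ.toFun x e) volume :=
    integrable_mul_of_L2 hw' ((φ.dir e).memLp 2)
  rw [integral_add i1 i2,
    integral_add (integrable_mul_of_L2 (φ.memLp 2) (memLp_inner_const hD e))
    (integrable_mul_of_L2 (φ.memLp 2) (memLp_inner_const hD' e)), h φ e, h' φ e]
  ring

theorem IsWeakGrad.const_smul {w : EucSp n → ℝ} {D : EucSp n → EucSp n} (h : IsWeakGrad w D)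
    (c : ℝ) : IsWeakGrad (fun x => c * w x) (fun x => c • D x) := by
  intro φ e
  simp only [real_inner_smul_left, mul_assoc, integral_const_mul, h φ e]
  have : ∀ x, φ.toFun x * (c * inner ℝ (D x) e) = c * (φ.toFun x * inner ℝ (D x) e) := by
    intro x; ring
  simp only [this, integral_const_mul]
  ring

theorem IsWeakGrad.Lp_sub {W W' : L2Sp n ℝ} {D D' : L2Sp n (EucSp n)} (h : IsWeakGrad W D)
    (h' : IsWeakGrad W' D') : IsWeakGrad (W - W' : L2Sp n ℝ) (D - D' : L2Sp n (EucSp n)) := by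
  have h2 := (h.add (h'.const_smul (-1)) (Lp.memLp W) (Lp.memLp D)
    ((Lp.memLp W').const_mul (-1)) ((Lp.memLp D').const_smul (-1 : ℝ)))
  refine h2.congr ?_ ?_
  · filter_upwards [Lp.coeFn_sub W W'] with x hx
    rw [hx]; simp [sub_eq_add_neg]
  · filter_upwards [Lp.coeFn_sub D D'] with x hx
    rw [hx]; simp [sub_eq_add_neg]

theorem IsWeakGrad.Lp_smul {W : L2Sp n ℝ} {D : L2Sp n (EucSp n)} (h : IsWeakGrad W D) (c : ℝ) :
    IsWeakGrad (c • W : L2Sp n ℝ) (c • D : L2Sp n (EucSp n)) := by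
  refine (h.const_smul c).congr ?_ ?_
  · filter_upwards [Lp.coeFn_smul c W] with x hx
    rw [hx]; simp
  · filter_upwards [Lp.coeFn_smul c D] with x hx
    rw [hx]; simp

/-- Pointwise multiplication by an essentially bounded function, as an operator on `L²`. -/
noncomputable def bddMul {X F G : Type} [NormedAddCommGroup X] [NormedSpace ℝ X]
    [NormedAddCommGroup F] [NormedSpace ℝ F] [NormedAddCommGroup G] [NormedSpace ℝ G]
    (B : X →L[ℝ] F →L[ℝ] G) (b : EucSp n → X) (hb : MemLp b ⊤ volume) :
    L2Sp n F →L[ℝ] L2Sp n G :=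
  B.holderL volume ⊤ 2 2 hb.toLp

theorem coeFn_bddMul {X F G : Type} [NormedAddCommGroup X] [NormedSpace ℝ X]
    [NormedAddCommGroup F] [NormedSpace ℝ F] [NormedAddCommGroup G] [NormedSpace ℝ G]
    (B : X →L[ℝ] F →L[ℝ] G) (b : EucSp n → X) (hb : MemLp b ⊤ volume) (f : L2Sp n F) :
    bddMul B b hb f =ᵐ[volume] fun x => B (b x) (f x) := by
  filter_upwards [ContinuousLinearMap.coeFn_holder (r := 2) B hb.toLp f, hb.coeFn_toLp] with x h1 h2
  rw [bddMul, ContinuousLinearMap.holderL_apply_apply, h1, h2]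

open Filter Topology

/-! ### Density of test functions in H¹ -/

section Mollification

variable {n : ℕ} {F : Type} [NormedAddCommGroup F]

/-- Translations are measure preserving and depend continuously on `y`, so composition with them is
continuous in L². -/
theorem eLpNorm_translate_sub_tendsto {f : EucSp n → F} (hf : MemLp f 2 volume) :
    Tendsto (fun y => eLpNorm (fun x => f (x - y) - f x) 2 volume) (𝓝 0) (𝓝 0) := by
  let g : EucSp n → C(EucSp n, EucSp n) := fun y => ⟨fun x => x - y, by fun_prop⟩
  have hg : Continuous g := by
    refine ContinuousMap.continuous_of_continuous_uncurry _ ?_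
    change Continuous fun z : EucSp n × EucSp n => z.2 - z.1
    fun_prop
  have hgm : ∀ y, MeasurePreserving (g y) volume volume := fun y => measurePreserving_sub_right _ y
  have h := Filter.Tendsto.compMeasurePreservingLp (l := 𝓝 (0 : EucSp n)) (p := 2)
    (f := fun _ => hf.toLp) (f₀ := hf.toLp) tendsto_const_nhds (hg.tendsto 0) hgm (hgm 0) (by simp)
  rw [tendsto_iff_edist_tendsto_0] at h
  refine h.congr fun y => ?_
  rw [Lp.edist_def]
  apply eLpNorm_congr_ae
  have h1 := Lp.coeFn_compMeasurePreserving hf.toLp (hgm y)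
  have h0 := Lp.coeFn_compMeasurePreserving hf.toLp (hgm 0)
  have h2 := (hgm y).quasiMeasurePreserving.ae_eq_comp hf.coeFn_toLp
  have h3 := (hgm 0).quasiMeasurePreserving.ae_eq_comp hf.coeFn_toLp
  filter_upwards [h1, h0, h2, h3] with x h1 h0 h2 h3
  simp only [Pi.sub_apply]
  rw [h1, h0, h2, h3]
  simp [g]

variable [NormedSpace ℝ F] [CompleteSpace F]

/-- Jensen's inequality for the square and the probability measure with density η (here `ν`), in the
form of Cauchy–Schwarz against the constant 1. -/
theorem enorm_convolution_sub_sq_le (η : ContDiffBump (0 : EucSp n)) {f : EucSp n → F}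
    (hfm : StronglyMeasurable f)
    (hf : LocallyIntegrable f volume) (x : EucSp n) :
    ‖convolution (η.normed volume) f (ContinuousLinearMap.lsmul ℝ ℝ) volume x - f x‖ₑ ^ (2 : ℝ) ≤
      ∫⁻ y, ENNReal.ofReal (η.normed volume y) * ‖f (x - y) - f x‖ₑ ^ (2 : ℝ) := by
  have hc : ConvolutionExistsAt (η.normed volume) f x (ContinuousLinearMap.lsmul ℝ ℝ) volume :=
    (η.hasCompactSupport_normed.convolutionExists_left _ η.continuous_normed hf) x
  have i1 : Integrable (fun t => η.normed volume t • f (x - t)) volume := hc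
  have i2 : Integrable (fun t => η.normed volume t • f x) volume :=
    (η.integrable_normed).smul_const _
  have e1 : convolution (η.normed volume) f (ContinuousLinearMap.lsmul ℝ ℝ) volume x - f x
      = ∫ t, η.normed volume t • (f (x - t) - f x) := by
    simp only [smul_sub]
    rw [integral_sub i1 i2, integral_smul_const, η.integral_normed, one_smul]
    rfl
  set ν : Measure (EucSp n) :=
    volume.withDensity (fun y => ENNReal.ofReal (η.normed volume y)) with hν
  have hm : Measurable (fun y => ENNReal.ofReal (η.normed volume y)) :=
    η.continuous_normed.measurable.ennreal_ofReal
  have hν1 : ν Set.univ = 1 := by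
    rw [hν, withDensity_apply _ MeasurableSet.univ, Measure.restrict_univ,
      ← ofReal_integral_eq_lintegral_ofReal η.integrable_normed
        (Eventually.of_forall fun y => η.nonneg_normed y), η.integral_normed]
    simp
  have hmeas : Measurable (fun y => ‖f (x - y) - f x‖ₑ) :=
    ((hfm.comp_measurable (measurable_const.sub measurable_id)).sub stronglyMeasurable_const).enorm
  have e2 : ‖∫ t, η.normed volume t • (f (x - t) - f x)‖ₑ ≤ ∫⁻ y, ‖f (x - y) - f x‖ₑ ∂ν := by
    refine (enorm_integral_le_lintegral_enorm _).trans (le_of_eq ?_)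
    rw [hν, lintegral_withDensity_eq_lintegral_mul _ hm hmeas]
    apply lintegral_congr
    intro y
    rw [enorm_smul, Real.enorm_of_nonneg (η.nonneg_normed y)]
    rfl
  have e3 := ENNReal.lintegral_mul_le_Lp_mul_Lq ν Real.HolderConjugate.two_two
    hmeas.aemeasurable (g := fun _ => 1) aemeasurable_const
  simp only [Pi.mul_apply, mul_one, ENNReal.one_rpow, lintegral_const, hν1] at e3
  rw [e1]
  calc _ ≤ ((∫⁻ y, ‖f (x - y) - f x‖ₑ ^ (2 : ℝ) ∂ν) ^ (1 / 2 : ℝ)) ^ (2 : ℝ) := by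
        gcongr
        exact e2.trans e3
    _ = ∫⁻ y, ‖f (x - y) - f x‖ₑ ^ (2 : ℝ) ∂ν := by
        rw [← ENNReal.rpow_mul]; norm_num
    _ = _ := by
        rw [hν, lintegral_withDensity_eq_lintegral_mul _ hm (hmeas.pow_const _)]
        rfl

theorem eLpNorm_two_rpow {α : Type*} [MeasurableSpace α] {μ : Measure α} {G : Type*}
    [NormedAddCommGroup G] (f : α → G) :
    eLpNorm f 2 μ ^ (2 : ℝ) = ∫⁻ x, ‖f x‖ₑ ^ (2 : ℝ) ∂μ := by
  rw [eLpNorm_eq_lintegral_rpow_enorm_toReal (by simp) (by simp), ← ENNReal.rpow_mul]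
  norm_num

/-- The pointwise Jensen bound is integrated in x and Tonelli leaves an average of translation
errors over the support of η. The threshold `δ` works for every narrow bump, so one bump can later
serve a function and its gradient. -/
theorem exists_bump_eLpNorm_convolution_sub_le {f : EucSp n → F} (hfm : StronglyMeasurable f)
    (hf : MemLp f 2 volume) {ε : ENNReal} (hε : 0 < ε) :
    ∃ δ : ℝ, 0 < δ ∧ ∀ η : ContDiffBump (0 : EucSp n), η.rOut < δ →
      eLpNorm (fun x => convolution (η.normed volume) f (ContinuousLinearMap.lsmul ℝ ℝ) volume x
        - f x) 2 volume ≤ ε := by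
  have h := (eLpNorm_translate_sub_tendsto hf).eventually (Iic_mem_nhds hε)
  rw [Metric.eventually_nhds_iff] at h
  obtain ⟨δ, hδ, h⟩ := h
  refine ⟨δ, hδ, fun η hη => ?_⟩
  rw [← ENNReal.rpow_le_rpow_iff (z := 2) (by norm_num), eLpNorm_two_rpow]
  have hm : Measurable (fun y => ENNReal.ofReal (η.normed volume y)) :=
    η.continuous_normed.measurable.ennreal_ofReal
  have hm2 : Measurable (fun z : EucSp n × EucSp n => ‖f (z.1 - z.2) - f z.1‖ₑ) :=
    ((hfm.comp_measurable (measurable_fst.sub measurable_snd)).sub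
      (hfm.comp_measurable measurable_fst)).enorm
  calc _ ≤ ∫⁻ x, ∫⁻ y, ENNReal.ofReal (η.normed volume y) * ‖f (x - y) - f x‖ₑ ^ (2 : ℝ) :=
        lintegral_mono fun x => enorm_convolution_sub_sq_le η hfm
          (hf.locallyIntegrable (by norm_num)) x
    _ = ∫⁻ y, ∫⁻ x, ENNReal.ofReal (η.normed volume y) * ‖f (x - y) - f x‖ₑ ^ (2 : ℝ) := by
        apply lintegral_lintegral_swap
        exact ((hm.comp measurable_snd).mul (hm2.pow_const _)).aemeasurable
    _ ≤ ∫⁻ y, ENNReal.ofReal (η.normed volume y) * ε ^ (2 : ℝ) := by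
        apply lintegral_mono
        intro y
        simp only
        have hm3 : Measurable (fun x => ‖f (x - y) - f x‖ₑ) :=
          hm2.comp (measurable_id.prodMk measurable_const)
        rw [lintegral_const_mul _ (hm3.pow_const _)]
        by_cases hy : ‖y‖ < δ
        · gcongr
          have := h (y := y) (by simpa using hy)
          rw [← eLpNorm_two_rpow (fun x => f (x - y) - f x)]
          gcongr
        · have : η.normed volume y = 0 := by
            rw [← Function.notMem_support, η.support_normed_eq]
            simp only [Metric.mem_ball, dist_zero_right, not_lt]
            push Not at hy
            linarith
          simp [this]
    _ = ε ^ (2 : ℝ) := by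
        rw [lintegral_mul_const _ hm, ← ofReal_integral_eq_lintegral_ofReal η.integrable_normed
        (Eventually.of_forall fun y => η.nonneg_normed y), η.integral_normed]
        simp

end Mollification

variable {n : ℕ}

/-- The reflected translate `y ↦ η (x - y)` of a bump function. -/
noncomputable def bumpReflect (η : ContDiffBump (0 : EucSp n)) (x : EucSp n) : TestFun n where
  toFun y := η.normed volume (x - y)
  smooth := η.contDiff_normed.comp (contDiff_const.sub contDiff_id)
  compact := η.hasCompactSupport_normed.comp_homeomorph (Homeomorph.subLeft x)

/-- The derivative falls on the bump, and y ↦ η(x - y) is an admissible test function; the sign from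
the reflection cancels the sign in the definition of the weak gradient. -/
theorem IsWeakGrad.gradient_convolution {w : EucSp n → ℝ} {D : EucSp n → EucSp n}
    (h : IsWeakGrad w D) (hw : MemLp w 2 volume) (hD : MemLp D 2 volume)
    (η : ContDiffBump (0 : EucSp n)) (x : EucSp n) :
    gradient (convolution (η.normed volume) w (ContinuousLinearMap.lsmul ℝ ℝ) volume) x =
      convolution (η.normed volume) D (ContinuousLinearMap.lsmul ℝ ℝ) volume x := by
  have hwl : LocallyIntegrable w volume := hw.locallyIntegrable (by norm_num)
  have hDl : LocallyIntegrable D volume := hD.locallyIntegrable (by norm_num)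
  have hs : ContDiff ℝ 1 (η.normed volume) := η.contDiff_normed
  refine ext_inner_right ℝ fun e => ?_
  rw [inner_gradient_left, (η.hasCompactSupport_normed.hasFDerivAt_convolution_left _ hs hwl
    x).fderiv]
  have hexi : ConvolutionExistsAt (fderiv ℝ (η.normed volume)) w x
      (ContinuousLinearMap.precompL (EucSp n) (ContinuousLinearMap.lsmul ℝ ℝ)) volume := by
    have hc : HasCompactSupport (fderiv ℝ (η.normed (volume : Measure (EucSp n)))) :=
      η.hasCompactSupport_normed.fderiv ℝ
    exact hc.convolutionExists_left _ (hs.continuous_fderiv (by simp)) hwl x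
  have hexD : ConvolutionExistsAt (η.normed volume) D x (ContinuousLinearMap.lsmul ℝ ℝ) volume :=
    (η.hasCompactSupport_normed.convolutionExists_left _ η.continuous_normed hDl) x
  rw [convolution, convolution, ContinuousLinearMap.integral_apply hexi, real_inner_comm,
    ← integral_inner hexD]
  rw [← integral_sub_left_eq_self _ volume x, ← integral_sub_left_eq_self (fun a => inner ℝ e _) volume x]
  have h1 := h (bumpReflect η x) e
  have e1 : ∀ y, fderiv ℝ (bumpReflect η x).toFun y e = - fderiv ℝ (η.normed volume) (x - y) e := by
    intro y
    have hd : HasFDerivAt (η.normed volume) (fderiv ℝ (η.normed volume) (x - y)) (x - y) :=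
      (hs.differentiable (by simp) _).hasFDerivAt
    have := hd.comp y ((hasFDerivAt_const x y).sub (hasFDerivAt_id y))
    have h3 : fderiv ℝ (bumpReflect η x).toFun y = _ := this.fderiv
    rw [h3]
    simp
  simp only [e1] at h1
  simp only [mul_neg, integral_neg, neg_inj] at h1
  simp only [ContinuousLinearMap.precompL_apply, ContinuousLinearMap.lsmul_apply, sub_sub_cancel,
    smul_eq_mul, inner_smul_right]
  convert h1 using 3 with y y
  · exact mul_comm _ _
  · rw [real_inner_comm]
    rfl

theorem IsWeakGrad.exists_testFun_of_compact {w : EucSp n → ℝ} {D : EucSp n → EucSp n}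
    (h : IsWeakGrad w D) (hw : MemLp w 2 volume) (hD : MemLp D 2 volume)
    (hwm : StronglyMeasurable w) (hDm : StronglyMeasurable D)
    (hc : HasCompactSupport w) {ε : ENNReal} (hε : 0 < ε) :
    ∃ φ : TestFun n, eLpNorm (fun x => φ.toFun x - w x) 2 volume ≤ ε ∧
      eLpNorm (fun x => gradient φ.toFun x - D x) 2 volume ≤ ε := by
  obtain ⟨δ₁, hδ₁, h₁⟩ := exists_bump_eLpNorm_convolution_sub_le hwm hw hε
  obtain ⟨δ₂, hδ₂, h₂⟩ := exists_bump_eLpNorm_convolution_sub_le hDm hD hε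
  have hδ : 0 < min δ₁ δ₂ := lt_min hδ₁ hδ₂
  let η : ContDiffBump (0 : EucSp n) := ⟨min δ₁ δ₂ / 4, min δ₁ δ₂ / 2, by linarith, by linarith⟩
  have hη : η.rOut < min δ₁ δ₂ := by simp only [η]; linarith
  refine ⟨⟨convolution (η.normed volume) w (ContinuousLinearMap.lsmul ℝ ℝ) volume, ?_, ?_⟩, ?_, ?_⟩
  · exact η.hasCompactSupport_normed.contDiff_convolution_left _ η.contDiff_normed
      (hw.locallyIntegrable (by norm_num))
  · exact η.hasCompactSupport_normed.convolution _ hc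
  · exact h₁ η (hη.trans_le (min_le_left _ _))
  · simp only [h.gradient_convolution hw hD η]
    exact h₂ η (hη.trans_le (min_le_right _ _))

/-- A smooth cutoff function equal to `1` on the unit ball. -/
noncomputable def unitCutoff (n : ℕ) : ContDiffBump (0 : EucSp n) := ⟨1, 2, by norm_num, by norm_num⟩

/-- The cutoff function at scale `k + 1`. -/
noncomputable def cutoff (n : ℕ) (k : ℕ) : TestFun n where
  toFun x := unitCutoff n (((k : ℝ) + 1)⁻¹ • x)
  smooth := (unitCutoff n).contDiff.comp (contDiff_const_smul _)
  compact := (unitCutoff n).hasCompactSupport.comp_smul (by positivity)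

theorem cutoff_eq_one {k : ℕ} {x : EucSp n} (hx : ‖x‖ ≤ k + 1) : (cutoff n k).toFun x = 1 := by
  apply (unitCutoff n).one_of_mem_closedBall
  simp only [unitCutoff, mem_closedBall_zero_iff, norm_smul, norm_inv]
  rw [Real.norm_of_nonneg (by positivity)]
  rw [inv_mul_le_iff₀ (by positivity)]
  linarith

theorem cutoff_nonneg (k : ℕ) (x : EucSp n) : 0 ≤ (cutoff n k).toFun x := (unitCutoff n).nonneg

theorem cutoff_le_one (k : ℕ) (x : EucSp n) : (cutoff n k).toFun x ≤ 1 := (unitCutoff n).le_one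

theorem exists_norm_gradient_cutoff_le (n : ℕ) :
    ∃ C : ℝ, ∀ k x, ‖gradient (cutoff n k).toFun x‖ ≤ C / (k + 1) := by
  have hs : ContDiff ℝ 1 (unitCutoff n) := (unitCutoff n).contDiff
  have hc : HasCompactSupport (fderiv ℝ (unitCutoff n)) :=
    (unitCutoff n).hasCompactSupport.fderiv ℝ
  obtain ⟨C, hC⟩ := hc.exists_bound_of_continuous (hs.continuous_fderiv (by simp))
  refine ⟨C, fun k x => ?_⟩
  have h1 : fderiv ℝ (cutoff n k).toFun x
      = ((k : ℝ) + 1)⁻¹ • fderiv ℝ (unitCutoff n) (((k : ℝ) + 1)⁻¹ • x) :=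
    fderiv_comp_smul (f := unitCutoff n) _
  rw [gradient, LinearIsometryEquiv.norm_map, h1, norm_smul, norm_inv,
    Real.norm_of_nonneg (by positivity), div_eq_inv_mul]
  gcongr
  exact hC _

theorem tendsto_eLpNorm_two_of_dominated {F G : Type*} [NormedAddCommGroup F]
    [NormedAddCommGroup G] {f : ℕ → EucSp n → F} {g : EucSp n → G} (hf : ∀ k, AEStronglyMeasurable (f k) volume)
    (hg : MemLp g 2 volume) (C : NNReal) (hb : ∀ k x, ‖f k x‖ₑ ≤ C * ‖g x‖ₑ)
    (hl : ∀ x, Tendsto (fun k => f k x) atTop (𝓝 0)) :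
    Tendsto (fun k => eLpNorm (f k) 2 volume) atTop (𝓝 0) := by
  have h : Tendsto (fun k => ∫⁻ x, ‖f k x‖ₑ ^ (2 : ℝ)) atTop (𝓝 (∫⁻ _ : EucSp n, 0)) := by
    refine tendsto_lintegral_of_dominated_convergence' (fun x => (C * ‖g x‖ₑ) ^ (2 : ℝ)) ?_ ?_ ?_ ?_
    · exact fun k => (hf k).enorm.pow_const _
    · exact fun k => Eventually.of_forall fun x => ENNReal.rpow_le_rpow (hb k x) (by norm_num)
    · simp only [ENNReal.mul_rpow_of_nonneg _ _ (zero_le_two (α := ℝ))]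
      rw [lintegral_const_mul' _ _ (by simp), ← eLpNorm_two_rpow]
      exact ENNReal.mul_ne_top (by simp) (ENNReal.rpow_ne_top_of_nonneg (by norm_num) hg.2.ne)
    · refine Eventually.of_forall fun x => ?_
      have h1 := ((hl x).enorm).ennrpow_const 2
      simpa using h1
  simp only [← eLpNorm_two_rpow, lintegral_zero] at h
  have h1 := h.ennrpow_const (1 / 2)
  simp only [← ENNReal.rpow_mul] at h1
  norm_num at h1
  exact h1

/-- Cutting off at scale k + 1 reduces to compact support. The product rule produces the error
w∇χ_k, which is small in L² because ∇χ_k is at most C/(k + 1). Three errors of size ε/3 add up. -/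
theorem IsWeakGrad.exists_testFun {w : EucSp n → ℝ} {D : EucSp n → EucSp n}
    (h : IsWeakGrad w D) (hw : MemLp w 2 volume) (hD : MemLp D 2 volume)
    (hwm : StronglyMeasurable w) (hDm : StronglyMeasurable D) {ε : ENNReal} (hε : 0 < ε) :
    ∃ φ : TestFun n, eLpNorm (fun x => φ.toFun x - w x) 2 volume ≤ ε ∧
      eLpNorm (fun x => gradient φ.toFun x - D x) 2 volume ≤ ε := by
  obtain ⟨C, hC⟩ := exists_norm_gradient_cutoff_le n
  have hC0 : 0 ≤ C := by
    have := (norm_nonneg _).trans (hC 0 0)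
    simpa using this
  have hcm : ∀ k, StronglyMeasurable (cutoff n k).toFun := fun k =>
    (cutoff n k).smooth.continuous.stronglyMeasurable
  have hgm : ∀ k, StronglyMeasurable (gradient (cutoff n k).toFun) := fun k =>
    (contDiff_gradient (cutoff n k).smooth).continuous.stronglyMeasurable
  have hone : ∀ x : EucSp n, ∀ᶠ k : ℕ in atTop, (cutoff n k).toFun x = 1 := by
    intro x
    filter_upwards [eventually_ge_atTop ⌈‖x‖⌉₊] with k hk
    apply cutoff_eq_one
    have := (Nat.le_ceil ‖x‖).trans (Nat.cast_le.mpr hk)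
    linarith
  have t1 : Tendsto (fun k => eLpNorm (fun x => (cutoff n k).toFun x * w x - w x) 2 volume)
      atTop (𝓝 0) := by
    refine tendsto_eLpNorm_two_of_dominated
      (fun k => (((hcm k).mul hwm).sub hwm).aestronglyMeasurable) hw 1 ?_ ?_
    · intro k x
      have : (cutoff n k).toFun x * w x - w x = ((cutoff n k).toFun x - 1) * w x := by ring
      rw [this, enorm_mul]
      gcongr
      rw [← ofReal_norm]
      simp only [ENNReal.coe_one, ENNReal.ofReal_le_one, Real.norm_eq_abs, abs_le]
      constructor <;> linarith [cutoff_nonneg k x, cutoff_le_one k x]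
    · intro x
      refine tendsto_const_nhds.congr' ?_
      filter_upwards [hone x] with k hk
      simp [hk]
  have t2 : Tendsto (fun k => eLpNorm (fun x => (cutoff n k).toFun x • D x - D x) 2 volume)
      atTop (𝓝 0) := by
    refine tendsto_eLpNorm_two_of_dominated
      (fun k => (((hcm k).smul hDm).sub hDm).aestronglyMeasurable) hD 1 ?_ ?_
    · intro k x
      have : (cutoff n k).toFun x • D x - D x = ((cutoff n k).toFun x - 1) • D x := by
        rw [sub_smul, one_smul]
      rw [this, enorm_smul]
      gcongr
      rw [← ofReal_norm]
      simp only [ENNReal.coe_one, ENNReal.ofReal_le_one, Real.norm_eq_abs, abs_le]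
      constructor <;> linarith [cutoff_nonneg k x, cutoff_le_one k x]
    · intro x
      refine tendsto_const_nhds.congr' ?_
      filter_upwards [hone x] with k hk
      simp [hk]
  have t3 : Tendsto (fun k => eLpNorm (fun x => w x • gradient (cutoff n k).toFun x) 2 volume)
      atTop (𝓝 0) := by
    have hb : ∀ k x, ‖w x • gradient (cutoff n k).toFun x‖ ≤ C / (k + 1) * ‖w x‖ := by
      intro k x
      rw [norm_smul, mul_comm]
      gcongr
      exact hC k x
    refine tendsto_eLpNorm_two_of_dominated (g := w)
      (fun k => (hwm.smul (hgm k)).aestronglyMeasurable) hw C.toNNReal ?_ ?_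
    · intro k x
      rw [← ofReal_norm, ← ofReal_norm]
      change _ ≤ ENNReal.ofReal C * _
      rw [← ENNReal.ofReal_mul hC0]
      apply ENNReal.ofReal_le_ofReal
      refine (hb k x).trans ?_
      gcongr
      exact div_le_self hC0 (by linarith [(Nat.cast_nonneg k : (0 : ℝ) ≤ k)])
    · intro x
      refine squeeze_zero_norm (fun k => hb k x) ?_
      have : Tendsto (fun k : ℕ => C / ((k : ℝ) + 1)) atTop (𝓝 0) :=
        (tendsto_const_div_atTop_nhds_zero_nat C).comp (tendsto_add_atTop_nat 1) |>.congr
          fun k => by simp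
      simpa using this.mul_const ‖w x‖
  have hε3 : 0 < ε / 3 := ENNReal.div_pos hε.ne' (by simp)
  obtain ⟨k, k1, k2, k3⟩ := ((t1.eventually (Iic_mem_nhds hε3)).and
    ((t2.eventually (Iic_mem_nhds hε3)).and (t3.eventually (Iic_mem_nhds hε3)))).exists
  have hwk : MemLp (fun x => (cutoff n k).toFun x * w x) 2 volume := by
    refine hw.mono ((hcm k).mul hwm).aestronglyMeasurable (Eventually.of_forall fun x => ?_)
    rw [norm_mul, Real.norm_of_nonneg (cutoff_nonneg k x)]
    exact mul_le_of_le_one_left (norm_nonneg _) (cutoff_le_one k x)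
  have hDk1 : MemLp (fun x => (cutoff n k).toFun x • D x) 2 volume := by
    refine hD.mono ((hcm k).smul hDm).aestronglyMeasurable (Eventually.of_forall fun x => ?_)
    rw [norm_smul, Real.norm_of_nonneg (cutoff_nonneg k x)]
    exact mul_le_of_le_one_left (norm_nonneg _) (cutoff_le_one k x)
  have hDk2 : MemLp (fun x => w x • gradient (cutoff n k).toFun x) 2 volume := by
    refine (hw.const_mul (C / (k + 1))).mono (hwm.smul (hgm k)).aestronglyMeasurable
      (Eventually.of_forall fun x => ?_)
    rw [norm_smul, norm_mul, mul_comm, Real.norm_of_nonneg (by positivity : 0 ≤ C / ((k : ℝ) + 1))]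
    gcongr
    exact hC k x
  obtain ⟨φ, h1, h2⟩ := (h.mul_smooth hw hD (cutoff n k).smooth).exists_testFun_of_compact hwk
    (hDk1.add hDk2) ((hcm k).mul hwm) (((hcm k).smul hDm).add (hwm.smul (hgm k)))
    ((cutoff n k).compact.mul_right) hε3
  have hq : ε / 3 + ε / 3 + ε / 3 ≤ ε := (ENNReal.add_thirds ε).le
  refine ⟨φ, ?_, ?_⟩
  · have e : (fun x => φ.toFun x - w x) = (fun x => φ.toFun x - (cutoff n k).toFun x * w x)
        + (fun x => (cutoff n k).toFun x * w x - w x) := by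
      ext x; simp
    rw [e]
    refine (eLpNorm_add_le ((φ.memLp 2).sub hwk).1 (hwk.sub hw).1 (by norm_num)).trans ?_
    refine (add_le_add h1 k1).trans ((le_self_add).trans hq)
  · have e : (fun x => gradient φ.toFun x - D x) =
        (fun x => gradient φ.toFun x - ((cutoff n k).toFun x • D x
          + w x • gradient (cutoff n k).toFun x))
        + (fun x => (cutoff n k).toFun x • D x - D x)
        + (fun x => w x • gradient (cutoff n k).toFun x) := by
      ext1 x; simp only [Pi.add_apply]; abel
    rw [e]
    refine (eLpNorm_add_le (((φ.memLp_gradient 2).sub (hDk1.add hDk2)).1.add (hDk1.sub hD).1)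
      hDk2.1 (by norm_num)).trans ?_
    refine (add_le_add (eLpNorm_add_le ((φ.memLp_gradient 2).sub (hDk1.add hDk2)).1
      (hDk1.sub hD).1 (by norm_num)) k3).trans ?_
    exact (add_le_add (add_le_add h2 k2) le_rfl).trans hq

/-- Test functions are dense in `H¹`. -/
theorem IsWeakGrad.exists_approx {W : L2Sp n ℝ} {D : L2Sp n (EucSp n)} (h : IsWeakGrad W D)
    {ε : ℝ} (hε : 0 < ε) : ∃ φ : TestFun n, ‖φ.toL2 - W‖ ≤ ε ∧ ‖φ.gradL2 - D‖ ≤ ε := by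
  obtain ⟨φ, h1, h2⟩ := h.exists_testFun (Lp.memLp W) (Lp.memLp D) (Lp.stronglyMeasurable W)
    (Lp.stronglyMeasurable D) (ENNReal.ofReal_pos.mpr hε)
  refine ⟨φ, ?_, ?_⟩
  · rw [Lp.norm_def]
    refine ENNReal.toReal_le_of_le_ofReal hε.le (le_of_eq_of_le (eLpNorm_congr_ae ?_) h1)
    filter_upwards [Lp.coeFn_sub φ.toL2 W, φ.coeFn_toL2] with x h3 h4
    rw [h3, Pi.sub_apply, h4]
  · rw [Lp.norm_def]
    refine ENNReal.toReal_le_of_le_ofReal hε.le (le_of_eq_of_le (eLpNorm_congr_ae ?_) h2)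
    filter_upwards [Lp.coeFn_sub φ.gradL2 D, φ.coeFn_gradL2] with x h3 h4
    rw [h3, Pi.sub_apply, h4]

theorem IsWeakGrad.exists_seq {W : L2Sp n ℝ} {D : L2Sp n (EucSp n)} (h : IsWeakGrad W D) :
    ∃ φ : ℕ → TestFun n, Tendsto (fun k => (φ k).toL2) atTop (𝓝 W) ∧
      Tendsto (fun k => (φ k).gradL2) atTop (𝓝 D) := by
  choose φ h1 h2 using fun k : ℕ => h.exists_approx (ε := 1 / ((k : ℝ) + 1)) (by positivity)
  refine ⟨φ, ?_, ?_⟩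
  · rw [tendsto_iff_norm_sub_tendsto_zero]
    exact squeeze_zero (fun _ => norm_nonneg _) h1 tendsto_one_div_add_atTop_nhds_zero_nat
  · rw [tendsto_iff_norm_sub_tendsto_zero]
    exact squeeze_zero (fun _ => norm_nonneg _) h2 tendsto_one_div_add_atTop_nhds_zero_nat

/-! ### The Sobolev inequality H¹ → L^{2p} -/

theorem eLpNorm_ofReal_rpow {α E : Type*} [MeasurableSpace α] {μ : Measure α}
    [NormedAddCommGroup E] {f : α → E} {r : ℝ} (hr : 0 < r) :
    eLpNorm f (ENNReal.ofReal r) μ ^ r = ∫⁻ x, ‖f x‖ₑ ^ r ∂μ := by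
  rw [eLpNorm_eq_lintegral_rpow_enorm_toReal (by simpa using hr) (by simp),
    ENNReal.toReal_ofReal hr.le, ← ENNReal.rpow_mul, one_div, inv_mul_cancel₀ hr.ne',
    ENNReal.rpow_one]

/-- A crude interpolation: after normalizing by the sum `A` of the two norms, z^r ≤ z^a + z^b for
every z ≥ 0 and each term has integral at most 1. The factor 2 covers the resulting 2^{1/r}. -/
theorem eLpNorm_le_two_mul_add {α E : Type*} [MeasurableSpace α] {μ : Measure α}
    [NormedAddCommGroup E] {f : α → E} (hf : AEStronglyMeasurable f μ) {a r b : ℝ} (ha : 1 ≤ a)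
    (har : a ≤ r) (hrb : r ≤ b) :
    eLpNorm f (ENNReal.ofReal r) μ ≤
      2 * (eLpNorm f (ENNReal.ofReal a) μ + eLpNorm f (ENNReal.ofReal b) μ) := by
  have ha0 : 0 < a := by linarith
  have hr0 : 0 < r := by linarith
  have hb0 : 0 < b := by linarith
  set A := eLpNorm f (ENNReal.ofReal a) μ + eLpNorm f (ENNReal.ofReal b) μ with hA
  rcases eq_or_ne A 0 with h0 | h0
  · have h1 : eLpNorm f (ENNReal.ofReal a) μ = 0 := by
      rw [hA, add_eq_zero] at h0
      exact h0.1
    rw [eLpNorm_eq_zero_iff hf (by simpa using ha0)] at h1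
    rw [eLpNorm_congr_ae h1]
    simp
  rcases eq_or_ne A ⊤ with ht | ht
  · rw [ht]; simp
  have key : ∀ s : ℝ, 0 < s → eLpNorm f (ENNReal.ofReal s) μ ≤ A →
      ∫⁻ x, (‖f x‖ₑ / A) ^ s ∂μ ≤ 1 := by
    intro s hs hle
    simp only [div_eq_mul_inv, ENNReal.mul_rpow_of_nonneg _ _ hs.le]
    rw [lintegral_mul_const'' _ (hf.enorm.pow_const _), ← eLpNorm_ofReal_rpow hs,
      ← ENNReal.mul_rpow_of_nonneg _ _ hs.le, ← div_eq_mul_inv]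
    calc _ ≤ (1 : ENNReal) ^ s := by
          gcongr
          exact ENNReal.div_le_of_le_mul (by simpa using hle)
      _ = 1 := by simp
  have h2 : ∫⁻ x, (‖f x‖ₑ / A) ^ r ∂μ ≤ 2 := by
    calc _ ≤ ∫⁻ x, ((‖f x‖ₑ / A) ^ a + (‖f x‖ₑ / A) ^ b) ∂μ := by
          refine lintegral_mono fun x => ?_
          rcases le_total (‖f x‖ₑ / A) 1 with h | h
          · exact (ENNReal.rpow_le_rpow_of_exponent_ge h har).trans le_self_add
          · exact (ENNReal.rpow_le_rpow_of_exponent_le h hrb).trans le_add_self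
      _ = _ := lintegral_add_left' ((hf.enorm.div_const _).pow_const _) _
      _ ≤ 1 + 1 := add_le_add (key a ha0 le_self_add) (key b hb0 le_add_self)
      _ = 2 := by norm_num
  rw [← ENNReal.rpow_le_rpow_iff hr0, eLpNorm_ofReal_rpow hr0,
    ENNReal.mul_rpow_of_nonneg _ _ hr0.le]
  have h3 : ∀ x, ‖f x‖ₑ ^ r = (‖f x‖ₑ / A) ^ r * A ^ r := by
    intro x
    rw [← ENNReal.mul_rpow_of_nonneg _ _ hr0.le, ENNReal.div_mul_cancel h0 ht]
  simp only [h3]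
  rw [lintegral_mul_const' _ _ (ENNReal.rpow_ne_top_of_nonneg hr0.le ht)]
  gcongr
  refine h2.trans ?_
  calc (2 : ENNReal) = 2 ^ (1 : ℝ) := by simp
    _ ≤ 2 ^ r := ENNReal.rpow_le_rpow_of_exponent_le (by norm_num) (by linarith)

theorem enorm_gradient {n : ℕ} (f : EucSp n → ℝ) (x : EucSp n) :
    ‖gradient f x‖ₑ = ‖fderiv ℝ f x‖ₑ := by
  rw [gradient, LinearIsometryEquiv.enorm_map]

theorem eLpNorm_gradient {n : ℕ} (f : EucSp n → ℝ) (r : ENNReal) :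
    eLpNorm (gradient f) r volume = eLpNorm (fderiv ℝ f) r volume :=
  eLpNorm_congr_enorm_ae (Eventually.of_forall fun x => enorm_gradient f x)

/-- The `H¹` size of a test function. -/
noncomputable def TestFun.sobolevNorm {n : ℕ} (φ : TestFun n) : ENNReal :=
  eLpNorm φ.toFun 2 volume + eLpNorm (gradient φ.toFun) 2 volume

/-- Gagliardo–Nirenberg–Sobolev gives the endpoint 2n/(n-2), and 2 ≤ 2p ≤ 2n/(n-2) is reached by
interpolation. -/
theorem TestFun.sobolev_of_three_le {n : ℕ} (hn : 3 ≤ n) {p : ℝ} (hp : 1 < p)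
    (hpn : p ≤ (n : ℝ) / ((n : ℝ) - 2)) :
    ∃ C : NNReal, ∀ φ : TestFun n,
      eLpNorm φ.toFun (ENNReal.ofReal (2 * p)) volume ≤ C * φ.sobolevNorm := by
  have hn' : (3 : ℝ) ≤ n := by exact_mod_cast hn
  set b : ℝ := 2 * n / (n - 2) with hb
  have hb0 : 0 < b := by apply div_pos <;> linarith
  have hfin : Module.finrank ℝ (EucSp n) = n := by simp
  set C := eLpNormLESNormFDerivOfEqInnerConst (volume : Measure (EucSp n)) ((2 : NNReal) : ℝ)
  have h1 : ∀ φ : TestFun n, eLpNorm φ.toFun (ENNReal.ofReal b) volume ≤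
      C * eLpNorm (gradient φ.toFun) 2 volume := by
    intro φ
    rw [eLpNorm_gradient]
    have := eLpNorm_le_eLpNorm_fderiv_of_eq_inner (volume : Measure (EucSp n)) (p := 2)
      (p' := b.toNNReal) (φ.smooth.of_le (by simp)) φ.compact (by norm_num) (by rw [hfin]; omega)
      (by
        rw [Real.coe_toNNReal _ hb0.le, hfin, hb]
        have : (n : ℝ) - 2 ≠ 0 := by linarith
        have : (n : ℝ) ≠ 0 := by linarith
        norm_num
        field_simp)
    rw [ENNReal.coe_ofNat] at this
    exact this
  refine ⟨2 * (1 + C), fun φ => ?_⟩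
  have h2 := eLpNorm_le_two_mul_add (μ := volume) (f := φ.toFun) (a := 2) (r := 2 * p) (b := b)
    (φ.memLp 2).1 (by norm_num) (by linarith) (by
      rw [hb, mul_div_assoc]; linarith)
  refine h2.trans ?_
  rw [show ENNReal.ofReal 2 = 2 by simp, TestFun.sobolevNorm]
  push_cast
  rw [mul_assoc]
  gcongr
  rw [add_mul, one_mul, mul_add]
  gcongr
  · exact le_self_add
  · exact (h1 φ).trans le_add_self

theorem eLpNorm_pow_nat {α : Type*} [MeasurableSpace α] {μ : Measure α} (f : α → ℝ) {s : ℕ}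
    (hs : 0 < s) : eLpNorm (fun x => f x ^ s) 2 μ = eLpNorm f (ENNReal.ofReal (2 * s)) μ ^ s := by
  have h := eLpNorm_norm_rpow (p := 2) (μ := μ) f (q := s) (by exact_mod_cast hs)
  rw [ENNReal.rpow_natCast] at h
  rw [ENNReal.ofReal_mul (by norm_num), ENNReal.ofReal_ofNat, ← h]
  apply eLpNorm_congr_enorm_ae
  refine Eventually.of_forall fun x => ?_
  simp [enorm_pow]

/-- In the plane ‖f‖₂ ≤ K‖∇f‖₁. Applied to f = φ^{s+2} with Cauchy–Schwarz this gives
‖φ‖_{2(s+2)}^{s+2} ≤ K(s+2)‖φ‖_{2(s+1)}^{s+1}‖∇φ‖₂, which climbs through the even exponents. -/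
theorem TestFun.sobolev_nat_of_two (s : ℕ) :
    ∃ C : NNReal, ∀ φ : TestFun 2,
      eLpNorm φ.toFun (ENNReal.ofReal (2 * (s + 1 : ℕ))) volume ≤ C * φ.sobolevNorm := by
  induction s with
  | zero =>
    refine ⟨1, fun φ => ?_⟩
    simp [TestFun.sobolevNorm]
  | succ s ih =>
    obtain ⟨C, hC⟩ := ih
    set K := eLpNormLESNormFDerivOneConst (volume : Measure (EucSp 2)) (2 : NNReal)
    -- The summand 1 makes C' ≥ 1, hence C' ≤ C'^(s+2), and no root has to be taken.
    set C' : NNReal := 1 + K * ((s + 2 : ℕ) * C ^ (s + 1)) with hC'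
    refine ⟨C', fun φ => ?_⟩
    rw [← ENNReal.pow_le_pow_left_iff (n := s + 2) (by omega)]
    rw [← eLpNorm_pow_nat _ (by omega)]
    have hg := eLpNorm_le_eLpNorm_fderiv_one (volume : Measure (EucSp 2)) (p := 2)
      (u := fun x => φ.toFun x ^ (s + 2)) ((φ.smooth.of_le (by simp)).pow _)
      (φ.compact.comp_left (g := fun t : ℝ => t ^ (s + 2)) (by simp)) (by
        simp only [finrank_euclideanSpace, Fintype.card_fin]
        exact_mod_cast NNReal.HolderConjugate.two_two)
    have hd : eLpNorm (fderiv ℝ fun x => φ.toFun x ^ (s + 2)) 1 volume ≤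
        (s + 2 : ℕ) * ((C * φ.sobolevNorm) ^ (s + 1) * φ.sobolevNorm) := by
      have e : ∀ x, ‖fderiv ℝ (fun x => φ.toFun x ^ (s + 2)) x‖ₑ =
          (s + 2 : ℕ) * (‖φ.toFun x ^ (s + 1)‖ₑ * ‖gradient φ.toFun x‖ₑ) := by
        intro x
        rw [((φ.smooth.differentiable (by simp) x).hasFDerivAt.pow (s + 2)).fderiv, enorm_smul,
          enorm_gradient, nsmul_eq_mul, enorm_mul, mul_assoc]
        congr 1
        rw [Real.enorm_of_nonneg (by positivity), ENNReal.ofReal_natCast]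
      rw [eLpNorm_one_eq_lintegral_enorm]
      simp only [e]
      rw [lintegral_const_mul' _ _ (by simp)]
      gcongr
      have h3 := ENNReal.lintegral_mul_le_Lp_mul_Lq (volume : Measure (EucSp 2))
        Real.HolderConjugate.two_two
        (φ.smooth.continuous.pow (s + 1)).enorm.aemeasurable
        (contDiff_gradient φ.smooth).continuous.enorm.aemeasurable
      refine h3.trans ?_
      rw [← eLpNorm_two_rpow, ← eLpNorm_two_rpow, ← ENNReal.rpow_mul, ← ENNReal.rpow_mul]
      norm_num
      have h5 : eLpNorm (φ.toFun ^ (s + 1)) 2 volume = _ :=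
        eLpNorm_pow_nat (μ := (volume : Measure (EucSp 2))) φ.toFun (Nat.succ_pos s)
      rw [h5]
      gcongr
      · exact hC φ
      · exact le_add_self
    refine hg.trans ?_
    calc (K : ENNReal) * eLpNorm (fderiv ℝ fun x => φ.toFun x ^ (s + 2)) 1 volume
        ≤ K * ((s + 2 : ℕ) * ((C * φ.sobolevNorm) ^ (s + 1) * φ.sobolevNorm)) := by gcongr
      _ = (K * ((s + 2 : ℕ) * C ^ (s + 1)) : NNReal) * φ.sobolevNorm ^ (s + 2) := by
          push_cast
          ring
      _ ≤ C' ^ (s + 2) * φ.sobolevNorm ^ (s + 2) := by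
          gcongr
          norm_cast
          calc _ ≤ C' := le_add_self
            _ ≤ C' ^ (s + 2) := le_self_pow₀ (by rw [hC']; exact le_self_add) (by omega)
      _ = _ := by rw [mul_pow]

theorem TestFun.sobolev_of_two {p : ℝ} (hp : 1 < p) :
    ∃ C : NNReal, ∀ φ : TestFun 2,
      eLpNorm φ.toFun (ENNReal.ofReal (2 * p)) volume ≤ C * φ.sobolevNorm := by
  obtain ⟨C, hC⟩ := TestFun.sobolev_nat_of_two ⌈p⌉₊
  refine ⟨2 * (1 + C), fun φ => ?_⟩
  have h2 := eLpNorm_le_two_mul_add (μ := volume) (f := φ.toFun) (a := 2) (r := 2 * p)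
    (b := 2 * (⌈p⌉₊ + 1 : ℕ))
    (φ.memLp 2).1 (by norm_num) (by linarith) (by
      have := Nat.le_ceil p
      push_cast
      linarith)
  refine h2.trans ?_
  rw [show ENNReal.ofReal 2 = 2 by simp]
  push_cast
  rw [mul_assoc, add_mul, one_mul]
  gcongr
  · exact le_self_add
  · exact_mod_cast hC φ

theorem measurePreserving_smul_single :
    MeasurePreserving (fun s : ℝ => s • (EuclideanSpace.single (0 : Fin 1) (1 : ℝ) : EucSp 1))
      volume volume := by
  have h1 := (volume_preserving_funUnique (Fin 1) ℝ).symm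
  have h2 := (PiLp.volume_preserving_toLp (Fin 1)).comp h1
  have e : (fun s : ℝ => s • (EuclideanSpace.single (0 : Fin 1) (1 : ℝ) : EucSp 1)) =
      (WithLp.toLp 2) ∘ (MeasurableEquiv.funUnique (Fin 1) ℝ).symm := by
    funext s
    ext i
    have : i = 0 := Subsingleton.elim _ _
    subst this
    simp
  rw [e]
  exact h2

/-- On the line φ(x)² is the integral of 2φφ' over (-∞, x], and Cauchy–Schwarz applies. -/
theorem TestFun.enorm_sq_le_of_one (φ : TestFun 1) (x : EucSp 1) :
    ‖φ.toFun x‖ₑ ^ 2 ≤ 2 * (eLpNorm φ.toFun 2 volume * eLpNorm (gradient φ.toFun) 2 volume) := by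
  set e : EucSp 1 := EuclideanSpace.single (0 : Fin 1) (1 : ℝ) with he
  have hx : x = (x 0) • e := by
    ext i
    have : i = 0 := Subsingleton.elim _ _
    subst this
    simp [he]
  have hemb : Continuous fun s : ℝ => s • e := by fun_prop
  have hcd : ContDiff ℝ 1 fun s : ℝ => φ.toFun (s • e) ^ 2 :=
    ((φ.smooth.of_le (by simp)).comp (contDiff_id.smul contDiff_const)).pow 2
  have hcs : HasCompactSupport fun s : ℝ => φ.toFun (s • e) ^ 2 := by
    refine HasCompactSupport.intro (K := (fun z : EucSp 1 => z 0) '' tsupport φ.toFun)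
      (φ.compact.isCompact.image (by fun_prop)) ?_
    intro s hs
    have : s • e ∉ tsupport φ.toFun := by
      intro h
      exact hs ⟨_, h, by simp [he]⟩
    rw [image_eq_zero_of_notMem_tsupport this]
    simp
  have h1 := hcs.enorm_le_lintegral_Ici_deriv hcd (x 0)
  have hd : ∀ s : ℝ, deriv (fun s : ℝ => φ.toFun (s • e) ^ 2) s =
      2 * (φ.toFun (s • e) * fderiv ℝ φ.toFun (s • e) e) := by
    intro s
    have h0 : HasDerivAt (fun s : ℝ => s • e) e s := by
      simpa using (hasDerivAt_id s).smul_const e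
    have h2 := ((φ.smooth.differentiable (by simp) (s • e)).hasFDerivAt.comp_hasDerivAt s h0).pow 2
    refine h2.deriv.trans ?_
    simp
    ring
  simp only at h1
  rw [← hx, enorm_pow] at h1
  have hm := measurePreserving_smul_single
  have hne : ‖e‖ₑ = 1 := by simp [he, enorm_eq_nnnorm]
  calc _ ≤ ∫⁻ s in Set.Iic (x 0), ‖deriv (fun s : ℝ => φ.toFun (s • e) ^ 2) s‖ₑ := h1
    _ ≤ ∫⁻ s : ℝ, ‖deriv (fun s : ℝ => φ.toFun (s • e) ^ 2) s‖ₑ := setLIntegral_le_lintegral _ _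
    _ ≤ ∫⁻ s : ℝ, 2 * (‖φ.toFun (s • e)‖ₑ * ‖gradient φ.toFun (s • e)‖ₑ) := by
        refine lintegral_mono fun s => ?_
        simp only [hd]
        rw [enorm_mul, enorm_mul, enorm_gradient]
        rw [Real.enorm_of_nonneg (by norm_num : (0 : ℝ) ≤ 2)]
        simp only [ENNReal.ofReal_ofNat]
        gcongr
        refine (ContinuousLinearMap.le_opENorm _ _).trans ?_
        rw [hne, mul_one]
    _ = ∫⁻ z : EucSp 1, 2 * (‖φ.toFun z‖ₑ * ‖gradient φ.toFun z‖ₑ) := by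
        refine hm.lintegral_comp (f := fun z => 2 * (‖φ.toFun z‖ₑ * ‖gradient φ.toFun z‖ₑ)) ?_
        exact (φ.smooth.continuous.enorm.measurable.mul
          (contDiff_gradient φ.smooth).continuous.enorm.measurable).const_mul _
    _ ≤ _ := by
        rw [lintegral_const_mul' _ _ (by simp)]
        gcongr
        have h3 := ENNReal.lintegral_mul_le_Lp_mul_Lq (volume : Measure (EucSp 1))
          Real.HolderConjugate.two_two
          φ.smooth.continuous.enorm.aemeasurable
          (contDiff_gradient φ.smooth).continuous.enorm.aemeasurable
        refine h3.trans (le_of_eq ?_)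
        rw [← eLpNorm_two_rpow, ← eLpNorm_two_rpow, ← ENNReal.rpow_mul, ← ENNReal.rpow_mul]
        norm_num

/-- The supremum is bounded by the H¹ size, and |φ|^{2p} ≤ (sup|φ|)^{2p-2} φ². -/
theorem TestFun.sobolev_of_one {p : ℝ} (hp : 1 < p) (φ : TestFun 1) :
    eLpNorm φ.toFun (ENNReal.ofReal (2 * p)) volume ≤ φ.sobolevNorm := by
  have hsup : ∀ x, ‖φ.toFun x‖ₑ ≤ φ.sobolevNorm := by
    intro x
    rw [← ENNReal.pow_le_pow_left_iff (n := 2) (by norm_num)]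
    refine (φ.enorm_sq_le_of_one x).trans ?_
    rw [TestFun.sobolevNorm, add_sq, ← mul_assoc]
    exact le_add_self.trans le_self_add
  have h2p : 0 < 2 * p := by linarith
  rw [← ENNReal.rpow_le_rpow_iff h2p, eLpNorm_ofReal_rpow h2p]
  calc ∫⁻ x, ‖φ.toFun x‖ₑ ^ (2 * p)
      ≤ ∫⁻ x, φ.sobolevNorm ^ (2 * p - 2) * ‖φ.toFun x‖ₑ ^ (2 : ℝ) := by
        refine lintegral_mono fun x => ?_
        simp only
        rw [show 2 * p = (2 * p - 2) + 2 by ring,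
          ENNReal.rpow_add_of_nonneg _ _ (by linarith) (by norm_num), add_sub_cancel_right]
        gcongr
        · linarith
        · exact hsup x
    _ = φ.sobolevNorm ^ (2 * p - 2) * eLpNorm φ.toFun 2 volume ^ (2 : ℝ) := by
        rw [lintegral_const_mul _ (φ.smooth.continuous.enorm.measurable.pow_const _),
          eLpNorm_two_rpow]
    _ ≤ φ.sobolevNorm ^ (2 * p - 2) * φ.sobolevNorm ^ (2 : ℝ) := by
        gcongr
        exact le_self_add
    _ = φ.sobolevNorm ^ (2 * p) := by
        rw [← ENNReal.rpow_add_of_nonneg _ _ (by linarith) (by norm_num)]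
        ring_nf

variable {n : ℕ}

theorem TestFun.exists_sobolev (hn : 1 ≤ n) {p : ℝ} (hp : 1 < p)
    (hpn : 3 ≤ n → p ≤ (n : ℝ) / ((n : ℝ) - 2)) :
    ∃ C : NNReal, ∀ φ : TestFun n,
      eLpNorm φ.toFun (ENNReal.ofReal (2 * p)) volume ≤ C * φ.sobolevNorm := by
  rcases lt_or_ge n 3 with h | h
  · interval_cases n
    · exact ⟨1, fun φ => by simpa using TestFun.sobolev_of_one hp φ⟩
    · exact TestFun.sobolev_of_two hp
  · exact TestFun.sobolev_of_three_le h hp (hpn h)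

theorem TestFun.sobolevNorm_eq (φ : TestFun n) :
    φ.sobolevNorm = ENNReal.ofReal (‖φ.toL2‖ + ‖φ.gradL2‖) := by
  rw [ENNReal.ofReal_add (norm_nonneg _) (norm_nonneg _), Lp.norm_def, Lp.norm_def,
    ENNReal.ofReal_toReal (Lp.eLpNorm_ne_top _), ENNReal.ofReal_toReal (Lp.eLpNorm_ne_top _),
    eLpNorm_congr_ae φ.coeFn_toL2, eLpNorm_congr_ae φ.coeFn_gradL2, TestFun.sobolevNorm]

/-- The Sobolev inequality `‖w‖_{2p} ≤ C (‖w‖₂ + ‖∇w‖₂)`. -/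
theorem exists_sobolev (hn : 1 ≤ n) {p : ℝ} (hp : 1 < p)
    (hpn : 3 ≤ n → p ≤ (n : ℝ) / ((n : ℝ) - 2)) :
    ∃ C : ℝ, 0 < C ∧ ∀ (W : L2Sp n ℝ) (D : L2Sp n (EucSp n)), IsWeakGrad W D →
      eLpNorm W (ENNReal.ofReal (2 * p)) volume ≤ ENNReal.ofReal (C * (‖W‖ + ‖D‖)) := by
  obtain ⟨C, hC⟩ := TestFun.exists_sobolev hn hp hpn
  -- The summand 1 only makes the constant positive.
  refine ⟨C + 1, by positivity, fun W D h => ?_⟩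
  obtain ⟨φ, h1, h2⟩ := h.exists_seq
  obtain ⟨ns, hns, hae⟩ := (tendstoInMeasure_of_tendsto_Lp h1).exists_seq_tendsto_ae
  have hae' : ∀ᵐ x, Tendsto (fun k => (φ (ns k)).toL2 x) atTop (𝓝 (W x)) := hae
  -- L² convergence gives an a.e. convergent subsequence, and Fatou makes the L^{2p} norm lower
  -- semicontinuous along it; membership of `W` in L^{2p} is thus a conclusion.
  refine (Lp.eLpNorm_lim_le_liminf_eLpNorm
    (fun k => (Lp.aestronglyMeasurable (φ (ns k)).toL2)) W hae').trans ?_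
  have hle : ∀ k, eLpNorm (φ (ns k)).toL2 (ENNReal.ofReal (2 * p)) volume ≤
      ENNReal.ofReal ((C + 1) * (‖(φ (ns k)).toL2‖ + ‖(φ (ns k)).gradL2‖)) := by
    intro k
    rw [eLpNorm_congr_ae (φ (ns k)).coeFn_toL2]
    refine (hC _).trans ?_
    rw [TestFun.sobolevNorm_eq, ENNReal.ofReal_mul (by positivity)]
    gcongr
    rw [ENNReal.le_ofReal_iff_toReal_le (by simp) (by positivity)]
    simp
  have ht : Tendsto (fun k => ENNReal.ofReal ((C + 1) * (‖(φ (ns k)).toL2‖ + ‖(φ (ns k)).gradL2‖)))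
      atTop (𝓝 (ENNReal.ofReal ((C + 1) * (‖W‖ + ‖D‖)))) := by
    refine ENNReal.tendsto_ofReal (Tendsto.const_mul _ ?_)
    exact ((h1.comp hns.tendsto_atTop).norm).add ((h2.comp hns.tendsto_atTop).norm)
  rw [← ht.liminf_eq]
  exact liminf_le_liminf (Eventually.of_forall hle)

/-! ### The power nonlinearity as a map from H¹ to L² -/

/-- Bernoulli's inequality for y/x = 1 + (y/x - 1), multiplied by x^p. -/
theorem Real.rpow_sub_rpow_le_of_le {p x y : ℝ} (hp : 1 ≤ p) (hy : 0 ≤ y) (hxy : y ≤ x) :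
    x ^ p - y ^ p ≤ p * x ^ (p - 1) * (x - y) := by
  rcases hy.trans hxy |>.eq_or_lt with h | h
  · have : y = 0 := by linarith
    simp [← h, this]
  have h1 := one_add_mul_self_le_rpow_one_add (s := y / x - 1) (by
    have : 0 ≤ y / x := by positivity
    linarith) hp
  rw [add_sub_cancel, Real.div_rpow hy h.le, le_div_iff₀ (by positivity)] at h1
  have h2 : x ^ p = x ^ (p - 1) * x := by
    rw [Real.rpow_sub_one h.ne', div_mul_cancel₀ _ h.ne']
  have h3 : (1 + p * (y / x - 1)) * x ^ p = x ^ p - p * x ^ (p - 1) * (x - y) := by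
    rw [h2]; field_simp; ring
  linarith

theorem abs_abs_rpow_sub_le {p : ℝ} (hp : 1 ≤ p) (a b : ℝ) :
    |(|a| ^ p - |b| ^ p)| ≤ p * (|a| + |b|) ^ (p - 1) * |a - b| := by
  wlog h : |b| ≤ |a| generalizing a b
  · rw [abs_sub_comm, add_comm, abs_sub_comm a b]
    exact this b a (by linarith)
  have h0 : |b| ^ p ≤ |a| ^ p := by gcongr
  rw [abs_of_nonneg (by linarith)]
  refine (Real.rpow_sub_rpow_le_of_le hp (abs_nonneg _) h).trans ?_
  have hab : |a| - |b| ≤ |a - b| := abs_sub_abs_le_abs_sub a b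
  have : |a| ^ (p - 1) ≤ (|a| + |b|) ^ (p - 1) := by
    exact Real.rpow_le_rpow (abs_nonneg _) (by linarith [abs_nonneg b]) (by linarith)
  gcongr

/-- Hölder with 1/2 = (p-1)/(2p) + 1/(2p). -/
theorem eLpNorm_rpow_mul_le {α : Type*} [MeasurableSpace α] {μ : Measure α} {p : ℝ} (hp : 1 < p)
    {f g : α → ℝ} (hf : AEStronglyMeasurable f μ) (hg : AEStronglyMeasurable g μ) :
    eLpNorm (fun x => ‖f x‖ ^ (p - 1) * g x) 2 μ ≤
      eLpNorm f (ENNReal.ofReal (2 * p)) μ ^ (p - 1) * eLpNorm g (ENNReal.ofReal (2 * p)) μ := by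
  have hp1 : 0 < p - 1 := by linarith
  have hfm : AEStronglyMeasurable (fun x => ‖f x‖ ^ (p - 1)) μ :=
    (hf.norm.aemeasurable.pow_const _).aestronglyMeasurable
  have : (ENNReal.ofReal (2 * p / (p - 1))).HolderTriple (ENNReal.ofReal (2 * p)) 2 := by
    constructor
    rw [← ENNReal.ofReal_inv_of_pos (by positivity), ← ENNReal.ofReal_inv_of_pos (by positivity),
      ← ENNReal.ofReal_add (by positivity) (by positivity)]
    have : (2 : ENNReal)⁻¹ = ENNReal.ofReal (2⁻¹) := by
      rw [ENNReal.ofReal_inv_of_pos (by norm_num)]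
      simp
    rw [this]
    congr 1
    field_simp
    ring
  have h := eLpNorm_smul_le_mul_eLpNorm (p := ENNReal.ofReal (2 * p / (p - 1)))
    (q := ENNReal.ofReal (2 * p)) (r := 2) hg hfm
  rw [eLpNorm_norm_rpow _ hp1, ← ENNReal.ofReal_mul (by positivity),
    div_mul_cancel₀ _ hp1.ne'] at h
  exact h

/-- `C` bounds the Sobolev embedding `H¹ → L^{2p}`. -/
def IsSobolevConst (n : ℕ) (p C : ℝ) : Prop :=
  ∀ (W : L2Sp n ℝ) (D : L2Sp n (EucSp n)), IsWeakGrad W D →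
    eLpNorm W (ENNReal.ofReal (2 * p)) volume ≤ ENNReal.ofReal (C * (‖W‖ + ‖D‖))

open Classical in
/-- The power `|W|^p` as an element of `L²` (and `0` if it is not in `L²`). -/
noncomputable def powL2 {n : ℕ} (p : ℝ) (W : L2Sp n ℝ) : L2Sp n ℝ :=
  if h : MemLp (fun x => |W x| ^ p) 2 volume then h.toLp else 0

section Power

variable {n : ℕ} {p C : ℝ}

theorem IsSobolevConst.memLp_rpow (hC : IsSobolevConst n p C) (hp : 1 < p) {W : L2Sp n ℝ}
    {D : L2Sp n (EucSp n)} (h : IsWeakGrad W D) : MemLp (fun x => |W x| ^ p) 2 volume := by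
  refine ⟨((Lp.aestronglyMeasurable W).norm.aemeasurable.pow_const _).aestronglyMeasurable, ?_⟩
  have h1 := eLpNorm_norm_rpow (p := 2) (μ := volume) (W : EucSp n → ℝ) (q := p) (by linarith)
  simp only [Real.norm_eq_abs] at h1
  rw [h1]
  have h2 : (2 : ENNReal) * ENNReal.ofReal p = ENNReal.ofReal (2 * p) := by
    rw [ENNReal.ofReal_mul (by norm_num)]; simp
  rw [h2]
  exact ENNReal.rpow_lt_top_of_nonneg (by linarith) ((hC W D h).trans_lt ENNReal.ofReal_lt_top).ne

theorem IsSobolevConst.coeFn_powL2 (hC : IsSobolevConst n p C) (hp : 1 < p) {W : L2Sp n ℝ}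
    {D : L2Sp n (EucSp n)} (h : IsWeakGrad W D) :
    powL2 p W =ᵐ[volume] fun x => |W x| ^ p := by
  have h1 := hC.memLp_rpow hp h
  rw [powL2, dif_pos h1]
  exact h1.coeFn_toLp

/-- Writing b|W|^p as |W|^{p-1}·|bW| for b ≥ 0 (and up to sign in general) places the whole weight
on one factor. The bound is therefore linear in the weighted norm, as the energy argument requires,
and the other p - 1 factors are measured without weight. -/
theorem IsSobolevConst.norm_bddMul_powL2_le (hC : IsSobolevConst n p C) (hC0 : 0 < C) (hp : 1 < p)
    {W : L2Sp n ℝ} {D : L2Sp n (EucSp n)} (h : IsWeakGrad W D) {b : EucSp n → ℝ}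
    (hb : MemLp b ⊤ volume) {W' : L2Sp n ℝ} {D' : L2Sp n (EucSp n)} (h' : IsWeakGrad W' D')
    (hW' : W' =ᵐ[volume] fun x => b x * W x) :
    ‖bddMul (ContinuousLinearMap.lsmul ℝ ℝ) b hb (powL2 p W)‖ ≤
      (C * (‖W‖ + ‖D‖)) ^ (p - 1) * (C * (‖W'‖ + ‖D'‖)) := by
  rw [Lp.norm_def]
  refine ENNReal.toReal_le_of_le_ofReal (by positivity) ?_
  have e : eLpNorm (bddMul (ContinuousLinearMap.lsmul ℝ ℝ) b hb (powL2 p W)) 2 volume =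
      eLpNorm (fun x => ‖W x‖ ^ (p - 1) * W' x) 2 volume := by
    apply eLpNorm_congr_norm_ae
    filter_upwards [coeFn_bddMul (ContinuousLinearMap.lsmul ℝ ℝ) b hb (powL2 p W),
      hC.coeFn_powL2 hp h, hW'] with x h1 h2 h3
    rw [h1, h2, h3]
    simp only [ContinuousLinearMap.lsmul_apply, smul_eq_mul, norm_mul, Real.norm_eq_abs]
    rw [abs_of_nonneg (Real.rpow_nonneg (abs_nonneg _) _),
      abs_of_nonneg (Real.rpow_nonneg (abs_nonneg _) _)]
    rcases eq_or_ne |W x| 0 with h0 | h0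
    · rw [h0, Real.zero_rpow (by linarith)]; simp
    · rw [Real.rpow_sub_one h0]; field_simp
  rw [e]
  refine (eLpNorm_rpow_mul_le hp (Lp.aestronglyMeasurable _) (Lp.aestronglyMeasurable _)).trans ?_
  rw [ENNReal.ofReal_mul (p := (C * (‖W‖ + ‖D‖)) ^ (p - 1)) (by positivity),
    ← ENNReal.ofReal_rpow_of_nonneg (by positivity) (by linarith)]
  gcongr
  · exact hC W D h
  · exact hC W' D' h'

/-- Local Lipschitz continuity: the mean value bound for |·|^p, Hölder, and Sobolev for `W - W'`. -/
theorem IsSobolevConst.norm_powL2_sub_le (hC : IsSobolevConst n p C) (hC0 : 0 < C) (hp : 1 < p)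
    {W : L2Sp n ℝ} {D : L2Sp n (EucSp n)} (h : IsWeakGrad W D)
    {W' : L2Sp n ℝ} {D' : L2Sp n (EucSp n)} (h' : IsWeakGrad W' D') :
    ‖powL2 p W - powL2 p W'‖ ≤
      p * ((C * (‖W‖ + ‖D‖) + C * (‖W'‖ + ‖D'‖)) ^ (p - 1) * (C * (‖W - W'‖ + ‖D - D'‖))) := by
  rw [Lp.norm_def]
  refine ENNReal.toReal_le_of_le_ofReal (by positivity) ?_
  have hm : AEStronglyMeasurable (fun x => |W x| + |W' x|) volume :=
    (Lp.aestronglyMeasurable W).norm.add (Lp.aestronglyMeasurable W').norm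
  have e : eLpNorm (powL2 p W - powL2 p W' : L2Sp n ℝ) 2 volume ≤ ENNReal.ofReal p *
      eLpNorm (fun x => ‖|W x| + |W' x|‖ ^ (p - 1) * (W - W' : L2Sp n ℝ) x) 2 volume := by
    refine eLpNorm_le_mul_eLpNorm_of_ae_le_mul ?_ _
    filter_upwards [Lp.coeFn_sub (powL2 p W) (powL2 p W'), hC.coeFn_powL2 hp h,
      hC.coeFn_powL2 hp h', Lp.coeFn_sub W W'] with x h1 h2 h3 h4
    rw [h1, h4]
    simp only [Pi.sub_apply]
    rw [h2, h3, norm_mul, Real.norm_eq_abs, Real.norm_eq_abs, Real.norm_eq_abs, Real.norm_eq_abs]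
    rw [abs_of_nonneg (by positivity : 0 ≤ |W x| + |W' x|),
      abs_of_nonneg (by positivity : 0 ≤ (|W x| + |W' x|) ^ (p - 1)), ← mul_assoc]
    exact abs_abs_rpow_sub_le hp.le _ _
  refine e.trans ?_
  rw [ENNReal.ofReal_mul (by linarith)]
  gcongr
  refine (eLpNorm_rpow_mul_le hp hm (Lp.aestronglyMeasurable _)).trans ?_
  rw [ENNReal.ofReal_mul (p := (C * (‖W‖ + ‖D‖) + C * (‖W'‖ + ‖D'‖)) ^ (p - 1)) (by positivity),
    ← ENNReal.ofReal_rpow_of_nonneg (by positivity) (by linarith)]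
  gcongr
  · rw [ENNReal.ofReal_add (p := C * (‖W‖ + ‖D‖)) (by positivity) (by positivity)]
    refine (eLpNorm_add_le (f := fun x => |W x|) (g := fun x => |W' x|)
      (Lp.aestronglyMeasurable W).norm (Lp.aestronglyMeasurable W').norm ?_).trans ?_
    · rw [ENNReal.one_le_ofReal]; linarith
    · refine add_le_add ?_ ?_
      · exact le_of_eq_of_le (eLpNorm_norm (W : EucSp n → ℝ)) (hC W D h)
      · exact le_of_eq_of_le (eLpNorm_norm (W' : EucSp n → ℝ)) (hC W' D' h')
  · exact hC _ _ (h.Lp_sub h')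

theorem IsSobolevConst.continuousOn_powL2 (hC : IsSobolevConst n p C) (hC0 : 0 < C) (hp : 1 < p)
    {s : Set ℝ} {W : ℝ → L2Sp n ℝ} {D : ℝ → L2Sp n (EucSp n)} (hW : ContinuousOn W s)
    (hD : ContinuousOn D s) (h : ∀ t ∈ s, IsWeakGrad (W t) (D t)) :
    ContinuousOn (fun t => powL2 p (W t)) s := by
  intro t ht
  rw [ContinuousWithinAt, tendsto_iff_norm_sub_tendsto_zero]
  have hWt := hW t ht
  have hDt := hD t ht
  have h1 : Tendsto (fun r => p * ((C * (‖W r‖ + ‖D r‖) + C * (‖W t‖ + ‖D t‖)) ^ (p - 1) *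
      (C * (‖W r - W t‖ + ‖D r - D t‖)))) (𝓝[s] t) (𝓝 (p * ((C * (‖W t‖ + ‖D t‖) +
        C * (‖W t‖ + ‖D t‖)) ^ (p - 1) * (C * (‖W t - W t‖ + ‖D t - D t‖))))) := by
    refine Tendsto.const_mul _ (Tendsto.mul (Tendsto.rpow_const ?_ ?_) ?_)
    · exact (((hWt.norm.add hDt.norm).const_mul _).add tendsto_const_nhds)
    · right; linarith
    · exact ((hWt.sub tendsto_const_nhds).norm.add (hDt.sub tendsto_const_nhds).norm).const_mul _
  simp only [sub_self, norm_zero, add_zero, mul_zero] at h1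
  refine squeeze_zero' (Eventually.of_forall fun _ => norm_nonneg _) ?_ h1
  filter_upwards [self_mem_nhdsWithin] with r hr
  exact hC.norm_powL2_sub_le hC0 hp (h r hr) (h t ht)

end Power

/-! ### The memory term as an L²-valued convolution -/

section Memory

variable {n : ℕ}

/-- The `L²`-valued convolution `∫₀ˢ g(s - τ) N(τ) dτ`. -/
noncomputable def memoryL2 {H : Type*} [NormedAddCommGroup H] [NormedSpace ℝ H] (g : ℝ → ℝ)
    (N : ℝ → H) (s : ℝ) : H :=
  ∫ τ in (0 : ℝ)..s, g (s - τ) • N τ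

theorem intervalIntegrable_comp_sub_left {g : ℝ → ℝ} {S s : ℝ}
    (hg : IntegrableOn g (Set.Ioc 0 S) volume) (hs : s ∈ Set.Icc 0 S) :
    IntervalIntegrable (fun τ => g (s - τ)) volume 0 s := by
  have h : IntervalIntegrable g volume 0 s := by
    rw [intervalIntegrable_iff_integrableOn_Ioc_of_le hs.1]
    exact hg.mono_set (Set.Ioc_subset_Ioc_right hs.2)
  have := (h.comp_sub_left s).symm
  simpa using this

/-- The substitution σ = s - τ moves the dependence on s from the merely integrable `g` to the
continuous `N`, where dominated convergence applies. -/
theorem continuousOn_memoryL2 {H : Type*} [NormedAddCommGroup H] [NormedSpace ℝ H]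
    [CompleteSpace H] {g : ℝ → ℝ} {N : ℝ → H} {S : ℝ} (hS : 0 < S)
    (hg : IntegrableOn g (Set.Ioc 0 S) volume) (hN : ContinuousOn N (Set.Icc 0 S)) :
    ContinuousOn (memoryL2 g N) (Set.Icc 0 S) := by
  -- Subtracting `N 0` makes the constant extension vanish at negative times, so the integral of
  -- g(σ)N'(s - σ) may run over the fixed interval [0, S]. The subtracted part contributes a
  -- primitive of `g` times `N 0`.
  set N' : ℝ → H := Set.IccExtend hS.le (Set.domRestrict (Set.Icc 0 S) (fun t => N t - N 0)) with hN'
  have hN'c : Continuous N' :=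
    (continuousOn_iff_continuous_domRestrict.mp (hN.sub continuousOn_const)).Icc_extend'
  have hN'z : ∀ t ≤ 0, N' t = 0 := by
    intro t ht
    rw [hN', Set.IccExtend_of_le_left _ _ ht]
    exact sub_self _
  have hN'e : ∀ t ∈ Set.Icc 0 S, N' t = N t - N 0 := by
    intro t ht
    rw [hN', Set.IccExtend_of_mem _ _ ht]
    rfl
  have hgi : IntervalIntegrable g volume 0 S := by
    rwa [intervalIntegrable_iff_integrableOn_Ioc_of_le hS.le]
  obtain ⟨M, hM⟩ : ∃ M, ∀ t, ‖N' t‖ ≤ M := by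
    obtain ⟨M, hM⟩ := isCompact_Icc.exists_bound_of_continuousOn (hN.sub (continuousOn_const (c := N 0)))
    refine ⟨M, fun t => ?_⟩
    exact hM _ (Set.projIcc 0 S hS.le t).2
  have hint : ∀ s, IntervalIntegrable (fun σ => g σ • N' (s - σ)) volume 0 S := by
    intro s
    refine IntervalIntegrable.smul_continuousOn hgi ?_
    fun_prop
  have e : Set.EqOn (memoryL2 g N)
      (fun s => (∫ σ in (0 : ℝ)..S, g σ • N' (s - σ)) + (∫ σ in (0 : ℝ)..s, g σ) • N 0)
      (Set.Icc 0 S) := by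
    intro s hs
    have hgs := intervalIntegrable_comp_sub_left hg hs
    have i1 : IntervalIntegrable (fun τ => g (s - τ) • N' τ) volume 0 s :=
      hgs.smul_continuousOn hN'c.continuousOn
    have i2 : IntervalIntegrable (fun τ => g (s - τ) • N 0) volume 0 s :=
      hgs.smul_continuousOn continuousOn_const
    have e1 : memoryL2 g N s = ∫ τ in (0 : ℝ)..s, (g (s - τ) • N' τ + g (s - τ) • N 0) := by
      refine intervalIntegral.integral_congr fun τ hτ => ?_
      rw [Set.uIcc_of_le hs.1] at hτ
      rw [hN'e τ ⟨hτ.1, hτ.2.trans hs.2⟩, ← smul_add, sub_add_cancel]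
    rw [e1, intervalIntegral.integral_add i1 i2]
    congr 1
    · have h1 := intervalIntegral.integral_comp_sub_left (a := 0) (b := s)
        (fun σ => g σ • N' (s - σ)) s
      simp only [sub_sub_cancel, sub_self, sub_zero] at h1
      rw [h1]
      have hs' : s ∈ Set.uIcc 0 S := by rwa [Set.uIcc_of_le hS.le]
      rw [← intervalIntegral.integral_add_adjacent_intervals (b := s) (c := S)
        ((hint s).mono_set (Set.uIcc_subset_uIcc_left hs'))
        ((hint s).mono_set (Set.uIcc_subset_uIcc_right hs'))]
      have h2 : ∫ σ in s..S, g σ • N' (s - σ) = 0 := by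
        rw [intervalIntegral.integral_congr (g := fun _ => (0 : H))]
        · simp
        · intro σ hσ
          rw [Set.uIcc_of_le hs.2] at hσ
          simp only
          rw [hN'z _ (by linarith [hσ.1]), smul_zero]
      rw [h2, add_zero]
    · have h1 := intervalIntegral.integral_comp_sub_left (a := 0) (b := s)
        (fun σ => g σ • N 0) s
      simp only [sub_self, sub_zero] at h1
      rw [h1, intervalIntegral.integral_smul_const]
  refine ContinuousOn.congr ?_ e
  refine ContinuousOn.add ?_ (ContinuousOn.smul ?_ continuousOn_const)
  · refine Continuous.continuousOn ?_
    refine intervalIntegral.continuous_of_dominated_interval (bound := fun σ => ‖g σ‖ * M) ?_ ?_ ?_ ?_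
    · intro s
      exact (hint s).aestronglyMeasurable_restrict_uIoc
    · intro s
      refine Eventually.of_forall fun σ _ => ?_
      rw [norm_smul]
      gcongr
      exact hM _
    · exact hgi.norm.mul_const _
    · refine Eventually.of_forall fun σ _ => ?_
      fun_prop
  · have := intervalIntegral.continuousOn_primitive_interval' hgi (a := 0) (Set.left_mem_uIcc)
    rwa [Set.uIcc_of_le hS.le] at this

/-- Testing the memory term at a fixed time against a test function. -/
theorem integral_memoryTerm_mul {g : ℝ → ℝ} {r : ℝ} {w : ℝ → EucSp n → ℝ} {N : ℝ → L2Sp n ℝ}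
    {S s : ℝ} (hg : IntegrableOn g (Set.Ioc 0 S) volume) (hs : s ∈ Set.Icc 0 S)
    (hw : AEStronglyMeasurable (fun z : ℝ × EucSp n => w z.1 z.2)
      ((volume.restrict (Set.Icc 0 S)).prod volume))
    (hN : ContinuousOn N (Set.Icc 0 S)) (hNw : ∀ t ∈ Set.Icc 0 S, N t =ᵐ[volume] fun x => |w t x| ^ r)
    (φ : TestFun n) :
    ∫ x, memoryTerm g r w s x * φ.toFun x = inner ℝ (memoryL2 g N s) φ.toL2 := by
  have hgs := intervalIntegrable_comp_sub_left hg hs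
  have hgs' := hgs.1
  have hsub : Set.Ioc 0 s ⊆ Set.Icc 0 S := fun τ hτ => ⟨hτ.1.le, hτ.2.trans hs.2⟩
  have hwm : AEStronglyMeasurable (fun z : ℝ × EucSp n => w z.1 z.2)
      ((volume.restrict (Set.Ioc 0 s)).prod volume) :=
    hw.mono_measure (Measure.prod_mono (Measure.restrict_mono hsub le_rfl) le_rfl)
  have habs : MemLp (fun x => |φ.toFun x|) 2 volume := (φ.memLp 2).norm
  have hint : Integrable (fun z : ℝ × EucSp n => g (s - z.1) * |w z.1 z.2| ^ r * φ.toFun z.2)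
      ((volume.restrict (Set.Ioc 0 s)).prod volume) := by
    have hm : AEStronglyMeasurable
        (fun z : ℝ × EucSp n => g (s - z.1) * |w z.1 z.2| ^ r * φ.toFun z.2)
        ((volume.restrict (Set.Ioc 0 s)).prod volume) := by
      refine AEStronglyMeasurable.mul (AEStronglyMeasurable.mul ?_ ?_) ?_
      · exact hgs'.aestronglyMeasurable.comp_fst
      · exact (hwm.norm.aemeasurable.pow_const r).aestronglyMeasurable
      · exact (φ.smooth.continuous.comp continuous_snd).aestronglyMeasurable
    rw [integrable_prod_iff hm]
    constructor
    · filter_upwards [ae_restrict_mem measurableSet_Ioc] with τ hτ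
      have h1 := (integrable_mul_of_L2 (Lp.memLp (N τ)) (φ.memLp 2)).const_mul (g (s - τ))
      refine h1.congr ?_
      filter_upwards [hNw τ (hsub hτ)] with x hx
      rw [hx]; ring
    · have h2 : ContinuousOn (fun τ => (inner ℝ (N τ) habs.toLp : ℝ)) (Set.Icc 0 s) :=
        (hN.mono (Set.Icc_subset_Icc_right hs.2)).inner continuousOn_const
      have h3 : IntervalIntegrable (fun τ => ‖g (s - τ)‖ * (inner ℝ (N τ) habs.toLp : ℝ))
          volume 0 s := by
        refine hgs.norm.mul_continuousOn ?_
        rwa [Set.uIcc_of_le hs.1]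
      refine h3.1.congr ?_
      filter_upwards [ae_restrict_mem measurableSet_Ioc] with τ hτ
      rw [L2.inner_def, ← integral_const_mul]
      apply integral_congr_ae
      filter_upwards [hNw τ (hsub hτ), habs.coeFn_toLp] with x h1 h2
      rw [h1, h2]
      simp only [norm_mul, Real.norm_eq_abs, RCLike.inner_apply, conj_trivial]
      rw [abs_of_nonneg (Real.rpow_nonneg (abs_nonneg _) _)]
      ring
  have e1 : ∀ x, memoryTerm g r w s x * φ.toFun x =
      ∫ τ in Set.Ioc 0 s, g (s - τ) * |w τ x| ^ r * φ.toFun x := by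
    intro x
    rw [memoryTerm, intervalIntegral.integral_of_le hs.1, integral_mul_const]
  simp only [e1]
  rw [← integral_integral_swap (f := fun τ x => g (s - τ) * |w τ x| ^ r * φ.toFun x) hint]
  have hNi : IntervalIntegrable (fun τ => g (s - τ) • N τ) volume 0 s := by
    refine hgs.smul_continuousOn ?_
    rw [Set.uIcc_of_le hs.1]
    exact hN.mono (Set.Icc_subset_Icc_right hs.2)
  rw [memoryL2, intervalIntegral.integral_of_le hs.1, real_inner_comm, ← integral_inner hNi.1]
  refine setIntegral_congr_fun measurableSet_Ioc fun τ hτ => ?_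
  simp only [inner_smul_right]
  rw [real_inner_comm, TestFun.inner_toL2, ← integral_const_mul]
  apply integral_congr_ae
  filter_upwards [hNw τ (hsub hτ)] with x h1
  rw [h1]; ring

end Memory

/-! ### Wave curves and the energy identity -/

/-- A weak solution of `w_tt - Δw = f` on `[0, S]` in the energy class, in terms of curves in
`L²`. -/
structure IsWaveCurve {n : ℕ} (S : ℝ) (W Wt : ℝ → L2Sp n ℝ) (D : ℝ → L2Sp n (EucSp n))
    (f : ℝ → L2Sp n ℝ) : Prop where
  hasDeriv : ∀ t ∈ Set.Icc 0 S, HasDerivWithinAt W (Wt t) (Set.Icc 0 S) t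
  continuousOn_deriv : ContinuousOn Wt (Set.Icc 0 S)
  continuousOn_grad : ContinuousOn D (Set.Icc 0 S)
  continuousOn_source : ContinuousOn f (Set.Icc 0 S)
  weakGrad : ∀ t ∈ Set.Icc 0 S, IsWeakGrad (W t) (D t)
  relation : ∀ t ∈ Set.Icc 0 S, ∀ φ : TestFun n,
    (∫ s in (0 : ℝ)..t, inner ℝ (D s) φ.gradL2) + inner ℝ (Wt t) φ.toL2 =
      inner ℝ (Wt 0) φ.toL2 + ∫ s in (0 : ℝ)..t, inner ℝ (f s) φ.toL2

section Mean

theorem exists_continuous_extension {H : Type*} [NormedAddCommGroup H] {F : ℝ → H} {S : ℝ} (hS : 0 ≤ S)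
    (hF : ContinuousOn F (Set.Icc 0 S)) :
    ∃ F' : ℝ → H, Continuous F' ∧ (∀ t ∈ Set.Icc 0 S, F' t = F t) ∧ ∃ M, ∀ t, ‖F' t‖ ≤ M := by
  obtain ⟨M, hM⟩ := isCompact_Icc.exists_bound_of_continuousOn hF
  exact ⟨Set.IccExtend hS (Set.domRestrict (Set.Icc 0 S) F),
    (continuousOn_iff_continuous_domRestrict.mp hF).Icc_extend',
    fun t ht => Set.IccExtend_of_mem _ _ ht, M, fun t => hM _ (Set.projIcc 0 S hS t).2⟩

variable {H : Type*} [NormedAddCommGroup H] [NormedSpace ℝ H]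

/-- The forward mean of a curve over `[s, s + h]`. -/
noncomputable def fwdMean (h : ℝ) (F : ℝ → H) (s : ℝ) : H := h⁻¹ • ∫ r in s..(s + h), F r

theorem norm_fwdMean_le {F : ℝ → H} {M h : ℝ} (hM : ∀ t, ‖F t‖ ≤ M) (hh : 0 < h) (s : ℝ) :
    ‖fwdMean h F s‖ ≤ M := by
  have h1 := intervalIntegral.norm_integral_le_of_norm_le_const (a := s) (b := s + h) (f := F)
    (C := M) (fun t _ => hM t)
  rw [add_sub_cancel_left, abs_of_pos hh] at h1
  rw [fwdMean, norm_smul, norm_inv, Real.norm_of_nonneg hh.le, inv_mul_le_iff₀ hh]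
  linarith

variable [CompleteSpace H]

theorem hasDerivAt_fwdMean {F : ℝ → H} (hF : Continuous F) (h s : ℝ) :
    HasDerivAt (fwdMean h F) (h⁻¹ • (F (s + h) - F s)) s := by
  have e : fwdMean h F = fun s => h⁻¹ • ((∫ r in (0 : ℝ)..(s + h), F r) - ∫ r in (0 : ℝ)..s, F r) := by
    ext1 s
    rw [fwdMean, intervalIntegral.integral_interval_sub_left (hF.intervalIntegrable _ _)
      (hF.intervalIntegrable _ _)]
  rw [e]
  have h1 : ∀ u, HasDerivAt (fun u => ∫ r in (0 : ℝ)..u, F r) (F u) u := fun u =>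
    intervalIntegral.integral_hasDerivAt_right (hF.intervalIntegrable _ _)
      hF.stronglyMeasurable.stronglyMeasurableAtFilter hF.continuousAt
  exact (((h1 (s + h)).comp_add_const s h).sub (h1 s)).const_smul _

theorem continuous_fwdMean {F : ℝ → H} (hF : Continuous F) (h : ℝ) : Continuous (fwdMean h F) :=
  continuous_iff_continuousAt.mpr fun s => (hasDerivAt_fwdMean hF h s).continuousAt

theorem tendsto_fwdMean {F : ℝ → H} (hF : Continuous F) (s : ℝ) :
    Tendsto (fun h => fwdMean h F s) (𝓝[>] 0) (𝓝 (F s)) := by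
  have h1 : HasDerivAt (fun u => ∫ r in s..u, F r) (F s) s :=
    intervalIntegral.integral_hasDerivAt_right (hF.intervalIntegrable _ _)
      hF.stronglyMeasurable.stronglyMeasurableAtFilter hF.continuousAt
  have h2 := h1.tendsto_slope_zero_right
  simpa [fwdMean] using h2

end Mean

section Energy

variable {n : ℕ}

/-- Identities tested against test functions extend to `H¹`. -/
theorem IsWeakGrad.inner_identity {x y : L2Sp n ℝ} {z : L2Sp n (EucSp n)}
    (h : ∀ φ : TestFun n, inner ℝ x φ.toL2 + inner ℝ z φ.gradL2 = (inner ℝ y φ.toL2 : ℝ))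
    {W : L2Sp n ℝ} {D : L2Sp n (EucSp n)} (hW : IsWeakGrad W D) :
    inner ℝ x W + inner ℝ z D = (inner ℝ y W : ℝ) := by
  obtain ⟨φ, h1, h2⟩ := hW.exists_seq
  have l1 : Tendsto (fun k => (inner ℝ x (φ k).toL2 + inner ℝ z (φ k).gradL2 : ℝ)) atTop
      (𝓝 (inner ℝ x W + inner ℝ z D)) :=
    (tendsto_const_nhds.inner h1).add (tendsto_const_nhds.inner h2)
  have l2 : Tendsto (fun k => (inner ℝ y (φ k).toL2 : ℝ)) atTop (𝓝 (inner ℝ y W)) :=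
    tendsto_const_nhds.inner h1
  exact tendsto_nhds_unique (l1.congr fun k => h (φ k)) l2

theorem IsWaveCurve.sub_eq_integral {S : ℝ} {W Wt : ℝ → L2Sp n ℝ} {D : ℝ → L2Sp n (EucSp n)}
    {f : ℝ → L2Sp n ℝ} (hw : IsWaveCurve S W Wt D f) {s t : ℝ} (hs : 0 ≤ s) (hst : s ≤ t)
    (ht : t ≤ S) : W t - W s = ∫ r in s..t, Wt r := by
  have hsub : Set.Icc s t ⊆ Set.Icc 0 S := Set.Icc_subset_Icc hs ht
  refine (intervalIntegral.integral_eq_sub_of_hasDerivAt_of_le hst ?_ ?_ ?_).symm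
  · exact fun r hr => ((hw.hasDeriv r (hsub hr)).continuousWithinAt).mono hsub
  · intro r hr
    refine (hw.hasDeriv r (hsub (Set.Ioo_subset_Icc_self hr))).hasDerivAt ?_
    exact Icc_mem_nhds (by linarith [hr.1]) (by linarith [hr.2])
  · refine ContinuousOn.intervalIntegrable ?_
    rw [Set.uIcc_of_le hst]
    exact hw.continuousOn_deriv.mono hsub

/-- The weighted energy identity, with the weight entering through the multiplication operators
`A`, `A'` and the operator `G` multiplying by the gradient of the weight. -/
theorem IsWaveCurve.energy_identity {S : ℝ} {W Wt : ℝ → L2Sp n ℝ} {D : ℝ → L2Sp n (EucSp n)}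
    {f : ℝ → L2Sp n ℝ} (hw : IsWaveCurve S W Wt D f)
    (A : L2Sp n ℝ →L[ℝ] L2Sp n ℝ) (A' : L2Sp n (EucSp n) →L[ℝ] L2Sp n (EucSp n))
    (G : L2Sp n ℝ →L[ℝ] L2Sp n (EucSp n))
    (hA : ∀ x y, inner ℝ (A x) y = (inner ℝ x (A y) : ℝ))
    (hA' : ∀ x y, inner ℝ (A' x) y = (inner ℝ x (A' y) : ℝ))
    (hG : ∀ (x : L2Sp n ℝ) (y : L2Sp n (EucSp n)), IsWeakGrad x y →
      IsWeakGrad (A x) (A' y + G x : L2Sp n (EucSp n)))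
    {t : ℝ} (ht : 0 ≤ t) (htS : t < S) :
    inner ℝ (Wt t) (A (Wt t)) + inner ℝ (D t) (A' (D t)) =
      inner ℝ (Wt 0) (A (Wt 0)) + inner ℝ (D 0) (A' (D 0)) +
      ∫ s in (0 : ℝ)..t, (2 * inner ℝ (f s) (A (Wt s)) - 2 * (inner ℝ (D s) (G (Wt s)) : ℝ)) := by
  have hS : 0 ≤ S := ht.trans htS.le
  -- The curves are extended to bounded continuous functions on ℝ, so that forward means are
  -- differentiable everywhere and bounded uniformly in h.
  obtain ⟨w, hwc, hwe, Mw, hMw⟩ := exists_continuous_extension hS hw.continuousOn_deriv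
  obtain ⟨d, hdc, hde, Md, hMd⟩ := exists_continuous_extension hS hw.continuousOn_grad
  obtain ⟨q, hqc, hqe, Mq, hMq⟩ := exists_continuous_extension hS hw.continuousOn_source
  have rel : ∀ r ∈ Set.Icc 0 S, ∀ φ : TestFun n,
      (∫ s in (0 : ℝ)..r, inner ℝ (d s) φ.gradL2) + inner ℝ (w r) φ.toL2 =
      inner ℝ (w 0) φ.toL2 + ∫ s in (0 : ℝ)..r, (inner ℝ (q s) φ.toL2 : ℝ) := by
    intro r hr φ
    have := hw.relation r hr φ
    rw [hwe r hr, hwe 0 ⟨le_rfl, hS⟩]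
    convert this using 2
    · refine intervalIntegral.integral_congr fun s hs => ?_
      rw [Set.uIcc_of_le hr.1] at hs
      simp only [hde s ⟨hs.1, hs.2.trans hr.2⟩]
    · refine intervalIntegral.integral_congr fun s hs => ?_
      rw [Set.uIcc_of_le hr.1] at hs
      simp only [hqe s ⟨hs.1, hs.2.trans hr.2⟩]
  -- `Wt` need not have a weak gradient, so the equation cannot be tested with it. Its mean over [s,
  -- s + h] is a difference quotient of `W` and does have one; the relation averaged over the same
  -- window is tested with `A` of that mean. The condition h < S - t keeps the window inside [0, S].
  have key : ∀ h, 0 < h → h < S - t → ∀ s ∈ Set.Icc 0 t,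
      inner ℝ (h⁻¹ • (w (s + h) - w s)) (A (fwdMean h w s)) +
      inner ℝ (h⁻¹ • (d (s + h) - d s)) (A' (fwdMean h d s)) =
      inner ℝ (fwdMean h q s) (A (fwdMean h w s)) -
        (inner ℝ (fwdMean h d s) (G (fwdMean h w s)) : ℝ) := by
    intro h hh hhS s hs
    have hs1 : s ∈ Set.Icc 0 S := ⟨hs.1, by linarith [hs.2]⟩
    have hs2 : s + h ∈ Set.Icc 0 S := ⟨by linarith [hs.1], by linarith [hs.2]⟩
    have e1 : fwdMean h w s = h⁻¹ • (W (s + h) - W s) := by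
      rw [hw.sub_eq_integral hs.1 (by linarith) hs2.2, fwdMean]
      congr 1
      refine intervalIntegral.integral_congr fun r hr => ?_
      rw [Set.uIcc_of_le (by linarith)] at hr
      exact hwe r ⟨hs.1.trans hr.1, hr.2.trans hs2.2⟩
    have g1 : IsWeakGrad (fwdMean h w s : L2Sp n ℝ) (h⁻¹ • (d (s + h) - d s) : L2Sp n (EucSp n)) := by
      rw [e1, hde _ hs1, hde _ hs2]
      exact ((hw.weakGrad _ hs2).Lp_sub (hw.weakGrad _ hs1)).Lp_smul _
    have r1 : ∀ φ : TestFun n, inner ℝ (h⁻¹ • (w (s + h) - w s)) φ.toL2 +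
        inner ℝ (fwdMean h d s) φ.gradL2 = (inner ℝ (fwdMean h q s) φ.toL2 : ℝ) := by
      intro φ
      have a1 := rel _ hs1 φ
      have a2 := rel _ hs2 φ
      have c1 : Continuous fun r => (inner ℝ (d r) φ.gradL2 : ℝ) := hdc.inner continuous_const
      have c2 : Continuous fun r => (inner ℝ (q r) φ.toL2 : ℝ) := hqc.inner continuous_const
      have b1 := intervalIntegral.integral_interval_sub_left (μ := volume)
        (c1.intervalIntegrable 0 (s + h)) (c1.intervalIntegrable 0 s)
      have b2 := intervalIntegral.integral_interval_sub_left (μ := volume)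
        (c2.intervalIntegrable 0 (s + h)) (c2.intervalIntegrable 0 s)
      have d1 : (inner ℝ (∫ r in s..(s + h), d r) φ.gradL2 : ℝ) =
          ∫ r in s..(s + h), inner ℝ (d r) φ.gradL2 := by
        have := (innerSL ℝ φ.gradL2).intervalIntegral_comp_comm
          (hdc.intervalIntegrable (μ := volume) s (s + h))
        simp only [innerSL_apply_apply] at this
        rw [real_inner_comm, ← this]
        simp only [real_inner_comm]
      have d2 : (inner ℝ (∫ r in s..(s + h), q r) φ.toL2 : ℝ) =
          ∫ r in s..(s + h), inner ℝ (q r) φ.toL2 := by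
        have := (innerSL ℝ φ.toL2).intervalIntegral_comp_comm
          (hqc.intervalIntegrable (μ := volume) s (s + h))
        simp only [innerSL_apply_apply] at this
        rw [real_inner_comm, ← this]
        simp only [real_inner_comm]
      simp only [fwdMean, real_inner_smul_left, inner_sub_left]
      rw [d1, d2, ← b1, ← b2, ← mul_add]
      congr 1
      linarith
    have r2 := IsWeakGrad.inner_identity r1 (hG _ _ g1)
    rw [inner_add_right] at r2
    rw [hA' .. |>.symm] at r2
    have : (inner ℝ (A' (fwdMean h d s)) (h⁻¹ • (d (s + h) - d s)) : ℝ) =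
      inner ℝ (h⁻¹ • (d (s + h) - d s)) (A' (fwdMean h d s)) := real_inner_comm _ _
    linarith
  have hident : ∀ h, 0 < h → h < S - t →
      inner ℝ (fwdMean h w t) (A (fwdMean h w t)) + inner ℝ (fwdMean h d t) (A' (fwdMean h d t)) =
      inner ℝ (fwdMean h w 0) (A (fwdMean h w 0)) + inner ℝ (fwdMean h d 0) (A' (fwdMean h d 0)) +
      ∫ s in (0 : ℝ)..t, (2 * inner ℝ (fwdMean h q s) (A (fwdMean h w s)) -
        2 * (inner ℝ (fwdMean h d s) (G (fwdMean h w s)) : ℝ)) := by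
    intro h hh hhS
    have cw := continuous_fwdMean hwc h
    have cd := continuous_fwdMean hdc h
    have cq := continuous_fwdMean hqc h
    have hder : ∀ s ∈ Set.uIcc 0 t, HasDerivAt (fun s => (inner ℝ (fwdMean h w s) (A (fwdMean h w s))
        + inner ℝ (fwdMean h d s) (A' (fwdMean h d s)) : ℝ))
        (2 * inner ℝ (fwdMean h q s) (A (fwdMean h w s)) -
        2 * (inner ℝ (fwdMean h d s) (G (fwdMean h w s)) : ℝ)) s := by
      intro s hs
      rw [Set.uIcc_of_le ht] at hs
      have h1 := hasDerivAt_fwdMean hwc h s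
      have h2 := hasDerivAt_fwdMean hdc h s
      have h3 := (h1.inner ℝ (A.hasFDerivAt.comp_hasDerivAt s h1)).add
        (h2.inner ℝ (A'.hasFDerivAt.comp_hasDerivAt s h2))
      refine h3.congr_deriv ?_
      have k := key h hh hhS s hs
      have s1 := hA (fwdMean h w s) (h⁻¹ • (w (s + h) - w s))
      have s2 := hA' (fwdMean h d s) (h⁻¹ • (d (s + h) - d s))
      rw [real_inner_comm] at s1 s2
      simp only [Function.comp_apply]
      linarith
    have := intervalIntegral.integral_eq_sub_of_hasDerivAt hder (by
      refine Continuous.intervalIntegrable ?_ _ _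
      exact ((cq.inner (A.continuous.comp cw)).const_mul _).sub
        ((cd.inner (G.continuous.comp cw)).const_mul _))
    rw [this]
    ring
  have lim : ∀ {H : Type} [NormedAddCommGroup H] [InnerProductSpace ℝ H] [CompleteSpace H]
      {K : Type} [NormedAddCommGroup K] [InnerProductSpace ℝ K] [CompleteSpace K]
      {x : ℝ → H} {y : ℝ → K} (_ : Continuous x) (_ : Continuous y)
      (B : K →L[ℝ] H) (s : ℝ),
      Tendsto (fun h => (inner ℝ (fwdMean h x s) (B (fwdMean h y s)) : ℝ)) (𝓝[>] 0)
        (𝓝 (inner ℝ (x s) (B (y s)))) := by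
    intro H _ _ _ K _ _ _ x y hx hy B s
    exact (tendsto_fwdMean hx s).inner ((B.continuous.tendsto _).comp (tendsto_fwdMean hy s))
  -- The bounds Mq, Md, Mw do not depend on h, so dominated convergence allows h → 0+.
  have hI : Tendsto (fun h => ∫ s in (0 : ℝ)..t, (2 * inner ℝ (fwdMean h q s) (A (fwdMean h w s)) -
        2 * (inner ℝ (fwdMean h d s) (G (fwdMean h w s)) : ℝ))) (𝓝[>] 0)
      (𝓝 (∫ s in (0 : ℝ)..t, (2 * inner ℝ (q s) (A (w s)) - 2 * (inner ℝ (d s) (G (w s)) : ℝ)))) := by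
    refine intervalIntegral.tendsto_integral_filter_of_dominated_convergence
      (fun _ => 2 * (Mq * (‖A‖ * Mw)) + 2 * (Md * (‖G‖ * Mw))) ?_ ?_ ?_ ?_
    · refine Eventually.of_forall fun h => Continuous.aestronglyMeasurable ?_
      exact (((continuous_fwdMean hqc h).inner (A.continuous.comp (continuous_fwdMean hwc h))).const_mul
        _).sub (((continuous_fwdMean hdc h).inner
          (G.continuous.comp (continuous_fwdMean hwc h))).const_mul _)
    · filter_upwards [self_mem_nhdsWithin] with h hh
      refine Eventually.of_forall fun s _ => ?_
      have hq0 := norm_fwdMean_le hMq hh s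
      have hd0 := norm_fwdMean_le hMd hh s
      have hw0 := norm_fwdMean_le hMw hh s
      have Mq0 := (norm_nonneg _).trans hq0
      have Md0 := (norm_nonneg _).trans hd0
      have b1 : |(inner ℝ (fwdMean h q s) (A (fwdMean h w s)) : ℝ)| ≤ Mq * (‖A‖ * Mw) := by
        refine (abs_real_inner_le_norm _ _).trans ?_
        gcongr
        exact (A.le_opNorm _).trans (by gcongr)
      have b2 : |(inner ℝ (fwdMean h d s) (G (fwdMean h w s)) : ℝ)| ≤ Md * (‖G‖ * Mw) := by
        refine (abs_real_inner_le_norm _ _).trans ?_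
        gcongr
        exact (G.le_opNorm _).trans (by gcongr)
      rw [Real.norm_eq_abs]
      rw [abs_le] at *
      constructor <;> linarith [b1.1, b1.2, b2.1, b2.2]
    · exact intervalIntegrable_const
    · refine Eventually.of_forall fun s _ => ?_
      exact ((lim hqc hwc A s).const_mul _).sub ((lim hdc hwc G s).const_mul _)
  have hL := (lim hwc hwc A t).add (lim hdc hdc A' t)
  have hR := ((lim hwc hwc A 0).add (lim hdc hdc A' 0)).add hI
  have hev : ∀ᶠ h in 𝓝[>] (0 : ℝ), 0 < h ∧ h < S - t := by
    refine (eventually_mem_nhdsWithin).and ?_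
    exact nhdsWithin_le_nhds (Iio_mem_nhds (by linarith))
  have huniq := tendsto_nhds_unique (hL.congr' (by
    filter_upwards [hev] with h hh
    exact hident h hh.1 hh.2)) hR
  have ht1 : t ∈ Set.Icc 0 S := ⟨ht, htS.le⟩
  have h01 : (0 : ℝ) ∈ Set.Icc 0 S := ⟨le_rfl, hS⟩
  rw [hwe t ht1, hde t ht1, hwe 0 h01, hde 0 h01] at huniq
  rw [huniq]
  congr 1
  refine intervalIntegral.integral_congr fun s hs => ?_
  rw [Set.uIcc_of_le ht] at hs
  have hs1 : s ∈ Set.Icc 0 S := ⟨hs.1, hs.2.trans htS.le⟩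
  simp only [hwe s hs1, hde s hs1, hqe s hs1]

end Energy

/-! ### Exponentially weighted energy -/

section Weight

variable {n : ℕ}

/-- An admissible exponent for the weights `exp (λ ρ)`: smooth, bounded and `1`-Lipschitz. -/
structure IsWeightExponent (ρ : EucSp n → ℝ) : Prop where
  smooth : ContDiff ℝ ∞ ρ
  bounded : ∃ M, ∀ x, |ρ x| ≤ M
  gradient_le : ∀ x, ‖gradient ρ x‖ ≤ 1

variable {ρ : EucSp n → ℝ}

theorem IsWeightExponent.memLp_exp (hρ : IsWeightExponent ρ) (μ : ℝ) :
    MemLp (fun x => Real.exp (μ * ρ x)) ⊤ volume := by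
  obtain ⟨M, hM⟩ := hρ.bounded
  refine memLp_top_of_bound (C := Real.exp (|μ| * M)) ?_ (Eventually.of_forall fun x => ?_)
  · exact (Real.continuous_exp.comp (hρ.smooth.continuous.const_mul _)).aestronglyMeasurable
  · rw [Real.norm_of_nonneg (Real.exp_pos _).le, Real.exp_le_exp]
    refine (le_abs_self _).trans ?_
    rw [abs_mul]
    gcongr
    exact hM x

theorem IsWeightExponent.memLp_gradient (hρ : IsWeightExponent ρ) :
    MemLp (gradient ρ) ⊤ volume :=
  memLp_top_of_bound (contDiff_gradient hρ.smooth).continuous.aestronglyMeasurable 1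
    (Eventually.of_forall hρ.gradient_le)

theorem IsWeightExponent.contDiff_exp (hρ : IsWeightExponent ρ) (μ : ℝ) :
    ContDiff ℝ ∞ (fun x => Real.exp (μ * ρ x)) :=
  (contDiff_const.mul hρ.smooth).exp

theorem IsWeightExponent.gradient_exp (hρ : IsWeightExponent ρ) (μ : ℝ) (x : EucSp n) :
    gradient (fun x => Real.exp (μ * ρ x)) x = (μ * Real.exp (μ * ρ x)) • gradient ρ x := by
  have h1 : HasFDerivAt ρ (fderiv ℝ ρ x) x := (hρ.smooth.differentiable (by simp) x).hasFDerivAt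
  have h2 := (h1.const_mul μ).exp
  refine ext_inner_right ℝ fun e => ?_
  rw [inner_gradient_left, h2.fderiv, real_inner_smul_left, inner_gradient_left]
  simp only [smul_apply, smul_eq_mul]
  ring

/-- Multiplication by `exp (μ ρ)` on `L²`. -/
noncomputable def IsWeightExponent.expMul (hρ : IsWeightExponent ρ) (μ : ℝ) (F : Type)
    [NormedAddCommGroup F] [InnerProductSpace ℝ F] : L2Sp n F →L[ℝ] L2Sp n F :=
  bddMul (ContinuousLinearMap.lsmul ℝ ℝ) (fun x => Real.exp (μ * ρ x)) (hρ.memLp_exp μ)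

/-- Multiplication by `∇ρ` on `L²`. -/
noncomputable def IsWeightExponent.gradMul (hρ : IsWeightExponent ρ) :
    L2Sp n ℝ →L[ℝ] L2Sp n (EucSp n) :=
  bddMul (ContinuousLinearMap.lsmul ℝ ℝ).flip (gradient ρ) hρ.memLp_gradient

theorem IsWeightExponent.coeFn_expMul (hρ : IsWeightExponent ρ) (μ : ℝ) {F : Type}
    [NormedAddCommGroup F] [InnerProductSpace ℝ F] (f : L2Sp n F) :
    hρ.expMul μ F f =ᵐ[volume] fun x => Real.exp (μ * ρ x) • f x :=
  coeFn_bddMul _ _ (hρ.memLp_exp μ) f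

theorem IsWeightExponent.coeFn_gradMul (hρ : IsWeightExponent ρ) (f : L2Sp n ℝ) :
    hρ.gradMul f =ᵐ[volume] fun x => f x • gradient ρ x :=
  coeFn_bddMul (ContinuousLinearMap.lsmul ℝ ℝ).flip _ hρ.memLp_gradient f

theorem IsWeightExponent.norm_gradMul_le (hρ : IsWeightExponent ρ) (f : L2Sp n ℝ) :
    ‖hρ.gradMul f‖ ≤ ‖f‖ := by
  refine Lp.norm_le_norm_of_ae_le ?_
  filter_upwards [hρ.coeFn_gradMul f] with x hx
  rw [hx, norm_smul]
  exact mul_le_of_le_one_right (norm_nonneg _) (hρ.gradient_le x)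

theorem IsWeightExponent.inner_expMul (hρ : IsWeightExponent ρ) (μ : ℝ) {F : Type}
    [NormedAddCommGroup F] [InnerProductSpace ℝ F] (f g : L2Sp n F) :
    inner ℝ (hρ.expMul μ F f) g = (inner ℝ f (hρ.expMul μ F g) : ℝ) := by
  rw [L2.inner_def, L2.inner_def]
  apply integral_congr_ae
  filter_upwards [hρ.coeFn_expMul μ f, hρ.coeFn_expMul μ g] with x h1 h2
  rw [h1, h2, real_inner_smul_left, real_inner_smul_right]

theorem IsWeightExponent.isWeakGrad_expMul (hρ : IsWeightExponent ρ) (μ : ℝ) {W : L2Sp n ℝ}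
    {D : L2Sp n (EucSp n)} (h : IsWeakGrad W D) :
    IsWeakGrad (hρ.expMul μ ℝ W)
      (hρ.expMul μ (EucSp n) D + μ • hρ.gradMul (hρ.expMul μ ℝ W) : L2Sp n (EucSp n)) := by
  refine (h.mul_smooth (Lp.memLp W) (Lp.memLp D) (hρ.contDiff_exp μ)).congr ?_ ?_
  · filter_upwards [hρ.coeFn_expMul μ W] with x h1
    rw [h1, smul_eq_mul]
  · filter_upwards [Lp.coeFn_add (hρ.expMul μ (EucSp n) D) (μ • hρ.gradMul (hρ.expMul μ ℝ W)),
      hρ.coeFn_expMul μ D, Lp.coeFn_smul μ (hρ.gradMul (hρ.expMul μ ℝ W)),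
      hρ.coeFn_gradMul (hρ.expMul μ ℝ W), hρ.coeFn_expMul μ W] with x h1 h2 h3 h4 h5
    rw [h1, Pi.add_apply, h2, h3, Pi.smul_apply, h4, h5, hρ.gradient_exp, smul_smul, smul_smul,
      smul_eq_mul]
    congr 2
    ring

/-- The weight e^{2μρ} is kept as e^{μρ} applied twice: symmetry then turns the quadratic forms of
the energy identity into squared norms. -/
theorem IsWeightExponent.isWeakGrad_expMul_sq (hρ : IsWeightExponent ρ) (μ : ℝ) {W : L2Sp n ℝ}
    {D : L2Sp n (EucSp n)} (h : IsWeakGrad W D) :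
    IsWeakGrad (hρ.expMul μ ℝ (hρ.expMul μ ℝ W))
      (hρ.expMul μ (EucSp n) (hρ.expMul μ (EucSp n) D) +
        (2 * μ) • hρ.expMul μ (EucSp n) (hρ.gradMul (hρ.expMul μ ℝ W)) : L2Sp n (EucSp n)) := by
  have h2 := hρ.isWeakGrad_expMul μ (hρ.isWeakGrad_expMul μ h)
  suffices e : hρ.expMul μ (EucSp n) (hρ.gradMul (hρ.expMul μ ℝ W)) =
      hρ.gradMul (hρ.expMul μ ℝ (hρ.expMul μ ℝ W)) by
    rw [map_add, map_smul, add_assoc, e, ← add_smul, ← two_mul] at h2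
    rwa [e]

  refine Lp.ext ?_
  filter_upwards [hρ.coeFn_expMul μ (hρ.gradMul (hρ.expMul μ ℝ W)),
    hρ.coeFn_gradMul (hρ.expMul μ ℝ W),
    hρ.coeFn_gradMul (hρ.expMul μ ℝ (hρ.expMul μ ℝ W)),
    hρ.coeFn_expMul μ (hρ.expMul μ ℝ W)] with x h1 h2 h3 h4
  rw [h1, h2, h3, h4, smul_smul, smul_eq_mul]

/-- The part of the weighted energy involving the first derivatives. -/
noncomputable def IsWeightExponent.kinetic (hρ : IsWeightExponent ρ) (μ : ℝ) (Wt : L2Sp n ℝ)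
    (D : L2Sp n (EucSp n)) : ℝ :=
  ‖hρ.expMul μ ℝ Wt‖ ^ 2 + ‖hρ.expMul μ (EucSp n) D‖ ^ 2

/-- The gradient of the weight produces a cross term at most 4μ‖e^{μρ}D‖‖e^{μρ}Wt‖, because |∇ρ| ≤
1, and this is at most 2μ times the kinetic energy. The rate 2μ encodes propagation speed 1. -/
theorem IsWeightExponent.kinetic_le (hρ : IsWeightExponent ρ) {μ : ℝ} (hμ : 0 < μ) {S : ℝ}
    {W Wt : ℝ → L2Sp n ℝ} {D : ℝ → L2Sp n (EucSp n)} {f : ℝ → L2Sp n ℝ}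
    (hw : IsWaveCurve S W Wt D f) {t : ℝ} (ht : 0 ≤ t) (htS : t < S) :
    hρ.kinetic μ (Wt t) (D t) ≤ hρ.kinetic μ (Wt 0) (D 0) +
      ∫ s in (0 : ℝ)..t, (2 * (‖hρ.expMul μ ℝ (f s)‖ * ‖hρ.expMul μ ℝ (Wt s)‖) +
        2 * μ * hρ.kinetic μ (Wt s) (D s)) := by
  set B := hρ.expMul μ ℝ with hB
  set B' := hρ.expMul μ (EucSp n) with hB'
  have key := hw.energy_identity (B.comp B) (B'.comp B')
    ((2 * μ) • (B'.comp (hρ.gradMul.comp B)))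
    (fun x y => by simp only [ContinuousLinearMap.comp_apply]; rw [hρ.inner_expMul, hρ.inner_expMul])
    (fun x y => by simp only [ContinuousLinearMap.comp_apply]; rw [hρ.inner_expMul, hρ.inner_expMul])
    (fun x y h => hρ.isWeakGrad_expMul_sq μ h) ht htS
  have hsq : ∀ x, inner ℝ x (B (B x)) = ‖B x‖ ^ 2 := fun x => by
    rw [← hρ.inner_expMul, real_inner_self_eq_norm_sq]
  have hsq' : ∀ x, inner ℝ x (B' (B' x)) = ‖B' x‖ ^ 2 := fun x => by
    rw [← hρ.inner_expMul, real_inner_self_eq_norm_sq]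
  simp only [ContinuousLinearMap.comp_apply, smul_apply, hsq, hsq'] at key
  rw [IsWeightExponent.kinetic, IsWeightExponent.kinetic, key]
  have hsub : Set.uIcc 0 t ⊆ Set.Icc 0 S := by
    rw [Set.uIcc_of_le ht]; exact Set.Icc_subset_Icc_right htS.le
  have cf := hw.continuousOn_source.mono hsub
  have cw := hw.continuousOn_deriv.mono hsub
  have cd := hw.continuousOn_grad.mono hsub
  gcongr
  refine intervalIntegral.integral_mono_on ht ?_ ?_ ?_
  · refine ContinuousOn.intervalIntegrable ?_
    refine ((cf.inner ?_).const_mul _).sub ((cd.inner ?_).const_mul _)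
    · exact B.continuous.comp_continuousOn (B.continuous.comp_continuousOn cw)
    · exact (B'.continuous.comp_continuousOn (hρ.gradMul.continuous.comp_continuousOn
        (B.continuous.comp_continuousOn cw))).const_smul (2 * μ)
  · refine ContinuousOn.intervalIntegrable ?_
    have c1 := (B.continuous.comp_continuousOn cw).norm
    have c2 := (B'.continuous.comp_continuousOn cd).norm
    have c3 := (B.continuous.comp_continuousOn cf).norm
    exact ((c3.mul c1).const_mul _).add (((c1.pow 2).add (c2.pow 2)).const_mul _)
  · intro s _
    rw [← hρ.inner_expMul, ← hB, IsWeightExponent.kinetic, ← hB, ← hB']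
    have i1 : inner ℝ (B (f s)) (B (Wt s)) ≤ ‖B (f s)‖ * ‖B (Wt s)‖ := real_inner_le_norm _ _
    have i2 : |inner ℝ (D s) ((2 * μ) • B' (hρ.gradMul (B (Wt s))))| ≤
        2 * μ * (‖B' (D s)‖ * ‖B (Wt s)‖) := by
      rw [real_inner_smul_right, ← hρ.inner_expMul, abs_mul, abs_of_pos (by linarith)]
      gcongr
      refine (abs_real_inner_le_norm _ _).trans ?_
      gcongr
      exact hρ.norm_gradMul_le _
    have i3 := (abs_le.mp i2).1
    have i4 : 2 * (‖B' (D s)‖ * ‖B (Wt s)‖) ≤ ‖B (Wt s)‖ ^ 2 + ‖B' (D s)‖ ^ 2 := by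
      nlinarith [sq_nonneg (‖B (Wt s)‖ - ‖B' (D s)‖)]
    have i5 := mul_le_mul_of_nonneg_left i4 (by linarith : 0 ≤ 2 * μ)
    linarith

theorem IsWeightExponent.norm_sq_le (hρ : IsWeightExponent ρ) {μ : ℝ} {S : ℝ}
    {W Wt : ℝ → L2Sp n ℝ} {D : ℝ → L2Sp n (EucSp n)} {f : ℝ → L2Sp n ℝ}
    (hw : IsWaveCurve S W Wt D f) {t : ℝ} (ht : 0 ≤ t) (htS : t < S) :
    ‖hρ.expMul μ ℝ (W t)‖ ^ 2 ≤ ‖hρ.expMul μ ℝ (W 0)‖ ^ 2 +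
      ∫ s in (0 : ℝ)..t, 2 * (‖hρ.expMul μ ℝ (W s)‖ * ‖hρ.expMul μ ℝ (Wt s)‖) := by
  set B := hρ.expMul μ ℝ with hB
  have hsub : Set.Icc 0 t ⊆ Set.Icc 0 S := Set.Icc_subset_Icc_right htS.le
  have cW : ContinuousOn W (Set.Icc 0 t) :=
    fun r hr => (hw.hasDeriv r (hsub hr)).continuousWithinAt.mono hsub
  have cw := hw.continuousOn_deriv.mono hsub
  have key : ∫ s in (0 : ℝ)..t, 2 * (inner ℝ (B (W s)) (B (Wt s)) : ℝ) =
      ‖B (W t)‖ ^ 2 - ‖B (W 0)‖ ^ 2 := by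
    refine intervalIntegral.integral_eq_sub_of_hasDerivAt_of_le ht
      (f := fun s => ‖B (W s)‖ ^ 2) ?_ ?_ ?_
    · exact (B.continuous.comp_continuousOn cW).norm.pow 2
    · intro r hr
      have h1 : HasDerivAt W (Wt r) r := by
        refine (hw.hasDeriv r (hsub (Set.Ioo_subset_Icc_self hr))).hasDerivAt ?_
        exact Icc_mem_nhds hr.1 (hr.2.trans htS)
      have h2 := B.hasFDerivAt.comp_hasDerivAt r h1
      simpa using h2.norm_sq
    · refine ContinuousOn.intervalIntegrable ?_
      rw [Set.uIcc_of_le ht]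
      exact ((B.continuous.comp_continuousOn cW).inner
        (B.continuous.comp_continuousOn cw)).const_mul _
  have : ‖B (W t)‖ ^ 2 = ‖B (W 0)‖ ^ 2 + ∫ s in (0 : ℝ)..t, 2 * (inner ℝ (B (W s)) (B (Wt s)) : ℝ) := by
    rw [key]; ring
  rw [this]
  gcongr
  refine intervalIntegral.integral_mono_on ht ?_ ?_ ?_
  · refine ContinuousOn.intervalIntegrable ?_
    rw [Set.uIcc_of_le ht]
    exact ((B.continuous.comp_continuousOn cW).inner
        (B.continuous.comp_continuousOn cw)).const_mul _
  · refine ContinuousOn.intervalIntegrable ?_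
    rw [Set.uIcc_of_le ht]
    exact ((B.continuous.comp_continuousOn cW).norm.mul
        (B.continuous.comp_continuousOn cw).norm).const_mul _
  · intro s _
    gcongr
    exact real_inner_le_norm _ _

/-- The weighted energy, including the function itself with a factor `κ (2μ)²`. -/
noncomputable def IsWeightExponent.energy (hρ : IsWeightExponent ρ) (μ κ : ℝ) (W Wt : L2Sp n ℝ)
    (D : L2Sp n (EucSp n)) : ℝ :=
  hρ.kinetic μ Wt D + κ * (2 * μ) ^ 2 * ‖hρ.expMul μ ℝ W‖ ^ 2

/-- With the factor (2μ)² in front of ‖e^{μρ}W‖², the inequality 2·(2μ)ab ≤ (2μ)²a² + b² shows that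
the new term raises the rate only by 2μκ, so a small κ keeps the speed close to 1. -/
theorem IsWeightExponent.energy_le (hρ : IsWeightExponent ρ) {μ κ : ℝ} (hμ : 0 < μ) (hκ : 0 ≤ κ)
    {S : ℝ} {W Wt : ℝ → L2Sp n ℝ} {D : ℝ → L2Sp n (EucSp n)} {f : ℝ → L2Sp n ℝ}
    (hw : IsWaveCurve S W Wt D f) {t : ℝ} (ht : 0 ≤ t) (htS : t < S) :
    hρ.energy μ κ (W t) (Wt t) (D t) ≤ hρ.energy μ κ (W 0) (Wt 0) (D 0) +
      ∫ s in (0 : ℝ)..t, (2 * μ * (1 + κ) * hρ.energy μ κ (W s) (Wt s) (D s) +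
        2 * (‖hρ.expMul μ ℝ (f s)‖ * ‖hρ.expMul μ ℝ (Wt s)‖)) := by
  have h1 := hρ.kinetic_le hμ hw ht htS
  have h2 := hρ.norm_sq_le (μ := μ) hw ht htS
  have h3 := mul_le_mul_of_nonneg_left h2 (by positivity : 0 ≤ κ * (2 * μ) ^ 2)
  set B := hρ.expMul μ ℝ with hB
  set B' := hρ.expMul μ (EucSp n) with hB'
  have hsub : Set.uIcc 0 t ⊆ Set.Icc 0 S := by
    rw [Set.uIcc_of_le ht]; exact Set.Icc_subset_Icc_right htS.le
  have cf := B.continuous.comp_continuousOn (hw.continuousOn_source.mono hsub)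
  have cw := B.continuous.comp_continuousOn (hw.continuousOn_deriv.mono hsub)
  have cW : ContinuousOn (fun s => B (W s)) (Set.uIcc 0 t) := B.continuous.comp_continuousOn
    (fun r hr => (hw.hasDeriv r (hsub hr)).continuousWithinAt.mono hsub)
  have cd := B'.continuous.comp_continuousOn (hw.continuousOn_grad.mono hsub)
  simp only [Function.comp_def] at cf cw cd
  have ck : ContinuousOn (fun s => hρ.kinetic μ (Wt s) (D s)) (Set.uIcc 0 t) :=
    (cw.norm.pow 2).add (cd.norm.pow 2)
  have i1 : IntervalIntegrable (fun s => 2 * (‖B (f s)‖ * ‖B (Wt s)‖) +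
        2 * μ * hρ.kinetic μ (Wt s) (D s)) volume 0 t :=
    (((cf.norm.mul cw.norm).const_mul _).add (ck.const_mul _)).intervalIntegrable
  have i2 : IntervalIntegrable (fun s => κ * (2 * μ) ^ 2 * (2 * (‖B (W s)‖ * ‖B (Wt s)‖)))
      volume 0 t :=
    (((cW.norm.mul cw.norm).const_mul _).const_mul _).intervalIntegrable
  rw [mul_add, ← intervalIntegral.integral_const_mul] at h3
  have h4 : ∫ s in (0 : ℝ)..t, ((2 * (‖B (f s)‖ * ‖B (Wt s)‖) +
        2 * μ * hρ.kinetic μ (Wt s) (D s)) + κ * (2 * μ) ^ 2 * (2 * (‖B (W s)‖ * ‖B (Wt s)‖))) ≤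
      ∫ s in (0 : ℝ)..t, (2 * μ * (1 + κ) * hρ.energy μ κ (W s) (Wt s) (D s) +
        2 * (‖B (f s)‖ * ‖B (Wt s)‖)) := by
    refine intervalIntegral.integral_mono_on ht (i1.add i2) ?_ ?_
    · refine ContinuousOn.intervalIntegrable ?_
      exact ((ck.add ((cW.norm.pow 2).const_mul _)).const_mul _).add
        ((cf.norm.mul cw.norm).const_mul _)
    · intro s _
      rw [IsWeightExponent.energy, ← hB]
      have a1 : ‖B (Wt s)‖ ^ 2 ≤ hρ.kinetic μ (Wt s) (D s) := by
        rw [IsWeightExponent.kinetic]; linarith [sq_nonneg ‖B' (D s)‖]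
      have a2 : (2 * μ) * (2 * (‖B (W s)‖ * ‖B (Wt s)‖)) ≤
          (2 * μ) ^ 2 * ‖B (W s)‖ ^ 2 + ‖B (Wt s)‖ ^ 2 := by
        nlinarith [sq_nonneg (2 * μ * ‖B (W s)‖ - ‖B (Wt s)‖)]
      have a3 : κ * (2 * μ) ^ 2 * (2 * (‖B (W s)‖ * ‖B (Wt s)‖)) ≤
          2 * μ * κ * ((2 * μ) ^ 2 * ‖B (W s)‖ ^ 2 + hρ.kinetic μ (Wt s) (D s)) := by
        have := mul_le_mul_of_nonneg_left (a2.trans (add_le_add_right a1 _))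
          (by positivity : 0 ≤ 2 * μ * κ)
        linarith
      have a4 : 0 ≤ 2 * μ * κ * (κ * (2 * μ) ^ 2 * ‖B (W s)‖ ^ 2) := by positivity
      linarith
  rw [intervalIntegral.integral_add i1 i2] at h4
  rw [IsWeightExponent.energy, IsWeightExponent.energy]
  linarith

end Weight

/-! ### Growth of the coupled weighted energy -/

/-- An integral inequality with memory: exponential growth bounds propagate. -/
theorem le_mul_exp_of_integral_le {E R : ℝ → ℝ} {t₀ μ c : ℝ} (ht₀ : 0 ≤ t₀) (hμ : 0 < μ)
    (hc : 0 ≤ c) (hE : ContinuousOn E (Set.Icc 0 t₀)) (hE0 : ∀ t ∈ Set.Icc 0 t₀, 0 ≤ E t)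
    (hR : ContinuousOn R (Set.Icc 0 t₀))
    (hle : ∀ t ∈ Set.Icc 0 t₀, E t ≤ E 0 + ∫ s in (0 : ℝ)..t, (μ * E s + R s))
    (hRle : ∀ s ∈ Set.Icc 0 t₀, ∀ M, 0 ≤ M → (∀ τ ∈ Set.Icc 0 s, E τ ≤ M) → R s ≤ c * M) :
    ∀ t ∈ Set.Icc 0 t₀, E t ≤ E 0 * Real.exp ((μ + c) * t) := by
  have hν : 0 < μ + c := by linarith
  have hcont : ContinuousOn (fun t => E t * Real.exp (-((μ + c) * t))) (Set.Icc 0 t₀) :=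
    hE.mul (by fun_prop)
  -- R sees the whole past of E, so the argument looks at the maximum M of E e^{-(μ+c)t}, attained
  -- at t'. Inserting E ≤ M e^{(μ+c)t} in the integral gives E t' ≤ E 0 + M e^{(μ+c)t'} - M, and E
  -- t' = M e^{(μ+c)t'} leaves M ≤ E 0.
  obtain ⟨t', ht', hmax⟩ := isCompact_Icc.exists_isMaxOn (Set.nonempty_Icc.mpr ht₀) hcont
  set M := E t' * Real.exp (-((μ + c) * t')) with hM
  have hM0 : 0 ≤ M := mul_nonneg (hE0 t' ht') (Real.exp_pos _).le
  have hbd : ∀ t ∈ Set.Icc 0 t₀, E t ≤ M * Real.exp ((μ + c) * t) := by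
    intro t ht
    have h1 : E t * Real.exp (-((μ + c) * t)) ≤ M := hmax ht
    have h2 := mul_le_mul_of_nonneg_right h1 (Real.exp_pos ((μ + c) * t)).le
    rwa [mul_assoc, ← Real.exp_add, neg_add_cancel, Real.exp_zero, mul_one] at h2
  have hsub : Set.Icc 0 t' ⊆ Set.Icc 0 t₀ := Set.Icc_subset_Icc_right ht'.2
  have hint : ∫ s in (0 : ℝ)..t', (μ * E s + R s) ≤
      ∫ s in (0 : ℝ)..t', M * ((μ + c) * Real.exp ((μ + c) * s)) := by
    refine intervalIntegral.integral_mono_on ht'.1 ?_ ?_ ?_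
    · refine ContinuousOn.intervalIntegrable ?_
      rw [Set.uIcc_of_le ht'.1]
      exact ((hE.mono hsub).const_mul _).add (hR.mono hsub)
    · exact (by fun_prop : Continuous _).intervalIntegrable _ _
    · intro s hs
      have h1 := hbd s (hsub hs)
      have h2 := hRle s (hsub hs) (M * Real.exp ((μ + c) * s)) (by positivity) (by
        intro τ hτ
        refine (hbd τ (hsub ⟨hτ.1, hτ.2.trans hs.2⟩)).trans ?_
        gcongr
        exact hτ.2)
      have h3 := mul_le_mul_of_nonneg_left h1 hμ.le
      linarith
  have hval : ∫ s in (0 : ℝ)..t', M * ((μ + c) * Real.exp ((μ + c) * s)) =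
      M * Real.exp ((μ + c) * t') - M := by
    rw [intervalIntegral.integral_eq_sub_of_hasDerivAt
      (f := fun s => M * Real.exp ((μ + c) * s))]
    · simp
    · intro s _
      have h1 : HasDerivAt (fun s => (μ + c) * s) (μ + c) s := by
        simpa using (hasDerivAt_id s).const_mul (μ + c)
      refine (h1.exp.const_mul M).congr_deriv ?_
      ring
    · exact (by fun_prop : Continuous _).intervalIntegrable _ _
  have hEM : E t' = M * Real.exp ((μ + c) * t') := by
    rw [hM, mul_assoc, ← Real.exp_add, neg_add_cancel, Real.exp_zero, mul_one]
  have hfin := hle t' ht'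
  have hME : M ≤ E 0 := by linarith
  intro t ht
  refine (hbd t ht).trans ?_
  gcongr

section Source

variable {n : ℕ} {ρ : EucSp n → ℝ}

/-- Only the L¹ norm of `g` enters, so a singularity of the kernel at 0 is harmless and the factor
does not depend on the operator. -/
theorem norm_clm_memoryL2_le {H K : Type*} [NormedAddCommGroup H] [NormedSpace ℝ H]
    [CompleteSpace H] [NormedAddCommGroup K] [NormedSpace ℝ K] [CompleteSpace K]
    (B : H →L[ℝ] K) {g : ℝ → ℝ} {N : ℝ → H} {S s X : ℝ}
    (hg : IntegrableOn g (Set.Ioc 0 S) volume) (hN : ContinuousOn N (Set.Icc 0 S))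
    (hs : s ∈ Set.Icc 0 S) (hX : 0 ≤ X) (hB : ∀ τ ∈ Set.Icc 0 s, ‖B (N τ)‖ ≤ X) :
    ‖B (memoryL2 g N s)‖ ≤ (∫ σ in Set.Ioc 0 S, ‖g σ‖) * X := by
  have hgs := intervalIntegrable_comp_sub_left hg hs
  have hi : IntervalIntegrable (fun τ => g (s - τ) • N τ) volume 0 s := by
    refine hgs.smul_continuousOn ?_
    rw [Set.uIcc_of_le hs.1]
    exact hN.mono (Set.Icc_subset_Icc_right hs.2)
  rw [memoryL2, ← B.intervalIntegral_comp_comm hi]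
  have h1 : ‖∫ τ in (0 : ℝ)..s, B (g (s - τ) • N τ)‖ ≤ ∫ τ in (0 : ℝ)..s, ‖g (s - τ)‖ * X := by
    refine intervalIntegral.norm_integral_le_of_norm_le hs.1 ?_ (hgs.norm.mul_const X)
    refine Eventually.of_forall fun τ hτ => ?_
    rw [map_smul, norm_smul]
    gcongr
    exact hB τ (Set.Ioc_subset_Icc_self hτ)
  refine h1.trans ?_
  rw [intervalIntegral.integral_mul_const]
  gcongr
  have h2 := intervalIntegral.integral_comp_sub_left (a := 0) (b := s) (fun σ => ‖g σ‖) s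
  simp only [sub_self, sub_zero] at h2
  rw [h2, intervalIntegral.integral_of_le hs.1]
  exact setIntegral_mono_set hg.norm (Eventually.of_forall fun _ => norm_nonneg _)
    (Set.Ioc_subset_Ioc_right hs.2).eventuallyLE

theorem IsWeightExponent.energy_nonneg (hρ : IsWeightExponent ρ) {μ κ : ℝ} (hκ : 0 ≤ κ)
    (W Wt : L2Sp n ℝ) (D : L2Sp n (EucSp n)) : 0 ≤ hρ.energy μ κ W Wt D := by
  rw [IsWeightExponent.energy, IsWeightExponent.kinetic]
  positivity

theorem IsWeightExponent.norm_deriv_le (hρ : IsWeightExponent ρ) {μ κ : ℝ} (hκ : 0 ≤ κ)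
    (W Wt : L2Sp n ℝ) (D : L2Sp n (EucSp n)) :
    ‖hρ.expMul μ ℝ Wt‖ ≤ √(hρ.energy μ κ W Wt D) := by
  apply Real.le_sqrt_of_sq_le
  rw [IsWeightExponent.energy, IsWeightExponent.kinetic]
  have : 0 ≤ κ * (2 * μ) ^ 2 * ‖hρ.expMul μ ℝ W‖ ^ 2 := by positivity
  linarith [sq_nonneg ‖hρ.expMul μ (EucSp n) D‖]

theorem IsWeightExponent.norm_grad_le (hρ : IsWeightExponent ρ) {μ κ : ℝ} (hκ : 0 ≤ κ)
    (W Wt : L2Sp n ℝ) (D : L2Sp n (EucSp n)) :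
    ‖hρ.expMul μ (EucSp n) D‖ ≤ √(hρ.energy μ κ W Wt D) := by
  apply Real.le_sqrt_of_sq_le
  rw [IsWeightExponent.energy, IsWeightExponent.kinetic]
  have : 0 ≤ κ * (2 * μ) ^ 2 * ‖hρ.expMul μ ℝ W‖ ^ 2 := by positivity
  linarith [sq_nonneg ‖hρ.expMul μ ℝ Wt‖]

theorem IsWeightExponent.norm_self_le (hρ : IsWeightExponent ρ) {μ κ : ℝ} (hκ : 0 ≤ κ)
    (W Wt : L2Sp n ℝ) (D : L2Sp n (EucSp n)) :
    √κ * (2 * μ * ‖hρ.expMul μ ℝ W‖) ≤ √(hρ.energy μ κ W Wt D) := by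
  apply Real.le_sqrt_of_sq_le
  rw [mul_pow, Real.sq_sqrt hκ, mul_pow, IsWeightExponent.energy, IsWeightExponent.kinetic]
  linarith [sq_nonneg ‖hρ.expMul μ (EucSp n) D‖, sq_nonneg ‖hρ.expMul μ ℝ Wt‖]

/-- The weak gradient of e^{μρ}W contains μ e^{μρ}W∇ρ. The energy controls 2μ‖e^{μρ}W‖ at the price
of 1/√κ, so the constant does not depend on μ. -/
theorem IsWeightExponent.norm_powL2_le (hρ : IsWeightExponent ρ) {μ κ p C M : ℝ} (hκ : 0 < κ)
    (hμ : 1 ≤ μ) (hp : 1 < p) (hC0 : 0 < C) (hC : IsSobolevConst n p C) {W : L2Sp n ℝ}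
    {D : L2Sp n (EucSp n)} (h : IsWeakGrad W D) (hM : ‖W‖ + ‖D‖ ≤ M) (Wt : L2Sp n ℝ) :
    ‖hρ.expMul μ ℝ (powL2 p W)‖ ≤
      (C * M) ^ (p - 1) * (C * (1 + (√κ)⁻¹)) * √(hρ.energy μ κ W Wt D) := by
  have h1 := hC.norm_bddMul_powL2_le hC0 hp h (hρ.memLp_exp μ) (hρ.isWeakGrad_expMul μ h)
    (hρ.coeFn_expMul μ W)
  refine h1.trans ?_
  rw [mul_assoc, mul_assoc]
  have h2 := hρ.norm_self_le (μ := μ) hκ.le W Wt D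
  have h3 := hρ.norm_grad_le (μ := μ) hκ.le W Wt D
  have hk : 0 < √κ := Real.sqrt_pos.mpr hκ
  set e := √(hρ.energy μ κ W Wt D) with he
  have h4 : 2 * μ * ‖hρ.expMul μ ℝ W‖ ≤ (√κ)⁻¹ * e := by
    rw [le_inv_mul_iff₀ hk]; exact h2
  have h5 : ‖hρ.expMul μ (EucSp n) D + μ • hρ.gradMul (hρ.expMul μ ℝ W)‖ ≤
      ‖hρ.expMul μ (EucSp n) D‖ + μ * ‖hρ.expMul μ ℝ W‖ := by
    refine (norm_add_le _ _).trans ?_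
    rw [norm_smul, Real.norm_of_nonneg (by linarith : 0 ≤ μ)]
    gcongr
    exact hρ.norm_gradMul_le _
  have h6 : ‖hρ.expMul μ ℝ W‖ ≤ μ * ‖hρ.expMul μ ℝ W‖ := le_mul_of_one_le_left (norm_nonneg _) hμ
  have hM0 : 0 ≤ ‖W‖ + ‖D‖ := by positivity
  have hM1 : 0 ≤ M := hM0.trans hM
  have h7 : ‖hρ.expMul μ ℝ W‖ + ‖hρ.expMul μ (EucSp n) D + μ • hρ.gradMul (hρ.expMul μ ℝ W)‖ ≤
      (1 + (√κ)⁻¹) * e := by linarith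
  gcongr

end Source

section Coupled

variable {n : ℕ}

theorem IsWaveCurve.continuousOn {S : ℝ} {W Wt : ℝ → L2Sp n ℝ} {D : ℝ → L2Sp n (EucSp n)}
    {f : ℝ → L2Sp n ℝ} (hw : IsWaveCurve S W Wt D f) : ContinuousOn W (Set.Icc 0 S) :=
  fun t ht => (hw.hasDeriv t ht).continuousWithinAt

theorem IsWaveCurve.exists_bound {S : ℝ} {W Wt : ℝ → L2Sp n ℝ} {D : ℝ → L2Sp n (EucSp n)}
    {f : ℝ → L2Sp n ℝ} (hw : IsWaveCurve S W Wt D f) :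
    ∃ M, 0 ≤ M ∧ ∀ t ∈ Set.Icc 0 S, ‖W t‖ + ‖D t‖ ≤ M := by
  obtain ⟨M, hM⟩ := isCompact_Icc.exists_bound_of_continuousOn
    (hw.continuousOn.norm.add hw.continuousOn_grad.norm)
  refine ⟨max M 0, le_max_right _ _, fun t ht => ?_⟩
  exact ((le_abs_self _).trans (hM t ht)).trans (le_max_left _ _)

theorem IsWaveCurve.continuousOn_energy {S : ℝ} {W Wt : ℝ → L2Sp n ℝ} {D : ℝ → L2Sp n (EucSp n)}
    {f : ℝ → L2Sp n ℝ} (hw : IsWaveCurve S W Wt D f) {ρ : EucSp n → ℝ} (hρ : IsWeightExponent ρ)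
    (μ κ : ℝ) : ContinuousOn (fun t => hρ.energy μ κ (W t) (Wt t) (D t)) (Set.Icc 0 S) := by
  have c1 := (hρ.expMul μ ℝ).continuous.comp_continuousOn hw.continuousOn
  have c2 := (hρ.expMul μ ℝ).continuous.comp_continuousOn hw.continuousOn_deriv
  have c3 := (hρ.expMul μ (EucSp n)).continuous.comp_continuousOn hw.continuousOn_grad
  exact ((c2.norm.pow 2).add (c3.norm.pow 2)).add ((c1.norm.pow 2).const_mul _)

/-- Growth of the weighted energy of a coupled system: the exponential rate is `2μ(1 + κ)` up to
a constant that does not depend on the weight. -/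
theorem exists_energy_growth {S p q C C' κ : ℝ} (hp : 1 < p) (hq : 1 < q)
    (hC0 : 0 < C) (hC : IsSobolevConst n p C) (hC0' : 0 < C') (hC' : IsSobolevConst n q C')
    (hκ : 0 < κ) {g₁ g₂ : ℝ → ℝ} (hg₁ : IntegrableOn g₁ (Set.Ioc 0 S) volume)
    (hg₂ : IntegrableOn g₂ (Set.Ioc 0 S) volume)
    {W Wt Z Zt : ℝ → L2Sp n ℝ} {D DZ : ℝ → L2Sp n (EucSp n)}
    (hW : IsWaveCurve S W Wt D (memoryL2 g₁ fun t => powL2 p (Z t)))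
    (hZ : IsWaveCurve S Z Zt DZ (memoryL2 g₂ fun t => powL2 q (W t))) :
    ∃ c : ℝ, ∀ (ρ : EucSp n → ℝ) (hρ : IsWeightExponent ρ) (μ : ℝ), 1 ≤ μ → ∀ t, 0 ≤ t → t < S →
      hρ.energy μ κ (W t) (Wt t) (D t) + hρ.energy μ κ (Z t) (Zt t) (DZ t) ≤
        (hρ.energy μ κ (W 0) (Wt 0) (D 0) + hρ.energy μ κ (Z 0) (Zt 0) (DZ 0)) *
          Real.exp ((2 * μ * (1 + κ) + c) * t) := by
  obtain ⟨M, hM0, hM⟩ := hW.exists_bound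
  obtain ⟨M', hM0', hM'⟩ := hZ.exists_bound
  set Γ₁ := ∫ σ in Set.Ioc 0 S, ‖g₁ σ‖ with hΓ₁
  set Γ₂ := ∫ σ in Set.Ioc 0 S, ‖g₂ σ‖ with hΓ₂
  set K₁ := (C * M') ^ (p - 1) * (C * (1 + (√κ)⁻¹)) with hK₁
  set K₂ := (C' * M) ^ (q - 1) * (C' * (1 + (√κ)⁻¹)) with hK₂
  have hΓ₁0 : 0 ≤ Γ₁ := setIntegral_nonneg measurableSet_Ioc fun _ _ => norm_nonneg _
  have hΓ₂0 : 0 ≤ Γ₂ := setIntegral_nonneg measurableSet_Ioc fun _ _ => norm_nonneg _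
  have hK₁0 : 0 ≤ K₁ := by positivity
  have hK₂0 : 0 ≤ K₂ := by positivity
  -- The Γ's are the kernel masses, the K's come from the unweighted H¹ bounds on [0, S], and the 2
  -- is that of the source term in the energy inequality. None of them involves μ or ρ.
  refine ⟨2 * (Γ₁ * K₁ + Γ₂ * K₂), fun ρ hρ μ hμ t ht htS => ?_⟩
  have hsub : Set.Icc 0 t ⊆ Set.Icc 0 S := Set.Icc_subset_Icc_right htS.le
  have hμ0 : 0 < μ := by linarith
  have cpZ := hC.continuousOn_powL2 hC0 hp hZ.continuousOn hZ.continuousOn_grad hZ.weakGrad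
  have cpW := hC'.continuousOn_powL2 hC0' hq hW.continuousOn hW.continuousOn_grad hW.weakGrad
  set B := hρ.expMul μ ℝ with hB
  set E₁ := fun t => hρ.energy μ κ (W t) (Wt t) (D t) with hE₁
  set E₂ := fun t => hρ.energy μ κ (Z t) (Zt t) (DZ t) with hE₂
  have e₁0 : ∀ t, 0 ≤ E₁ t := fun t => hρ.energy_nonneg hκ.le _ _ _
  have e₂0 : ∀ t, 0 ≤ E₂ t := fun t => hρ.energy_nonneg hκ.le _ _ _
  have c1 : ContinuousOn E₁ (Set.Icc 0 S) := hW.continuousOn_energy hρ μ κ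
  have c2 : ContinuousOn E₂ (Set.Icc 0 S) := hZ.continuousOn_energy hρ μ κ
  set R₁ := fun s => 2 * (‖B (memoryL2 g₁ (fun t => powL2 p (Z t)) s)‖ * ‖B (Wt s)‖) with hR₁
  set R₂ := fun s => 2 * (‖B (memoryL2 g₂ (fun t => powL2 q (W t)) s)‖ * ‖B (Zt s)‖) with hR₂
  have cR₁ : ContinuousOn R₁ (Set.Icc 0 S) :=
    ((B.continuous.comp_continuousOn hW.continuousOn_source).norm.mul
      (B.continuous.comp_continuousOn hW.continuousOn_deriv).norm).const_mul _
  have cR₂ : ContinuousOn R₂ (Set.Icc 0 S) :=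
    ((B.continuous.comp_continuousOn hZ.continuousOn_source).norm.mul
      (B.continuous.comp_continuousOn hZ.continuousOn_deriv).norm).const_mul _
  refine le_mul_exp_of_integral_le (E := fun t => E₁ t + E₂ t) (R := fun t => R₁ t + R₂ t) (t₀ := t)
    (μ := 2 * μ * (1 + κ)) ht (by positivity) (by positivity) ((c1.add c2).mono hsub)
    (fun s _ => add_nonneg (e₁0 s) (e₂0 s)) ((cR₁.add cR₂).mono hsub) ?_ ?_ t ⟨ht, le_rfl⟩
  · intro s hs
    have hsS : s < S := hs.2.trans_lt htS
    have h1 := hρ.energy_le hμ0 hκ.le hW hs.1 hsS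
    have h2 := hρ.energy_le hμ0 hκ.le hZ hs.1 hsS
    have hsub' : Set.uIcc 0 s ⊆ Set.Icc 0 S := by
      rw [Set.uIcc_of_le hs.1]; exact Set.Icc_subset_Icc_right hsS.le
    have i1 : IntervalIntegrable (fun r => 2 * μ * (1 + κ) * E₁ r + R₁ r) volume 0 s :=
      (((c1.const_mul _).add cR₁).mono hsub').intervalIntegrable
    have i2 : IntervalIntegrable (fun r => 2 * μ * (1 + κ) * E₂ r + R₂ r) volume 0 s :=
      (((c2.const_mul _).add cR₂).mono hsub').intervalIntegrable
    have h3 : ∫ r in (0 : ℝ)..s, (2 * μ * (1 + κ) * (E₁ r + E₂ r) + (R₁ r + R₂ r)) =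
        (∫ r in (0 : ℝ)..s, (2 * μ * (1 + κ) * E₁ r + R₁ r)) +
        ∫ r in (0 : ℝ)..s, (2 * μ * (1 + κ) * E₂ r + R₂ r) := by
      rw [← intervalIntegral.integral_add i1 i2]
      refine intervalIntegral.integral_congr fun r _ => ?_
      ring
    rw [h3]
    change E₁ s + E₂ s ≤ E₁ 0 + E₂ 0 + _
    change E₁ s ≤ E₁ 0 + ∫ r in (0 : ℝ)..s, (2 * μ * (1 + κ) * E₁ r + R₁ r) at h1
    change E₂ s ≤ E₂ 0 + ∫ r in (0 : ℝ)..s, (2 * μ * (1 + κ) * E₂ r + R₂ r) at h2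
    linarith
  · intro s hs X hX hEX
    have hs' := hsub hs
    have hle₁ : ∀ τ ∈ Set.Icc 0 s, √(E₁ τ) ≤ √X := fun τ hτ =>
      Real.sqrt_le_sqrt (by linarith [hEX τ hτ, e₂0 τ])
    have hle₂ : ∀ τ ∈ Set.Icc 0 s, √(E₂ τ) ≤ √X := fun τ hτ =>
      Real.sqrt_le_sqrt (by linarith [hEX τ hτ, e₁0 τ])
    have hss : s ∈ Set.Icc 0 s := ⟨hs.1, le_rfl⟩
    have b1 : ‖B (memoryL2 g₁ (fun t => powL2 p (Z t)) s)‖ ≤ Γ₁ * (K₁ * √X) := by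
      refine norm_clm_memoryL2_le B hg₁ cpZ hs' (by positivity) fun τ hτ => ?_
      have hτ' : τ ∈ Set.Icc 0 S := ⟨hτ.1, hτ.2.trans hs'.2⟩
      refine (hρ.norm_powL2_le hκ hμ hp hC0 hC (hZ.weakGrad τ hτ') (hM' τ hτ') (Zt τ)).trans ?_
      exact mul_le_mul_of_nonneg_left (hle₂ τ hτ) hK₁0
    have b2 : ‖B (memoryL2 g₂ (fun t => powL2 q (W t)) s)‖ ≤ Γ₂ * (K₂ * √X) := by
      refine norm_clm_memoryL2_le B hg₂ cpW hs' (by positivity) fun τ hτ => ?_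
      have hτ' : τ ∈ Set.Icc 0 S := ⟨hτ.1, hτ.2.trans hs'.2⟩
      refine (hρ.norm_powL2_le hκ hμ hq hC0' hC' (hW.weakGrad τ hτ') (hM τ hτ') (Wt τ)).trans ?_
      exact mul_le_mul_of_nonneg_left (hle₁ τ hτ) hK₂0
    have b3 : ‖B (Wt s)‖ ≤ √X := (hρ.norm_deriv_le hκ.le _ _ _).trans (hle₁ s hss)
    have b4 : ‖B (Zt s)‖ ≤ √X := (hρ.norm_deriv_le hκ.le _ _ _).trans (hle₂ s hss)
    have hXX : √X * √X = X := Real.mul_self_sqrt hX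
    have r1 : R₁ s ≤ 2 * (Γ₁ * (K₁ * √X) * √X) := by
      simp only [hR₁]
      gcongr
    have r2 : R₂ s ≤ 2 * (Γ₂ * (K₂ * √X) * √X) := by
      simp only [hR₂]
      gcongr
    calc R₁ s + R₂ s ≤ 2 * (Γ₁ * (K₁ * √X) * √X) + 2 * (Γ₂ * (K₂ * √X) * √X) := add_le_add r1 r2
      _ = 2 * (Γ₁ * K₁ + Γ₂ * K₂) * (√X * √X) := by ring
      _ = _ := by rw [hXX]

end Coupled

/-! ### Finite speed of propagation -/

section FiniteSpeed

variable {n : ℕ}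

theorem L2_norm_sq_eq_integral {F : Type} [NormedAddCommGroup F] [InnerProductSpace ℝ F]
    (f : L2Sp n F) : ‖f‖ ^ 2 = ∫ x, ‖f x‖ ^ 2 := by
  rw [← real_inner_self_eq_norm_sq, L2.inner_def]
  simp only [real_inner_self_eq_norm_sq]

theorem L2_integrable_norm_sq {F : Type} [NormedAddCommGroup F] [InnerProductSpace ℝ F]
    (f : L2Sp n F) : Integrable (fun x => ‖f x‖ ^ 2) volume := by
  have := L2.integrable_inner (𝕜 := ℝ) f f
  simpa only [real_inner_self_eq_norm_sq] using this

theorem IsWeakGrad.ae_eq_zero {W : L2Sp n ℝ} {D : L2Sp n (EucSp n)} (h : IsWeakGrad W D)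
    {U : Set (EucSp n)} (hU : IsOpen U) (hW : ∀ᵐ x, x ∈ U → W x = 0) :
    ∀ᵐ x, x ∈ U → D x = 0 := by
  refine hU.ae_eq_zero_of_integral_contDiff_smul_eq_zero ?_ fun φ hφ hc hs => ?_
  · exact ((Lp.memLp D).locallyIntegrable (by norm_num)).locallyIntegrableOn U
  · refine ext_inner_left ℝ fun e => ?_
    let ψ : TestFun n := ⟨φ, hφ, hc⟩
    have i1 : Integrable (fun x => φ x • D x) volume := by
      rw [← memLp_one_iff_integrable]
      exact (Lp.memLp D).smul (ψ.memLp 2)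
    rw [← integral_inner i1, inner_zero_right]
    have h1 := h ψ e
    have h2 : ∫ x, W x * fderiv ℝ φ x e = 0 := by
      refine integral_eq_zero_of_ae ?_
      filter_upwards [hW] with x hx
      by_cases hxU : x ∈ U
      · rw [hx hxU]; simp
      · have : x ∉ tsupport (fderiv ℝ φ) := fun hx' => hxU (hs (tsupport_fderiv_subset ℝ hx'))
        rw [image_eq_zero_of_notMem_tsupport this]
        simp
    change ∫ x, W x * fderiv ℝ φ x e = -∫ x, φ x * inner ℝ (D x) e at h1
    rw [h2] at h1
    have h3 : ∀ x, inner ℝ e (φ x • D x) = φ x * inner ℝ (D x) e := fun x => by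
      rw [real_inner_smul_right, real_inner_comm]
    simp only [h3]
    linarith

theorem IsWeightExponent.norm_expMul_sq_le {ρ : EucSp n → ℝ} (hρ : IsWeightExponent ρ) {μ r : ℝ}
    (hμ : 0 ≤ μ) {F : Type} [NormedAddCommGroup F] [InnerProductSpace ℝ F] {f : L2Sp n F}
    (hf : ∀ᵐ x, r < ρ x → f x = 0) :
    ‖hρ.expMul μ F f‖ ^ 2 ≤ Real.exp (2 * μ * r) * ‖f‖ ^ 2 := by
  rw [L2_norm_sq_eq_integral, L2_norm_sq_eq_integral, ← integral_const_mul]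
  refine integral_mono_ae (L2_integrable_norm_sq _) ((L2_integrable_norm_sq _).const_mul _) ?_
  filter_upwards [hf, hρ.coeFn_expMul μ f] with x h1 h2
  rw [h2, norm_smul, mul_pow]
  by_cases hx : r < ρ x
  · simp [h1 hx]
  · push Not at hx
    gcongr
    rw [Real.norm_of_nonneg (Real.exp_pos _).le, ← Real.exp_nat_mul]
    rw [Real.exp_le_exp]
    push_cast
    nlinarith

theorem IsWeightExponent.le_norm_expMul_sq {ρ : EucSp n → ℝ} (hρ : IsWeightExponent ρ) {μ r : ℝ}
    (hμ : 0 ≤ μ) (f : L2Sp n ℝ) :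
    Real.exp (2 * μ * r) * ∫ x in {x | r ≤ ρ x}, ‖f x‖ ^ 2 ≤ ‖hρ.expMul μ ℝ f‖ ^ 2 := by
  have hms : MeasurableSet {x | r ≤ ρ x} :=
    measurableSet_le measurable_const hρ.smooth.continuous.measurable
  rw [L2_norm_sq_eq_integral, ← integral_const_mul, ← integral_indicator hms]
  refine integral_mono_ae ?_ (L2_integrable_norm_sq _) ?_
  · exact ((L2_integrable_norm_sq f).const_mul _).indicator hms
  filter_upwards [hρ.coeFn_expMul μ f] with x h2
  rw [h2, norm_smul, mul_pow]
  by_cases hx : x ∈ {x | r ≤ ρ x}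
  · rw [Set.indicator_of_mem hx]
    gcongr
    rw [Real.norm_of_nonneg (Real.exp_pos _).le, ← Real.exp_nat_mul, Real.exp_le_exp]
    push_cast
    have : r ≤ ρ x := hx
    nlinarith
  · rw [Set.indicator_of_notMem hx]
    positivity

/-- All terms are put under the factor (2μ)² ≥ 1 carried by the last one, so that it cancels against
the same factor in the energy at time t. -/
theorem IsWeightExponent.energy_initial_le {ρ : EucSp n → ℝ} (hρ : IsWeightExponent ρ)
    {μ r κ : ℝ} (hμ : 1 ≤ μ) (hκ : 0 ≤ κ) {W Wt : L2Sp n ℝ} {D : L2Sp n (EucSp n)}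
    (hW : ∀ᵐ x, r < ρ x → W x = 0) (hWt : ∀ᵐ x, r < ρ x → Wt x = 0) (hD : IsWeakGrad W D) :
    hρ.energy μ κ W Wt D ≤
      Real.exp (2 * μ * r) * ((2 * μ) ^ 2 * (‖Wt‖ ^ 2 + ‖D‖ ^ 2 + κ * ‖W‖ ^ 2)) := by
  have hD0 : ∀ᵐ x, r < ρ x → D x = 0 :=
    hD.ae_eq_zero (U := {x | r < ρ x}) (isOpen_lt continuous_const hρ.smooth.continuous) hW
  have hμ0 : 0 ≤ μ := by linarith
  have h1 := hρ.norm_expMul_sq_le hμ0 hW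
  have h2 := hρ.norm_expMul_sq_le hμ0 hWt
  have h3 := hρ.norm_expMul_sq_le hμ0 hD0
  have h4 : 1 ≤ (2 * μ) ^ 2 := by nlinarith
  have h5 := mul_le_mul_of_nonneg_left h1 (by positivity : 0 ≤ κ * (2 * μ) ^ 2)
  have h6 : Real.exp (2 * μ * r) * (‖Wt‖ ^ 2 + ‖D‖ ^ 2) ≤
      (2 * μ) ^ 2 * (Real.exp (2 * μ * r) * (‖Wt‖ ^ 2 + ‖D‖ ^ 2)) :=
    le_mul_of_one_le_left (by positivity) h4
  rw [IsWeightExponent.energy, IsWeightExponent.kinetic]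
  linarith

theorem ae_eq_zero_of_exp_bound {f : L2Sp n ℝ} {s : Set (EucSp n)} (hs : MeasurableSet s)
    {Q δ : ℝ} (hδ : 0 < δ)
    (h : ∀ μ : ℝ, 1 ≤ μ → ∫ x in s, ‖f x‖ ^ 2 ≤ Q * Real.exp (-(2 * μ * δ))) :
    ∀ᵐ x, x ∈ s → f x = 0 := by
  have hlim : Tendsto (fun μ : ℝ => Q * Real.exp (-(2 * μ * δ))) atTop (𝓝 (Q * 0)) := by
    refine Tendsto.const_mul _ (Real.tendsto_exp_neg_atTop_nhds_zero.comp ?_)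
    exact (tendsto_id.const_mul_atTop (by norm_num : (0 : ℝ) < 2)).atTop_mul_const hδ
  rw [mul_zero] at hlim
  have h0 : ∫ x in s, ‖f x‖ ^ 2 ≤ 0 :=
    ge_of_tendsto hlim (by filter_upwards [eventually_ge_atTop 1] with μ hμ using h μ hμ)
  have h1 : ∫ x in s, ‖f x‖ ^ 2 = 0 :=
    le_antisymm h0 (setIntegral_nonneg hs fun x _ => by positivity)
  rw [setIntegral_eq_zero_iff_of_nonneg_ae (Eventually.of_forall fun x => by positivity)
    (L2_integrable_norm_sq f).integrableOn] at h1
  have h2 := (ae_restrict_iff' hs).mp h1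
  filter_upwards [h2] with x hx hxs
  have := hx hxs
  simpa using this

/-- On the set in question the weight is at least exp(2μ(r + (1+κ)t + δ)), while the energy is at
most of order (2μ)² exp(2μr + 2μ(1+κ)t). The quotient is of order e^{-2μδ}, and μ → ∞. -/
theorem IsWeightExponent.ae_eq_zero_of_growth {ρ : EucSp n → ℝ} (hρ : IsWeightExponent ρ)
    {r κ c t δ : ℝ} (hκ : 0 < κ) (hδ : 0 < δ)
    {W Wt Z Zt : ℝ → L2Sp n ℝ} {D DZ : ℝ → L2Sp n (EucSp n)}
    (hW : ∀ᵐ x, r < ρ x → W 0 x = 0) (hWt : ∀ᵐ x, r < ρ x → Wt 0 x = 0)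
    (hD : IsWeakGrad (W 0) (D 0))
    (hZ : ∀ᵐ x, r < ρ x → Z 0 x = 0) (hZt : ∀ᵐ x, r < ρ x → Zt 0 x = 0)
    (hDZ : IsWeakGrad (Z 0) (DZ 0))
    (h : ∀ μ : ℝ, 1 ≤ μ →
      hρ.energy μ κ (W t) (Wt t) (D t) + hρ.energy μ κ (Z t) (Zt t) (DZ t) ≤
        (hρ.energy μ κ (W 0) (Wt 0) (D 0) + hρ.energy μ κ (Z 0) (Zt 0) (DZ 0)) *
          Real.exp ((2 * μ * (1 + κ) + c) * t)) :
    ∀ᵐ x, r + (1 + κ) * t + δ ≤ ρ x → W t x = 0 ∧ Z t x = 0 := by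
  have hms : MeasurableSet {x | r + (1 + κ) * t + δ ≤ ρ x} :=
    measurableSet_le measurable_const hρ.smooth.continuous.measurable
  set Q := (‖Wt 0‖ ^ 2 + ‖D 0‖ ^ 2 + κ * ‖W 0‖ ^ 2) +
    (‖Zt 0‖ ^ 2 + ‖DZ 0‖ ^ 2 + κ * ‖Z 0‖ ^ 2) with hQ
  have key : ∀ (Y Yt : L2Sp n ℝ) (DY : L2Sp n (EucSp n)),
      (∀ μ : ℝ, 1 ≤ μ → hρ.energy μ κ Y Yt DY ≤
        hρ.energy μ κ (W t) (Wt t) (D t) + hρ.energy μ κ (Z t) (Zt t) (DZ t)) →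
      ∀ᵐ x, x ∈ {x | r + (1 + κ) * t + δ ≤ ρ x} → Y x = 0 := by
    intro Y Yt DY hY
    refine ae_eq_zero_of_exp_bound hms (Q := Q * Real.exp (c * t) / κ) hδ fun μ hμ => ?_
    have hμ0 : 0 ≤ μ := by linarith
    have h1 := hρ.le_norm_expMul_sq hμ0 (r := r + (1 + κ) * t + δ) Y
    set I := ∫ x in {x | r + (1 + κ) * t + δ ≤ ρ x}, ‖Y x‖ ^ 2 with hI
    have h2 : κ * (2 * μ) ^ 2 * ‖hρ.expMul μ ℝ Y‖ ^ 2 ≤ hρ.energy μ κ Y Yt DY := by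
      rw [IsWeightExponent.energy, IsWeightExponent.kinetic]
      linarith [sq_nonneg ‖hρ.expMul μ (EucSp n) DY‖, sq_nonneg ‖hρ.expMul μ ℝ Yt‖]
    have h3 := (h2.trans (hY μ hμ)).trans (h μ hμ)
    have h4 := add_le_add (hρ.energy_initial_le hμ hκ.le hW hWt hD)
      (hρ.energy_initial_le hμ hκ.le hZ hZt hDZ)
    rw [← mul_add, ← mul_add, ← hQ] at h4
    have h5 := h3.trans (mul_le_mul_of_nonneg_right h4 (Real.exp_pos _).le)
    have h6 := (mul_le_mul_of_nonneg_left h1 (by positivity : 0 ≤ κ * (2 * μ) ^ 2)).trans h5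
    have hE1 : Real.exp (2 * μ * (r + (1 + κ) * t + δ)) = Real.exp (2 * μ * r) *
        Real.exp (2 * μ * (1 + κ) * t) * Real.exp (2 * μ * δ) := by
      rw [← Real.exp_add, ← Real.exp_add]; ring_nf
    have hE2 : Real.exp ((2 * μ * (1 + κ) + c) * t) = Real.exp (2 * μ * (1 + κ) * t) *
        Real.exp (c * t) := by
      rw [← Real.exp_add]; ring_nf
    rw [hE1, hE2] at h6
    have hpos : 0 < (2 * μ) ^ 2 * (Real.exp (2 * μ * r) * Real.exp (2 * μ * (1 + κ) * t)) := by
      have : 0 < 2 * μ := by linarith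
      positivity
    rw [Real.exp_neg, ← div_eq_mul_inv, le_div_iff₀ (Real.exp_pos _), le_div_iff₀ hκ]
    refine le_of_mul_le_mul_left ?_ hpos
    linarith
  have k1 := key (W t) (Wt t) (D t) fun μ _ => le_add_of_nonneg_right (hρ.energy_nonneg hκ.le _ _ _)
  have k2 := key (Z t) (Zt t) (DZ t) fun μ _ => le_add_of_nonneg_left (hρ.energy_nonneg hκ.le _ _ _)
  filter_upwards [k1, k2] with x h1 h2 hx
  exact ⟨h1 hx, h2 hx⟩

/-- A smooth bounded `1`-Lipschitz approximation of `|x|`. -/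
noncomputable def approxNorm (n : ℕ) (ε : ℝ) (x : EucSp n) : ℝ :=
  √((ε ^ 2 + ‖x‖ ^ 2) / (1 + ε ^ 2 * (ε ^ 2 + ‖x‖ ^ 2)))

theorem isWeightExponent_approxNorm (n : ℕ) {ε : ℝ} (hε : 0 < ε) :
    IsWeightExponent (approxNorm n ε) where
  smooth := by
    have h1 : ContDiff ℝ ∞ fun x : EucSp n => ‖x‖ ^ 2 := contDiff_norm_sq ℝ
    refine ContDiff.sqrt ?_ fun x => by positivity
    exact (contDiff_const.add h1).div (contDiff_const.add (contDiff_const.mul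
      (contDiff_const.add h1))) fun x => by positivity
  bounded := by
    refine ⟨1 / ε, fun x => ?_⟩
    rw [approxNorm, abs_of_nonneg (Real.sqrt_nonneg _)]
    refine Real.sqrt_le_iff.mpr ⟨by positivity, ?_⟩
    rw [div_pow, one_pow, div_le_div_iff₀ (by positivity) (by positivity)]
    linarith
  gradient_le x := by
    set s := ε ^ 2 + ‖x‖ ^ 2 with hs
    have hs0 : 0 < s := by positivity
    have hd : 0 < 1 + ε ^ 2 * s := by positivity
    have hq : 0 < s / (1 + ε ^ 2 * s) := by positivity
    have h1 : HasFDerivAt (fun x : EucSp n => ‖x‖ ^ 2) (2 • innerSL ℝ x) x :=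
      (hasStrictFDerivAt_norm_sq x).hasFDerivAt
    have h2 : HasDerivAt (fun z : ℝ => (ε ^ 2 + z) / (1 + ε ^ 2 * (ε ^ 2 + z)))
        ((1 * (1 + ε ^ 2 * s) - s * (ε ^ 2 * 1)) / (1 + ε ^ 2 * s) ^ 2) (‖x‖ ^ 2) := by
      have a1 : HasDerivAt (fun z : ℝ => ε ^ 2 + z) 1 (‖x‖ ^ 2) :=
        (hasDerivAt_id _).const_add _
      exact a1.div ((a1.const_mul (ε ^ 2)).const_add 1) hd.ne'
    have h3 := (h2.sqrt hq.ne').comp_hasFDerivAt x h1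
    have h4 : fderiv ℝ (approxNorm n ε) x = _ := h3.fderiv
    rw [gradient, LinearIsometryEquiv.norm_map, h4, norm_smul, ← Nat.cast_smul_eq_nsmul ℝ, norm_smul,
      innerSL_apply_norm]
    have hq2 : 0 < √(s / (1 + ε ^ 2 * s)) := Real.sqrt_pos.mpr hq
    have e1 : 1 * (1 + ε ^ 2 * s) - s * (ε ^ 2 * 1) = 1 := by ring
    rw [e1, Real.norm_of_nonneg (by positivity)]
    -- Squared, this is ‖x‖² ≤ (1 + ε²s)³ s, which follows from ‖x‖² ≤ s.
    have h5 : ‖x‖ ≤ (1 + ε ^ 2 * s) ^ 2 * √(s / (1 + ε ^ 2 * s)) := by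
      refine le_of_sq_le_sq ?_ (by positivity)
      rw [mul_pow, Real.sq_sqrt hq.le]
      have e2 : ((1 + ε ^ 2 * s) ^ 2) ^ 2 * (s / (1 + ε ^ 2 * s)) = (1 + ε ^ 2 * s) ^ 3 * s := by
        field_simp
      rw [e2]
      have : 1 ≤ (1 + ε ^ 2 * s) ^ 3 := one_le_pow₀ (by linarith [mul_pos (pow_pos hε 2) hs0])
      nlinarith [sq_nonneg ε]
    have h6 : 1 / (1 + ε ^ 2 * s) ^ 2 / (2 * √(s / (1 + ε ^ 2 * s))) * (‖((2 : ℕ) : ℝ)‖ * ‖x‖) =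
        ‖x‖ / ((1 + ε ^ 2 * s) ^ 2 * √(s / (1 + ε ^ 2 * s))) := by
      rw [Real.norm_of_nonneg (by positivity)]
      push_cast
      field_simp
    rw [h6]
    exact div_le_one_of_le₀ h5 (by positivity)

theorem approxNorm_le {ε : ℝ} (hε : 0 < ε) (x : EucSp n) : approxNorm n ε x ≤ ‖x‖ + ε := by
  refine Real.sqrt_le_iff.mpr ⟨by positivity, ?_⟩
  refine (div_le_self (by positivity) ?_).trans ?_
  · have : 0 ≤ ε ^ 2 * (ε ^ 2 + ‖x‖ ^ 2) := by positivity
    linarith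
  · nlinarith [mul_nonneg (norm_nonneg x) hε.le]

theorem tendsto_approxNorm (x : EucSp n) :
    Tendsto (fun ε => approxNorm n ε x) (𝓝 0) (𝓝 ‖x‖) := by
  have h : Continuous fun ε => approxNorm n ε x := by
    unfold approxNorm
    refine Real.continuous_sqrt.comp (Continuous.div (by fun_prop) (by fun_prop) fun ε => ?_)
    positivity
  have h1 := h.tendsto 0
  simpa [approxNorm] using h1

/-- Finite speed of propagation for the coupled system. -/
theorem ae_eq_zero_of_lt_norm {S p q C C' R : ℝ} (hp : 1 < p) (hq : 1 < q)
    (hC0 : 0 < C) (hC : IsSobolevConst n p C) (hC0' : 0 < C') (hC' : IsSobolevConst n q C')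
    {g₁ g₂ : ℝ → ℝ} (hg₁ : IntegrableOn g₁ (Set.Ioc 0 S) volume)
    (hg₂ : IntegrableOn g₂ (Set.Ioc 0 S) volume)
    {W Wt Z Zt : ℝ → L2Sp n ℝ} {D DZ : ℝ → L2Sp n (EucSp n)}
    (hW : IsWaveCurve S W Wt D (memoryL2 g₁ fun t => powL2 p (Z t)))
    (hZ : IsWaveCurve S Z Zt DZ (memoryL2 g₂ fun t => powL2 q (W t)))
    (h0 : ∀ᵐ x, R < ‖x‖ → W 0 x = 0 ∧ Wt 0 x = 0 ∧ Z 0 x = 0 ∧ Zt 0 x = 0)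
    {t : ℝ} (ht : 0 ≤ t) (htS : t < S) :
    ∀ᵐ x, R + t < ‖x‖ → W t x = 0 ∧ Z t x = 0 := by
  have h0S : (0 : ℝ) ∈ Set.Icc 0 S := ⟨le_rfl, ht.trans htS.le⟩
  -- The smoothing scale ε, the energy weight κ and the margin δ all equal 1/(k+1). A sequence is
  -- used so that the exceptional null sets can be discarded together.
  have hk : ∀ k : ℕ, ∀ᵐ x, (R + 1 / ((k : ℝ) + 1)) + (1 + 1 / ((k : ℝ) + 1)) * t +
      1 / ((k : ℝ) + 1) ≤ approxNorm n (1 / ((k : ℝ) + 1)) x → W t x = 0 ∧ Z t x = 0 := by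
    intro k
    have hε : (0 : ℝ) < 1 / ((k : ℝ) + 1) := by positivity
    obtain ⟨c, hc⟩ := exists_energy_growth hp hq hC0 hC hC0' hC' hε hg₁ hg₂ hW hZ
    have hsup : ∀ x, R + 1 / ((k : ℝ) + 1) < approxNorm n (1 / ((k : ℝ) + 1)) x → R < ‖x‖ := by
      intro x hx
      have := approxNorm_le hε x
      linarith
    refine (isWeightExponent_approxNorm n hε).ae_eq_zero_of_growth hε hε ?_ ?_
      (hW.weakGrad 0 h0S) ?_ ?_ (hZ.weakGrad 0 h0S)
      (fun μ hμ => hc _ (isWeightExponent_approxNorm n hε) μ hμ t ht htS)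
    · filter_upwards [h0] with x hx h using (hx (hsup x h)).1
    · filter_upwards [h0] with x hx h using (hx (hsup x h)).2.1
    · filter_upwards [h0] with x hx h using (hx (hsup x h)).2.2.1
    · filter_upwards [h0] with x hx h using (hx (hsup x h)).2.2.2
  rw [← ae_all_iff] at hk
  filter_upwards [hk] with x hx hxt
  have hl : Tendsto (fun k : ℕ => 1 / ((k : ℝ) + 1)) atTop (𝓝 0) :=
    tendsto_one_div_add_atTop_nhds_zero_nat
  have l1 : Tendsto (fun k : ℕ => (R + 1 / ((k : ℝ) + 1)) + (1 + 1 / ((k : ℝ) + 1)) * t +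
      1 / ((k : ℝ) + 1)) atTop (𝓝 ((R + 0) + (1 + 0) * t + 0)) :=
    ((hl.const_add R).add ((hl.const_add 1).mul_const t)).add hl
  have l2 := (tendsto_approxNorm x).comp hl
  have hev := l1.eventually_lt l2 (by simpa using hxt)
  obtain ⟨k, hk'⟩ := hev.exists
  exact hx k hk'.le

end FiniteSpeed

/-! ### From energy solutions to wave curves -/

section EnergySolution

variable {n : ℕ}

/-- A cutoff equal to 1 in a neighbourhood of each s ∈ [0, t] has zero time derivative there, which
removes the u_tφ_s term and leaves time-independent test functions. -/
theorem exists_smooth_timeCutoff {t S : ℝ} (ht : 0 ≤ t) (htS : t < S) :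
    ∃ χ : ℝ → ℝ, ContDiff ℝ ∞ χ ∧ HasCompactSupport χ ∧ tsupport χ ⊆ Set.Iio S ∧
      ∀ s ∈ Set.Icc 0 t, χ =ᶠ[𝓝 s] fun _ => 1 := by
  let f : ContDiffBump (t / 2) := ⟨t / 2 + (S - t) / 3, t / 2 + 2 * (S - t) / 3,
    by linarith, by linarith⟩
  refine ⟨f, f.contDiff, f.hasCompactSupport, ?_, fun s hs => ?_⟩
  · rw [f.tsupport_eq]
    intro s hs
    rw [Metric.mem_closedBall, Real.dist_eq] at hs
    have h1 : s - t / 2 ≤ t / 2 + 2 * (S - t) / 3 := (le_abs_self _).trans hs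
    rw [Set.mem_Iio]
    linarith
  · refine f.eventuallyEq_one_of_mem_ball ?_
    rw [Metric.mem_ball, Real.dist_eq, abs_lt]
    change _ < _ ∧ _ < t / 2 + (S - t) / 3
    change -(t / 2 + (S - t) / 3) < _ ∧ _
    constructor <;> linarith [hs.1, hs.2]

/-- An integral relation on `[0, T)` tested with functions that do not depend on time near
`[0, t]`. -/
theorem WaveIntegralRelation.static {T : EReal} {w₁ : EucSp n → ℝ} {wt : ℝ → EucSp n → ℝ}
    {Dw : ℝ → EucSp n → EucSp n} {F : ℝ → EucSp n → ℝ} (h : WaveIntegralRelation T w₁ wt Dw F)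
    {t : ℝ} (ht : 0 < t) (htT : (t : EReal) < T) (φ : TestFun n) :
    (∫ s in (0 : ℝ)..t, ∫ x, inner ℝ (Dw s x) (gradient φ.toFun x)) + ∫ x, wt t x * φ.toFun x =
      (∫ x, w₁ x * φ.toFun x) + ∫ s in (0 : ℝ)..t, ∫ x, F s x * φ.toFun x := by
  obtain ⟨S, htS, hST⟩ := EReal.lt_iff_exists_real_btwn.mp htT
  obtain ⟨χ, hχ, hχc, hχS, hχ1⟩ := exists_smooth_timeCutoff ht.le (EReal.coe_lt_coe_iff.mp htS)
  have hone : ∀ s ∈ Set.Icc 0 t, χ s = 1 := fun s hs => (hχ1 s hs).eq_of_nhds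
  have hsub : Function.support (fun z : ℝ × EucSp n => χ z.1 * φ.toFun z.2) ⊆
      tsupport χ ×ˢ tsupport φ.toFun := by
    intro z hz
    exact ⟨subset_tsupport _ (left_ne_zero_of_mul hz), subset_tsupport _ (right_ne_zero_of_mul hz)⟩
  have hsub' := closure_minimal hsub ((isClosed_tsupport χ).prod (isClosed_tsupport φ.toFun))
  have key := h (fun z => χ z.1 * φ.toFun z.2)
    ((hχ.comp contDiff_fst).mul (φ.smooth.comp contDiff_snd))
    ((hχc.isCompact.prod φ.compact.isCompact).of_isClosed_subset (isClosed_tsupport _) hsub')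
    (fun z hz => lt_of_lt_of_le (EReal.coe_lt_coe_iff.mpr (hχS (hsub' hz).1)) hST.le) t ht htT
  have hu : ∀ s ∈ Set.uIcc 0 t, s ∈ Set.Icc 0 t := fun s hs => by rwa [Set.uIcc_of_le ht.le] at hs
  have e1 : (∫ s in (0 : ℝ)..t, ∫ x, (-(wt s x * deriv (fun σ => χ σ * φ.toFun x) s)
      + inner ℝ (Dw s x) (gradient (fun y => χ s * φ.toFun y) x))) =
      ∫ s in (0 : ℝ)..t, ∫ x, inner ℝ (Dw s x) (gradient φ.toFun x) := by
    refine intervalIntegral.integral_congr fun s hs => ?_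
    have hd : ∀ x, deriv (fun σ => χ σ * φ.toFun x) s = 0 := fun x => by
      have : (fun σ => χ σ * φ.toFun x) =ᶠ[𝓝 s] fun _ => 1 * φ.toFun x :=
        (hχ1 s (hu s hs)).mul (EventuallyEq.refl _ _)
      rw [this.deriv_eq, deriv_const]
    simp only [hd, hone s (hu s hs), one_mul, mul_zero, neg_zero, zero_add]
  have e2 : (∫ s in (0 : ℝ)..t, ∫ x, F s x * (χ s * φ.toFun x)) =
      ∫ s in (0 : ℝ)..t, ∫ x, F s x * φ.toFun x := by
    refine intervalIntegral.integral_congr fun s hs => ?_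
    simp only [hone s (hu s hs), one_mul]
  rw [← e1, ← e2]
  simpa only [hone t ⟨ht.le, le_rfl⟩, hone 0 ⟨le_rfl, ht.le⟩, one_mul, neg_mul] using key

theorem Icc_subset_timeInterval {T : EReal} {S : ℝ} (hST : (S : EReal) < T) :
    Set.Icc 0 S ⊆ timeInterval T :=
  fun _ ht => ⟨ht.1, lt_of_le_of_lt (EReal.coe_le_coe_iff.mpr ht.2) hST⟩

theorem IsEnergyCurve.exists_L2 {T : EReal} {w wt : ℝ → EucSp n → ℝ} {Dw : ℝ → EucSp n → EucSp n}
    (h : IsEnergyCurve T w wt Dw) :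
    ∃ (W Wt : ℝ → L2Sp n ℝ) (D : ℝ → L2Sp n (EucSp n)),
      (∀ t ∈ timeInterval T, w t =ᵐ[volume] W t ∧ wt t =ᵐ[volume] Wt t ∧ Dw t =ᵐ[volume] D t ∧
        HasDerivWithinAt W (Wt t) (timeInterval T) t ∧ IsWeakGrad (W t) (D t)) ∧
      ContinuousOn Wt (timeInterval T) ∧ ContinuousOn D (timeInterval T) := by
  obtain ⟨W, Wt, h1, h2, h3⟩ := h.contDiff_L2
  obtain ⟨D, h4, h5⟩ := h.continuous_gradient
  refine ⟨W, Wt, D, fun t ht => ⟨(h1 t ht).1, (h1 t ht).2, h5 t ht, h2 t ht, ?_⟩, h3, h4⟩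
  have hw : MemLp (w t) 2 volume := (Lp.memLp (W t)).ae_eq (h1 t ht).1.symm
  have hD : MemLp (Dw t) 2 volume := (Lp.memLp (D t)).ae_eq (h5 t ht).symm
  exact ((h.weakGradient t ht).isWeakGrad hw hD).congr (h1 t ht).1 (h5 t ht)

/-- The initial velocity is not prescribed separately: both sides of the integral relation are
continuous in t, so it extends from t > 0 to t = 0, where it identifies `Wt 0` with `w₁`. -/
theorem isWaveCurve_of_relation {T : EReal} {S r : ℝ} (hS : 0 < S) (hST : (S : EReal) < T)
    {w₁ : EucSp n → ℝ} {w wt z : ℝ → EucSp n → ℝ} {Dw : ℝ → EucSp n → EucSp n}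
    {W Wt N : ℝ → L2Sp n ℝ} {D : ℝ → L2Sp n (EucSp n)} {g : ℝ → ℝ}
    (hrep : ∀ t ∈ timeInterval T, w t =ᵐ[volume] W t ∧ wt t =ᵐ[volume] Wt t ∧
      Dw t =ᵐ[volume] D t ∧ HasDerivWithinAt W (Wt t) (timeInterval T) t ∧ IsWeakGrad (W t) (D t))
    (hWt : ContinuousOn Wt (timeInterval T)) (hD : ContinuousOn D (timeInterval T))
    (hg : IntegrableOn g (Set.Ioc 0 S) volume)
    (hz : AEStronglyMeasurable (fun y : ℝ × EucSp n => z y.1 y.2)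
      ((volume.restrict (timeInterval T)).prod volume))
    (hN : ContinuousOn N (Set.Icc 0 S)) (hNz : ∀ t ∈ Set.Icc 0 S, N t =ᵐ[volume] fun x => |z t x| ^ r)
    (hw₁ : MemLp w₁ 2 volume) (hrel : WaveIntegralRelation T w₁ wt Dw (memoryTerm g r z)) :
    IsWaveCurve S W Wt D (memoryL2 g N) ∧ Wt 0 =ᵐ[volume] w₁ := by
  have hsub := Icc_subset_timeInterval hST
  have hzS : AEStronglyMeasurable (fun y : ℝ × EucSp n => z y.1 y.2)
      ((volume.restrict (Set.Icc 0 S)).prod volume) :=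
    hz.mono_measure (Measure.prod_mono (Measure.restrict_mono hsub le_rfl) le_rfl)
  have hf : ContinuousOn (memoryL2 g N) (Set.Icc 0 S) := continuousOn_memoryL2 hS hg hN
  have hrel1 : ∀ φ : TestFun n, ∀ t ∈ Set.Ioc 0 S,
      (∫ s in (0 : ℝ)..t, inner ℝ (D s) φ.gradL2) + inner ℝ (Wt t) φ.toL2 =
      (∫ x, w₁ x * φ.toFun x) + ∫ s in (0 : ℝ)..t, inner ℝ (memoryL2 g N s) φ.toL2 := by
    intro φ t ht
    have htI : ∀ s ∈ Set.uIcc 0 t, s ∈ Set.Icc 0 S := fun s hs => by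
      rw [Set.uIcc_of_le ht.1.le] at hs
      exact ⟨hs.1, hs.2.trans ht.2⟩
    have key := hrel.static ht.1 (lt_of_le_of_lt (EReal.coe_le_coe_iff.mpr ht.2) hST) φ
    have e1 : (∫ s in (0 : ℝ)..t, ∫ x, inner ℝ (Dw s x) (gradient φ.toFun x)) =
        ∫ s in (0 : ℝ)..t, inner ℝ (D s) φ.gradL2 := by
      refine intervalIntegral.integral_congr fun s hs => ?_
      simp only [φ.inner_gradL2]
      refine integral_congr_ae ?_
      filter_upwards [(hrep s (hsub (htI s hs))).2.2.1] with x hx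
      rw [hx]
    have e2 : (∫ s in (0 : ℝ)..t, ∫ x, memoryTerm g r z s x * φ.toFun x) =
        ∫ s in (0 : ℝ)..t, inner ℝ (memoryL2 g N s) φ.toL2 :=
      intervalIntegral.integral_congr fun s hs =>
        integral_memoryTerm_mul hg (htI s hs) hzS hN hNz φ
    have e3 : ∫ x, wt t x * φ.toFun x = inner ℝ (Wt t) φ.toL2 := by
      rw [φ.inner_toL2]
      refine integral_congr_ae ?_
      filter_upwards [(hrep t (hsub ⟨ht.1.le, ht.2⟩)).2.1] with x hx
      rw [hx]
    rw [← e1, ← e2, ← e3, key]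
  have h0 : ∀ φ : TestFun n, inner ℝ (Wt 0) φ.toL2 = ∫ x, w₁ x * φ.toFun x := by
    intro φ
    have c1 : ContinuousOn (fun t => ∫ s in (0 : ℝ)..t, inner ℝ (D s) φ.gradL2) (Set.Icc 0 S) := by
      have := intervalIntegral.continuousOn_primitive_interval (μ := volume) (a := 0) (b := S)
        (f := fun s => inner ℝ (D s) φ.gradL2)
        (by rw [Set.uIcc_of_le hS.le]
            exact ((hD.mono hsub).inner continuousOn_const).integrableOn_Icc)
      rwa [Set.uIcc_of_le hS.le] at this
    have c2 : ContinuousOn (fun t => ∫ s in (0 : ℝ)..t, inner ℝ (memoryL2 g N s) φ.toL2)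
        (Set.Icc 0 S) := by
      have := intervalIntegral.continuousOn_primitive_interval (μ := volume) (a := 0) (b := S)
        (f := fun s => inner ℝ (memoryL2 g N s) φ.toL2)
        (by rw [Set.uIcc_of_le hS.le]
            exact (hf.inner continuousOn_const).integrableOn_Icc)
      rwa [Set.uIcc_of_le hS.le] at this
    have heq : Set.EqOn _ _ (Set.Icc 0 S) := Set.EqOn.of_subset_closure (hrel1 φ)
      (c1.add ((hWt.mono hsub).inner continuousOn_const)) (continuousOn_const.add c2)
      Set.Ioc_subset_Icc_self (by rw [closure_Ioc hS.ne])
    have := heq (Set.left_mem_Icc.mpr hS.le)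
    simpa using this
  refine ⟨⟨fun t ht => (hrep t (hsub ht)).2.2.2.1.mono hsub, hWt.mono hsub, hD.mono hsub, hf,
    fun t ht => (hrep t (hsub ht)).2.2.2.2, fun t ht φ => ?_⟩, ?_⟩
  · rcases ht.1.eq_or_lt with rfl | h
    · simp
    · rw [hrel1 φ t ⟨h, ht.2⟩, h0]
  · refine ae_eq_of_integral_contDiff_smul_eq ((Lp.memLp (Wt 0)).locallyIntegrable (by norm_num))
      (hw₁.locallyIntegrable (by norm_num)) fun ψ hψ hψc => ?_
    have := h0 ⟨ψ, hψ, hψc⟩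
    rw [TestFun.inner_toL2] at this
    simpa only [smul_eq_mul, mul_comm (ψ _)] using this

/-- The curves are fixed before S, so that for T = ∞ they are global. -/
theorem IsEnergySolution.exists_isWaveCurve {T : EReal} {g₁ g₂ : ℝ → ℝ} {p q C C' : ℝ}
    {u₀ u₁ v₀ v₁ : EucSp n → ℝ} {u v : ℝ → EucSp n → ℝ} (hT : 0 < T) (hp : 1 < p) (hq : 1 < q)
    (hC0 : 0 < C) (hC : IsSobolevConst n p C) (hC0' : 0 < C') (hC' : IsSobolevConst n q C')
    (hg₁ : IsMemoryKernel T g₁) (hg₂ : IsMemoryKernel T g₂)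
    (hu₁ : MemLp u₁ 2 volume) (hv₁ : MemLp v₁ 2 volume)
    (h : IsEnergySolution T g₁ g₂ p q u₀ u₁ v₀ v₁ u v) :
    ∃ (W Wt Z Zt : ℝ → L2Sp n ℝ) (D DZ : ℝ → L2Sp n (EucSp n)),
      (∀ t ∈ timeInterval T, u t =ᵐ[volume] W t ∧ v t =ᵐ[volume] Z t) ∧
      W 0 =ᵐ[volume] u₀ ∧ Wt 0 =ᵐ[volume] u₁ ∧ Z 0 =ᵐ[volume] v₀ ∧ Zt 0 =ᵐ[volume] v₁ ∧
      ∀ S : ℝ, 0 < S → (S : EReal) < T →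
        IsWaveCurve S W Wt D (memoryL2 g₁ fun t => powL2 p (Z t)) ∧
        IsWaveCurve S Z Zt DZ (memoryL2 g₂ fun t => powL2 q (W t)) := by
  obtain ⟨ut, vt, Du, Dv, hu, hv, -, -, hu0, hv0, hur, hvr⟩ := h
  obtain ⟨W, Wt, D, hW, hWt, hD⟩ := hu.exists_L2
  obtain ⟨Z, Zt, DZ, hZ, hZt, hDZ⟩ := hv.exists_L2
  have key : ∀ S : ℝ, 0 < S → (S : EReal) < T →
        (IsWaveCurve S W Wt D (memoryL2 g₁ fun t => powL2 p (Z t)) ∧ Wt 0 =ᵐ[volume] u₁) ∧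
        (IsWaveCurve S Z Zt DZ (memoryL2 g₂ fun t => powL2 q (W t)) ∧ Zt 0 =ᵐ[volume] v₁) := by
    intro S hS hST
    have hsub := Icc_subset_timeInterval hST
    have hWc : ContinuousOn W (Set.Icc 0 S) := fun t ht =>
      ((hW t (hsub ht)).2.2.2.1.continuousWithinAt).mono hsub
    have hZc : ContinuousOn Z (Set.Icc 0 S) := fun t ht =>
      ((hZ t (hsub ht)).2.2.2.1.continuousWithinAt).mono hsub
    refine ⟨isWaveCurve_of_relation hS hST hW hWt hD (hg₁.integrable S hS hST)
      hv.aestronglyMeasurable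
      (hC.continuousOn_powL2 hC0 hp hZc (hDZ.mono hsub) fun t ht => (hZ t (hsub ht)).2.2.2.2)
      (fun t ht => ?_) hu₁ hur, isWaveCurve_of_relation hS hST hZ hZt hDZ (hg₂.integrable S hS hST)
      hu.aestronglyMeasurable
      (hC'.continuousOn_powL2 hC0' hq hWc (hD.mono hsub) fun t ht => (hW t (hsub ht)).2.2.2.2)
      (fun t ht => ?_) hv₁ hvr⟩
    · filter_upwards [hC.coeFn_powL2 hp (hZ t (hsub ht)).2.2.2.2, (hZ t (hsub ht)).1] with x h1 h2
      rw [h1, h2]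
    · filter_upwards [hC'.coeFn_powL2 hq (hW t (hsub ht)).2.2.2.2, (hW t (hsub ht)).1] with x h1 h2
      rw [h1, h2]
  obtain ⟨S, hS, hST⟩ := EReal.lt_iff_exists_real_btwn.mp hT
  have k := key S (by exact_mod_cast hS) hST
  have h0T : (0 : ℝ) ∈ timeInterval T := ⟨le_rfl, by exact_mod_cast hT⟩
  exact ⟨W, Wt, Z, Zt, D, DZ, fun t ht => ⟨(hW t ht).1, (hZ t ht).1⟩, (hW 0 h0T).1.symm.trans hu0,
    k.1.2, (hZ 0 h0T).1.symm.trans hv0, k.2.2, fun S hS hST => ⟨(key S hS hST).1.1,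
    (key S hS hST).2.1⟩⟩

end EnergySolution

/-! ### Exponential moments and lower bounds for L^q norms -/

section ExponentialMoments

/-- A function of one coordinate times a Gaussian in the orthogonal directions. -/
theorem lintegral_mul_gaussian {m : ℕ} {e : EucSp (m + 1)} (he : ‖e‖ = 1) {h : ℝ → ℝ}
    (hh : Integrable h) (h0 : ∀ s, 0 ≤ h s) {a : ℝ} (ha : 0 < a) :
    ∫⁻ x : EucSp (m + 1), ENNReal.ofReal
        (h (inner ℝ e x) * Real.exp (-a * (‖x‖ ^ 2 - inner ℝ e x ^ 2))) =
      ENNReal.ofReal ((∫ s, h s) * √(Real.pi / a) ^ m) := by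
  have hv : Orthonormal ℝ (({0} : Set (Fin (m + 1))).domRestrict fun _ => e) := by
    constructor
    · intro i; simpa using he
    · intro i j hij
      exact absurd (Subsingleton.elim i j) hij
  -- In an orthonormal basis beginning with `e` the integrand is a product of functions of one
  -- coordinate each.
  obtain ⟨b, hb⟩ := hv.exists_orthonormalBasis_extension_of_card_eq (by simp)
  have hb0 : b 0 = e := hb 0 rfl
  let f : Fin (m + 1) → ℝ → ℝ := Fin.cons h fun _ s => Real.exp (-a * s ^ 2)
  have hf : ∀ i, Integrable (f i) := by
    intro i
    refine Fin.cases hh (fun j => ?_) i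
    exact integrable_exp_neg_mul_sq ha
  have hf0 : ∀ i s, 0 ≤ f i s := by
    intro i
    refine Fin.cases h0 (fun j s => ?_) i
    exact (Real.exp_pos _).le
  have hint := Integrable.fintype_prod (μ := fun _ : Fin (m + 1) => (volume : Measure ℝ)) hf
  have hval := integral_fintype_prod_eq_prod (μ := fun _ : Fin (m + 1) => (volume : Measure ℝ)) f
  have e1 : ∀ x : EucSp (m + 1), h (inner ℝ e x) *
      Real.exp (-a * (‖x‖ ^ 2 - inner ℝ e x ^ 2)) = ∏ i, f i (WithLp.ofLp (b.repr x) i) := by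
    intro x
    have hn : ‖x‖ ^ 2 = ∑ i, (b.repr x i) ^ 2 := by
      rw [← b.repr.norm_map x, EuclideanSpace.norm_sq_eq]
      simp
    have hi : inner ℝ e x = b.repr x 0 := by rw [b.repr_apply_apply, hb0]
    rw [hn, hi, Fin.prod_univ_succ, Fin.sum_univ_succ]
    simp only [f, Fin.cons_zero, Fin.cons_succ]
    rw [← Real.exp_sum, add_sub_cancel_left, Finset.mul_sum]
  simp_rw [e1]
  have mp := (PiLp.volume_preserving_ofLp (Fin (m + 1))).comp b.measurePreserving_repr
  have hemb : MeasurableEmbedding (WithLp.ofLp ∘ b.repr : EucSp (m + 1) → Fin (m + 1) → ℝ) :=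
    (MeasurableEquiv.toLp 2 (Fin (m + 1) → ℝ)).symm.measurableEmbedding.comp
      b.repr.toHomeomorph.measurableEmbedding
  have := mp.lintegral_comp_emb hemb (fun y => ENNReal.ofReal (∏ i, f i (y i)))
  simp only [Function.comp_apply] at this
  rw [this, volume_pi, ← ofReal_integral_eq_lintegral_ofReal hint
    (Eventually.of_forall fun y => Finset.prod_nonneg fun i _ => hf0 i _), hval,
    Fin.prod_univ_succ]
  simp only [f, Fin.cons_zero, Fin.cons_succ, integral_gaussian, Finset.prod_const,
    Finset.card_univ, Fintype.card_fin]

/-- With s = ⟨e, x⟩ the phase is lam·R - lam·(t + R - s) ≤ 2R - (t + R - s). Half of the loss is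
kept, and the other half dominates the transversal Gaussian because |x|² - s² ≤ 2(t + R)(t + R - s).
-/
theorem inner_sub_le_of_norm_le {n : ℕ} {x ξ e : EucSp n} {t R lam : ℝ} (ht : 0 < t) (hR : 0 < R)
    (he : ‖e‖ = 1) (hξ : ξ = lam • e) (h1 : 1 ≤ lam) (h2 : lam ≤ 2) (hx : ‖x‖ ≤ t + R) :
    inner ℝ x ξ - t * lam ≤ 2 * R - (t + R - inner ℝ e x) / 2 -
      1 / (4 * (t + R)) * (‖x‖ ^ 2 - inner ℝ e x ^ 2) := by
  have hex : inner ℝ x ξ = lam * inner ℝ e x := by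
    rw [hξ, inner_smul_right, real_inner_comm]
  have habs : |inner ℝ e x| ≤ ‖x‖ := by simpa [he] using abs_real_inner_le_norm e x
  rw [hex]
  set s := inner ℝ e x
  have hy : 0 ≤ t + R - s := by linarith [(le_abs_self s).trans habs]
  have hs : -(t + R) ≤ s := by linarith [(neg_abs_le s)]
  have hq : ‖x‖ ^ 2 - s ^ 2 ≤ 2 * (t + R) * (t + R - s) := by
    have : ‖x‖ ^ 2 ≤ (t + R) ^ 2 := by gcongr
    nlinarith
  have h3 : 1 / (4 * (t + R)) * (‖x‖ ^ 2 - s ^ 2) ≤ (t + R - s) / 2 := by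
    rw [one_div, inv_mul_le_iff₀ (by positivity)]
    linarith
  nlinarith

/-- The dual estimate: for s = ⟨e, ξ⟩ ≥ 0 the phase is at most 2R - t(|ξ| - s), and |ξ| - s ≥ (|ξ|²
- s²)/4 since |ξ| + s ≤ 4. For s ≤ 0 the term -t|ξ| suffices. -/
theorem inner_sub_mul_norm_le {n : ℕ} {x ξ e : EucSp n} {t R r : ℝ} (ht : 0 < t) (hR : 0 < R)
    (he : ‖e‖ = 1) (hx : x = r • e) (hr : 0 ≤ r) (hrt : r ≤ t + R) (h1 : 1 ≤ ‖ξ‖) (h2 : ‖ξ‖ ≤ 2) :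
    inner ℝ x ξ - t * ‖ξ‖ ≤ 2 * R - t / 4 * (‖ξ‖ ^ 2 - inner ℝ e ξ ^ 2) := by
  have hex : inner ℝ x ξ = r * inner ℝ e ξ := by
    rw [hx, inner_smul_left]; rfl
  have habs : |inner ℝ e ξ| ≤ ‖ξ‖ := by simpa [he] using abs_real_inner_le_norm e ξ
  rw [hex]
  set s := inner ℝ e ξ
  have hs := (le_abs_self s).trans habs
  have hs' : -‖ξ‖ ≤ s := by linarith [neg_abs_le s]
  rcases le_total 0 s with h | h
  · have a1 : r * s ≤ (t + R) * s := by gcongr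
    have a2 : (‖ξ‖ - s) * (‖ξ‖ + s) ≤ (‖ξ‖ - s) * 4 := by
      apply mul_le_mul_of_nonneg_left <;> linarith
    nlinarith
  · have a1 : r * s ≤ 0 := mul_nonpos_of_nonneg_of_nonpos hr h
    have a2 : 0 ≤ t * (‖ξ‖ - ‖ξ‖ ^ 2 / 4) := mul_nonneg ht.le (by nlinarith)
    nlinarith [mul_nonneg ht.le (sq_nonneg s)]

theorem exists_unit_smul_eq {n : ℕ} (hn : 1 ≤ n) (x : EucSp n) :
    ∃ e : EucSp n, ‖e‖ = 1 ∧ x = ‖x‖ • e := by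
  by_cases hx : x = 0
  · refine ⟨EuclideanSpace.single ⟨0, hn⟩ 1, by simp, by simp [hx]⟩
  · refine ⟨‖x‖⁻¹ • x, ?_, ?_⟩
    · rw [norm_smul, norm_inv, norm_norm, inv_mul_cancel₀ (norm_ne_zero_iff.mpr hx)]
    · rw [smul_smul, mul_inv_cancel₀ (norm_ne_zero_iff.mpr hx), one_smul]

theorem sqrt_pow_eq_rpow {a : ℝ} (ha : 0 ≤ a) (m : ℕ) :
    √a ^ m = a ^ ((((m + 1 : ℕ) : ℝ) - 1) / 2) := by
  rw [Real.sqrt_eq_rpow, ← Real.rpow_natCast, ← Real.rpow_mul ha]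
  congr 1
  push_cast
  ring

/-- The mass of `exp (⟨x, ξ⟩ - t |ξ|)` on the ball `|x| ≤ t + R`. -/
theorem exists_lintegral_exp_ball_le {n : ℕ} (hn : 1 ≤ n) {R : ℝ} (hR : 0 < R) :
    ∃ K > 0, ∀ t : ℝ, 1 ≤ t → ∀ ξ : EucSp n, 1 ≤ ‖ξ‖ → ‖ξ‖ ≤ 2 →
      ∫⁻ x in {x : EucSp n | ‖x‖ ≤ t + R}, ENNReal.ofReal (Real.exp (inner ℝ x ξ - t * ‖ξ‖)) ≤
        ENNReal.ofReal (K * t ^ (((n : ℝ) - 1) / 2)) := by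
  obtain ⟨m, rfl⟩ : ∃ m, n = m + 1 := ⟨n - 1, by omega⟩
  refine ⟨Real.exp (2 * R) * 2 * (4 * Real.pi * (1 + R)) ^ ((((m + 1 : ℕ) : ℝ) - 1) / 2),
    by positivity, fun t ht ξ h1 h2 => ?_⟩
  obtain ⟨e, he, hξ⟩ := exists_unit_smul_eq hn ξ
  -- Along `e` the profile is e^{2R} e^{-(t+R-s)/2} on s ≤ t + R, with integral 2e^{2R} for every t.
  -- The power of t comes from the n - 1 transversal Gaussians of width √t.
  let h : ℝ → ℝ := fun s => Real.exp (2 * R) * (Set.Iic (t + R)).indicator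
    (fun s => Real.exp ((1 / 2) * s) * Real.exp (-(t + R) / 2)) s
  have hi : IntegrableOn (fun s : ℝ => Real.exp ((1 / 2) * s)) (Set.Iic (t + R)) :=
    integrableOn_exp_mul_Iic (by norm_num) _
  have hi' : IntegrableOn (fun s : ℝ => Real.exp ((1 / 2) * s) * Real.exp (-(t + R) / 2))
      (Set.Iic (t + R)) := hi.mul_const _
  have hh : Integrable h := (hi'.integrable_indicator measurableSet_Iic).const_mul _
  have h0 : ∀ s, 0 ≤ h s := fun s =>
    mul_nonneg (Real.exp_pos _).le (Set.indicator_nonneg (fun _ _ => by positivity) _)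
  have hval : ∫ s, h s = Real.exp (2 * R) * 2 := by
    simp only [h]
    rw [integral_const_mul, integral_indicator measurableSet_Iic, integral_mul_const,
      integral_exp_mul_Iic (by norm_num)]
    have : Real.exp (1 / 2 * (t + R)) * Real.exp (-(t + R) / 2) = 1 := by
      rw [← Real.exp_add]; ring_nf; simp
    linear_combination (Real.exp (2 * R) * 2) * this
  have ha : (0 : ℝ) < 1 / (4 * (t + R)) := by positivity
  calc ∫⁻ x in {x : EucSp (m + 1) | ‖x‖ ≤ t + R},
        ENNReal.ofReal (Real.exp (inner ℝ x ξ - t * ‖ξ‖))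
      ≤ ∫⁻ x in {x : EucSp (m + 1) | ‖x‖ ≤ t + R}, ENNReal.ofReal (h (inner ℝ e x) *
          Real.exp (-(1 / (4 * (t + R))) * (‖x‖ ^ 2 - inner ℝ e x ^ 2))) := by
        refine setLIntegral_mono' (measurableSet_le measurable_norm measurable_const)
          fun x hx => ENNReal.ofReal_le_ofReal ?_
        have key := inner_sub_le_of_norm_le (by linarith) hR he hξ h1 h2 hx
        have hmem : inner ℝ e x ∈ Set.Iic (t + R) := by
          have : |inner ℝ e x| ≤ ‖x‖ := by simpa [he] using abs_real_inner_le_norm e x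
          exact ((le_abs_self _).trans this).trans hx
        simp only [h, Set.indicator_of_mem hmem]
        rw [← Real.exp_add, ← Real.exp_add, ← Real.exp_add, Real.exp_le_exp]
        linarith
    _ ≤ ∫⁻ x : EucSp (m + 1), ENNReal.ofReal (h (inner ℝ e x) *
          Real.exp (-(1 / (4 * (t + R))) * (‖x‖ ^ 2 - inner ℝ e x ^ 2))) := setLIntegral_le_lintegral _ _
    _ = ENNReal.ofReal ((∫ s, h s) * √(Real.pi / (1 / (4 * (t + R)))) ^ m) :=
        lintegral_mul_gaussian he hh h0 ha
    _ ≤ _ := by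
        refine ENNReal.ofReal_le_ofReal ?_
        rw [hval, sqrt_pow_eq_rpow (by positivity), mul_assoc _ _ (t ^ _),
          ← Real.mul_rpow (by positivity) (by linarith)]
        have : Real.pi / (1 / (4 * (t + R))) ≤ 4 * Real.pi * (1 + R) * t := by
          rw [div_div_eq_mul_div, div_one]
          have : t + R ≤ (1 + R) * t := by nlinarith
          nlinarith [Real.pi_pos]
        gcongr
        push_cast
        have : (0 : ℝ) ≤ m := by positivity
        linarith

/-- The mass of `exp (⟨x, ξ⟩ - t |ξ|)` on the annulus `1 ≤ |ξ| ≤ 2`. -/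
theorem exists_lintegral_exp_annulus_le {n : ℕ} (hn : 1 ≤ n) {R : ℝ} (hR : 0 < R) :
    ∃ K > 0, ∀ t : ℝ, 1 ≤ t → ∀ x : EucSp n, ‖x‖ ≤ t + R →
      ∫⁻ ξ in {ξ : EucSp n | 1 ≤ ‖ξ‖ ∧ ‖ξ‖ ≤ 2},
        ENNReal.ofReal (Real.exp (inner ℝ x ξ - t * ‖ξ‖)) ≤
        ENNReal.ofReal (K * t ^ (-(((n : ℝ) - 1) / 2))) := by
  obtain ⟨m, rfl⟩ : ∃ m, n = m + 1 := ⟨n - 1, by omega⟩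
  refine ⟨Real.exp (2 * R) * 4 * (4 * Real.pi) ^ ((((m + 1 : ℕ) : ℝ) - 1) / 2),
    by positivity, fun t ht x hx => ?_⟩
  obtain ⟨e, he, hxe⟩ := exists_unit_smul_eq hn x
  -- The component of ξ along `e` stays in [-2, 2]; the transversal Gaussians in ξ have width
  -- t^{-1/2}.
  let h : ℝ → ℝ := (Set.Icc (-2) 2).indicator fun _ => Real.exp (2 * R)
  have hh : Integrable h := (integrableOn_const (by simp)).integrable_indicator measurableSet_Icc
  have h0 : ∀ s, 0 ≤ h s := fun s => Set.indicator_nonneg (fun _ _ => by positivity) _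
  have hval : ∫ s, h s = Real.exp (2 * R) * 4 := by
    simp only [h]
    rw [integral_indicator measurableSet_Icc]
    simp
    norm_num
    ring
  have ha : (0 : ℝ) < t / 4 := by positivity
  calc ∫⁻ ξ in {ξ : EucSp (m + 1) | 1 ≤ ‖ξ‖ ∧ ‖ξ‖ ≤ 2},
        ENNReal.ofReal (Real.exp (inner ℝ x ξ - t * ‖ξ‖))
      ≤ ∫⁻ ξ in {ξ : EucSp (m + 1) | 1 ≤ ‖ξ‖ ∧ ‖ξ‖ ≤ 2}, ENNReal.ofReal (h (inner ℝ e ξ) *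
          Real.exp (-(t / 4) * (‖ξ‖ ^ 2 - inner ℝ e ξ ^ 2))) := by
        refine setLIntegral_mono' ((measurableSet_le measurable_const measurable_norm).inter
          (measurableSet_le measurable_norm measurable_const))
          fun ξ hξ => ENNReal.ofReal_le_ofReal ?_
        have key := inner_sub_mul_norm_le (by linarith) hR he hxe (norm_nonneg x) hx hξ.1 hξ.2
        have hmem : inner ℝ e ξ ∈ Set.Icc (-2 : ℝ) 2 := by
          have : |inner ℝ e ξ| ≤ ‖ξ‖ := by simpa [he] using abs_real_inner_le_norm e ξ
          exact abs_le.mp (this.trans hξ.2)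
        simp only [h, Set.indicator_of_mem hmem]
        rw [← Real.exp_add, Real.exp_le_exp]
        linarith
    _ ≤ ∫⁻ ξ : EucSp (m + 1), ENNReal.ofReal (h (inner ℝ e ξ) *
          Real.exp (-(t / 4) * (‖ξ‖ ^ 2 - inner ℝ e ξ ^ 2))) := setLIntegral_le_lintegral _ _
    _ = ENNReal.ofReal ((∫ s, h s) * √(Real.pi / (t / 4)) ^ m) :=
        lintegral_mul_gaussian he hh h0 ha
    _ ≤ _ := by
        refine ENNReal.ofReal_le_ofReal (le_of_eq ?_)
        rw [hval, sqrt_pow_eq_rpow (by positivity), mul_assoc _ _ (t ^ _),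
          Real.rpow_neg (by linarith), ← Real.inv_rpow (by linarith),
          ← Real.mul_rpow (by positivity) (by positivity)]
        congr 2
        field_simp

/-- Hölder on `B` with the splitting k = k^{1/q} k^{1/q'}, that is, Jensen for the measure with
density k. -/
theorem rpow_le_mul_of_lintegral_mul {α : Type*} [MeasurableSpace α] {μ : Measure α} {q : ℝ}
    (hq : 1 < q) {a k : α → ENNReal} (ha : AEMeasurable a μ) (hk : AEMeasurable k μ)
    {B : Set α} (hB : MeasurableSet B) (haB : ∀ᵐ x ∂μ, x ∉ B → a x = 0) :
    (∫⁻ x, a x * k x ∂μ) ^ q ≤ (∫⁻ x, a x ^ q * k x ∂μ) * (∫⁻ x in B, k x ∂μ) ^ (q - 1) := by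
  have hq0 : 0 < q := by linarith
  have hc : q.HolderConjugate (q / (q - 1)) := Real.HolderConjugate.conjExponent hq
  set q' := q / (q - 1) with hq'
  have e1 : ∫⁻ x, a x * k x ∂μ ≤ ∫⁻ x in B, a x * k x ∂μ := by
    rw [← lintegral_indicator hB]
    refine lintegral_mono_ae ?_
    filter_upwards [haB] with x hx
    by_cases h : x ∈ B
    · rw [Set.indicator_of_mem h]
    · simp [hx h]
  have e2 : ∫⁻ x in B, a x * k x ∂μ = ∫⁻ x in B, ((fun x => a x * k x ^ (1 / q)) *
      fun x => k x ^ (1 / q')) x ∂μ := by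
    refine lintegral_congr fun x => ?_
    rw [Pi.mul_apply, mul_assoc, ← ENNReal.rpow_add_of_nonneg _ _ (by positivity)
      (one_div_nonneg.mpr hc.symm.nonneg)]
    have : 1 / q + 1 / q' = 1 := by simpa only [one_div] using hc.inv_add_inv_eq_one
    rw [this, ENNReal.rpow_one]
  have e3 := ENNReal.lintegral_mul_le_Lp_mul_Lq (μ.restrict B) hc
    (f := fun x => a x * k x ^ (1 / q)) (g := fun x => k x ^ (1 / q'))
    (ha.restrict.mul (hk.restrict.pow_const _)) (hk.restrict.pow_const _)
  have e4 : ∀ x, (a x * k x ^ (1 / q)) ^ q = a x ^ q * k x := fun x => by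
    rw [ENNReal.mul_rpow_of_nonneg _ _ hq0.le, ← ENNReal.rpow_mul, one_div_mul_cancel hq0.ne',
      ENNReal.rpow_one]
  have e5 : ∀ x, (k x ^ (1 / q')) ^ q' = k x := fun x => by
    rw [← ENNReal.rpow_mul, one_div_mul_cancel hc.symm.ne_zero, ENNReal.rpow_one]
  simp only [e4, e5] at e3
  have e6 := (e1.trans (e2.le.trans e3))
  calc (∫⁻ x, a x * k x ∂μ) ^ q
      ≤ ((∫⁻ x in B, a x ^ q * k x ∂μ) ^ (1 / q) * (∫⁻ x in B, k x ∂μ) ^ (1 / q')) ^ q := by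
        gcongr
    _ = (∫⁻ x in B, a x ^ q * k x ∂μ) * (∫⁻ x in B, k x ∂μ) ^ (q - 1) := by
        rw [ENNReal.mul_rpow_of_nonneg _ _ hq0.le, ← ENNReal.rpow_mul, ← ENNReal.rpow_mul,
          one_div_mul_cancel hq0.ne', ENNReal.rpow_one]
        congr 2
        rw [hq']
        have : q - 1 ≠ 0 := by linarith
        field_simp
    _ ≤ _ := by
        gcongr
        exact Measure.restrict_le_self

/-- A function that has exponential moments of maximal growth on `|x| ≤ t + R` has a large
`L^q` norm. -/
theorem exists_le_integral_rpow {n : ℕ} (hn : 1 ≤ n) {q R c : ℝ} (hq : 1 < q) (hR : 0 < R)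
    (hc : 0 < c) :
    ∃ δ > 0, ∀ t : ℝ, 1 ≤ t → ∀ w : EucSp n → ℝ, AEStronglyMeasurable w volume →
      Integrable (fun x => |w x| ^ q) volume → (∀ᵐ x, t + R < ‖x‖ → w x = 0) →
      (∀ ξ : EucSp n, 1 ≤ ‖ξ‖ → ‖ξ‖ ≤ 2 →
        c * Real.exp (t * ‖ξ‖) ≤ ∫ x, w x * Real.exp (inner ℝ x ξ)) →
      δ * t ^ (((n : ℝ) - 1) * (1 - q / 2)) ≤ ∫ x, |w x| ^ q := by
  obtain ⟨K₁, hK₁, h₁⟩ := exists_lintegral_exp_ball_le hn hR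
  obtain ⟨K₂, hK₂, h₂⟩ := exists_lintegral_exp_annulus_le hn hR
  set A : Set (EucSp n) := {ξ | 1 ≤ ‖ξ‖ ∧ ‖ξ‖ ≤ 2} with hA
  have hAm : MeasurableSet A := (measurableSet_le measurable_const measurable_norm).inter
    (measurableSet_le measurable_norm measurable_const)
  have hAfin : volume A ≠ ⊤ := by
    refine ((measure_mono (t := Metric.closedBall (0 : EucSp n) 2) fun ξ hξ => ?_).trans_lt
      measure_closedBall_lt_top).ne
    simpa using hξ.2
  have hApos : 0 < volume A := by
    have ho : IsOpen {ξ : EucSp n | 1 < ‖ξ‖ ∧ ‖ξ‖ < 2} :=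
      (isOpen_lt continuous_const continuous_norm).inter
        (isOpen_lt continuous_norm continuous_const)
    have hne : {ξ : EucSp n | 1 < ‖ξ‖ ∧ ‖ξ‖ < 2}.Nonempty := by
      refine ⟨EuclideanSpace.single ⟨0, hn⟩ (3 / 2), ?_⟩
      simp only [Set.mem_ofPred_eq, PiLp.norm_single]
      norm_num
    exact (ho.measure_pos volume hne).trans_le (measure_mono fun ξ hξ => ⟨hξ.1.le, hξ.2.le⟩)
  set α := (volume A).toReal with hα
  have hα0 : 0 < α := ENNReal.toReal_pos hApos.ne' hAfin
  refine ⟨α * c ^ q / (K₁ ^ (q - 1) * K₂), by positivity, fun t ht w hw hwi hws hm => ?_⟩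
  have ht0 : 0 < t := by linarith
  set a : EucSp n → ENNReal := fun x => ENNReal.ofReal |w x| with ha
  have ham : AEMeasurable a volume := hw.norm.aemeasurable.ennreal_ofReal
  let k : EucSp n → EucSp n → ENNReal := fun ξ x => ENNReal.ofReal (Real.exp (inner ℝ x ξ - t * ‖ξ‖))
  have hkm : Measurable (Function.uncurry k) := by
    refine Measurable.ennreal_ofReal (Continuous.measurable ?_)
    fun_prop
  have hB : MeasurableSet {x : EucSp n | ‖x‖ ≤ t + R} :=
    measurableSet_le measurable_norm measurable_const
  have haB : ∀ᵐ x, x ∉ {x : EucSp n | ‖x‖ ≤ t + R} → a x = 0 := by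
    filter_upwards [hws] with x hx h
    simp only [ha, hx (not_le.mp h), abs_zero, ENNReal.ofReal_zero]
  set M₁ := ENNReal.ofReal (K₁ * t ^ (((n : ℝ) - 1) / 2)) with hM₁
  set M₂ := ENNReal.ofReal (K₂ * t ^ (-(((n : ℝ) - 1) / 2))) with hM₂
  -- For a single ξ: the moment bound after division by e^{t|ξ|}, and Hölder with M₁ as the mass of
  -- the weight on the ball.
  have s1 : ∀ ξ ∈ A, ENNReal.ofReal c ^ q ≤ (∫⁻ x, a x ^ q * k ξ x) * M₁ ^ (q - 1) := by
    intro ξ hξ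
    have b1 : ENNReal.ofReal c ≤ ∫⁻ x, a x * k ξ x := by
      have b2 : c ≤ ∫ x, w x * Real.exp (inner ℝ x ξ - t * ‖ξ‖) := by
        have e : ∀ x, w x * Real.exp (inner ℝ x ξ - t * ‖ξ‖) =
            w x * Real.exp (inner ℝ x ξ) * Real.exp (-(t * ‖ξ‖)) := fun x => by
          rw [mul_assoc, ← Real.exp_add, sub_eq_add_neg]
        simp_rw [e]
        rw [integral_mul_const, Real.exp_neg, ← div_eq_mul_inv, le_div_iff₀ (Real.exp_pos _)]
        exact hm ξ hξ.1 hξ.2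
      calc ENNReal.ofReal c ≤ ENNReal.ofReal ‖∫ x, w x * Real.exp (inner ℝ x ξ - t * ‖ξ‖)‖ :=
            ENNReal.ofReal_le_ofReal (b2.trans (le_abs_self _))
        _ ≤ ∫⁻ x, ENNReal.ofReal ‖w x * Real.exp (inner ℝ x ξ - t * ‖ξ‖)‖ :=
            ENNReal.ofReal_le_of_le_toReal (norm_integral_le_lintegral_norm _)
        _ = ∫⁻ x, a x * k ξ x := by
            refine lintegral_congr fun x => ?_
            rw [norm_mul, ENNReal.ofReal_mul (norm_nonneg _), Real.norm_eq_abs,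
              Real.norm_of_nonneg (Real.exp_pos _).le]
    calc ENNReal.ofReal c ^ q ≤ (∫⁻ x, a x * k ξ x) ^ q := by gcongr
      _ ≤ _ := rpow_le_mul_of_lintegral_mul hq ham
        (hkm.of_uncurry_left (x := ξ)).aemeasurable hB haB
      _ ≤ _ := by
        gcongr
        exact h₁ t ht ξ hξ.1 hξ.2
  have hprod : AEMeasurable (Function.uncurry fun ξ x => a x ^ q * k ξ x)
      ((volume.restrict A).prod volume) :=
    ((ham.comp_snd).pow_const q).mul hkm.aemeasurable
  -- Integrating over the annulus gains over a single ξ: after Tonelli the weight is integrated in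
  -- ξ, where its mass is at most M₂, of order t^{-(n-1)/2}.
  have s2 : volume A * ENNReal.ofReal c ^ q ≤ (∫⁻ x, a x ^ q) * M₂ * M₁ ^ (q - 1) := by
    calc volume A * ENNReal.ofReal c ^ q = ∫⁻ _ξ in A, ENNReal.ofReal c ^ q := by
          rw [setLIntegral_const, mul_comm]
      _ ≤ ∫⁻ ξ in A, (∫⁻ x, a x ^ q * k ξ x) * M₁ ^ (q - 1) := setLIntegral_mono' hAm s1
      _ = (∫⁻ ξ in A, ∫⁻ x, a x ^ q * k ξ x) * M₁ ^ (q - 1) := by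
          rw [lintegral_mul_const' _ _ (ENNReal.rpow_ne_top_of_nonneg (by linarith)
            ENNReal.ofReal_ne_top)]
      _ = (∫⁻ x, ∫⁻ ξ in A, a x ^ q * k ξ x) * M₁ ^ (q - 1) := by
          rw [lintegral_lintegral_swap hprod]
      _ ≤ (∫⁻ x, a x ^ q * M₂) * M₁ ^ (q - 1) := by
          gcongr ?_ * _
          refine lintegral_mono_ae ?_
          filter_upwards [haB] with x hx
          by_cases h : ‖x‖ ≤ t + R
          · rw [lintegral_const_mul _ (hkm.of_uncurry_right (y := x))]
            gcongr
            exact h₂ t ht x h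
          · rw [hx h, ENNReal.zero_rpow_of_pos (by linarith)]
            simp
      _ = _ := by rw [lintegral_mul_const' _ _ ENNReal.ofReal_ne_top]
  have s3 : ∫⁻ x, a x ^ q = ENNReal.ofReal (∫ x, |w x| ^ q) := by
    rw [ofReal_integral_eq_lintegral_ofReal hwi (Eventually.of_forall fun x => by positivity)]
    refine lintegral_congr fun x => ?_
    rw [ha, ENNReal.ofReal_rpow_of_nonneg (abs_nonneg _) (by linarith)]
  have hI : 0 ≤ ∫ x, |w x| ^ q := integral_nonneg fun x => by positivity
  rw [s3, ← ENNReal.ofReal_toReal hAfin, hM₁, hM₂, ENNReal.ofReal_rpow_of_nonneg hc.le (by linarith),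
    ENNReal.ofReal_rpow_of_nonneg (by positivity) (by linarith), ← ENNReal.ofReal_mul hα0.le,
    ← ENNReal.ofReal_mul hI, ← ENNReal.ofReal_mul (by positivity),
    ENNReal.ofReal_le_ofReal_iff (by positivity)] at s2
  have hsplit : t ^ (((n : ℝ) - 1) * (1 - q / 2)) * (t ^ (-(((n : ℝ) - 1) / 2)) *
      (t ^ (((n : ℝ) - 1) / 2)) ^ (q - 1)) = 1 := by
    rw [← Real.rpow_mul ht0.le, ← Real.rpow_add ht0, ← Real.rpow_add ht0,
      show ((n : ℝ) - 1) * (1 - q / 2) + (-(((n : ℝ) - 1) / 2) + ((n : ℝ) - 1) / 2 * (q - 1)) = 0 by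
        ring, Real.rpow_zero]
  rw [Real.mul_rpow hK₁.le (by positivity)] at s2
  rw [div_mul_eq_mul_div, div_le_iff₀ (by positivity)]
  calc α * c ^ q * t ^ (((n : ℝ) - 1) * (1 - q / 2))
      ≤ ((∫ x, |w x| ^ q) * (K₂ * t ^ (-(((n : ℝ) - 1) / 2))) *
        (K₁ ^ (q - 1) * (t ^ (((n : ℝ) - 1) / 2)) ^ (q - 1))) * t ^ (((n : ℝ) - 1) * (1 - q / 2)) := by
        gcongr
    _ = (∫ x, |w x| ^ q) * (K₁ ^ (q - 1) * K₂) * (t ^ (((n : ℝ) - 1) * (1 - q / 2)) *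
        (t ^ (-(((n : ℝ) - 1) / 2)) * (t ^ (((n : ℝ) - 1) / 2)) ^ (q - 1))) := by ring
    _ = _ := by rw [hsplit, mul_one]

end ExponentialMoments

/-! ### Scalar differential inequalities -/

section ScalarGrowth

theorem ContinuousOn.hasDerivWithinAt_primitive {f : ℝ → ℝ} {S : ℝ} (hS : 0 ≤ S)
    (hf : ContinuousOn f (Set.Icc 0 S)) {t : ℝ} (ht : t ∈ Set.Icc 0 S) :
    HasDerivWithinAt (fun t => ∫ s in (0 : ℝ)..t, f s) (f t) (Set.Icc 0 S) t := by
  obtain ⟨F, hF, hFf, -⟩ := exists_continuous_extension hS hf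
  have h1 : HasDerivWithinAt (fun t => ∫ s in (0 : ℝ)..t, F s) (F t) (Set.Icc 0 S) t :=
    (hF.integral_hasStrictDerivAt 0 t).hasDerivAt.hasDerivWithinAt
  rw [hFf t ht] at h1
  have h2 : ∀ r ∈ Set.Icc 0 S, (∫ s in (0 : ℝ)..r, f s) = ∫ s in (0 : ℝ)..r, F s := by
    intro r hr
    refine intervalIntegral.integral_congr fun s hs => ?_
    rw [Set.uIcc_of_le hr.1] at hs
    exact (hFf s ⟨hs.1, hs.2.trans hr.2⟩).symm
  exact h1.congr h2 (h2 t ht)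

theorem monotoneOn_of_hasDerivWithinAt_Icc {f f' : ℝ → ℝ} {S : ℝ}
    (hf : ∀ t ∈ Set.Icc 0 S, HasDerivWithinAt f (f' t) (Set.Icc 0 S) t)
    (h0 : ∀ t ∈ Set.Icc 0 S, 0 ≤ f' t) : MonotoneOn f (Set.Icc 0 S) :=
  monotoneOn_of_hasDerivWithinAt_nonneg (convex_Icc 0 S)
    (fun t ht => (hf t ht).continuousWithinAt)
    (fun t ht => (hf t (interior_subset ht)).mono interior_subset)
    (fun t ht => h0 t (interior_subset ht))

/-- A moment `y` with `y'' ≥ λ² y` and nonnegative data grows like `exp (λ t)`. -/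
theorem exp_le_of_hasDerivWithinAt {S I lam : ℝ} {y F : ℝ → ℝ} (h1 : 1 ≤ lam) (h2 : lam ≤ 2)
    (hI : 0 ≤ I)
    (hy : ∀ t ∈ Set.Icc 0 S, HasDerivWithinAt y (I + lam ^ 2 * (∫ s in (0 : ℝ)..t, y s) + F t)
      (Set.Icc 0 S) t)
    (hy0 : 0 ≤ y 0) (hF : ∀ t ∈ Set.Icc 0 S, 0 ≤ F t) {t : ℝ} (ht : t ∈ Set.Icc 0 S) (ht1 : 1 ≤ t) :
    I / 8 * Real.exp (t * lam) ≤ y t := by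
  have hS : 0 ≤ S := ht.1.trans ht.2
  have h0S : (0 : ℝ) ∈ Set.Icc 0 S := ⟨le_rfl, hS⟩
  have hyc : ContinuousOn y (Set.Icc 0 S) := fun t ht => (hy t ht).continuousWithinAt
  set Y : ℝ → ℝ := fun t => ∫ s in (0 : ℝ)..t, y s with hY
  have hYd : ∀ t ∈ Set.Icc 0 S, HasDerivWithinAt Y (y t) (Set.Icc 0 S) t := fun t ht =>
    hyc.hasDerivWithinAt_primitive hS ht
  have hexp : ∀ a t : ℝ, HasDerivWithinAt (fun t => Real.exp (a * t)) (Real.exp (a * t) * (a * 1))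
      (Set.Icc 0 S) t := fun a t => ((hasDerivAt_id t).const_mul a).exp.hasDerivWithinAt
  -- This follows the factorization y'' - λ²y = (d/dt - λ)(d/dt + λ)y. The quantity P = I + λ²Y + λy
  -- is y' + λy without F, so F need not be differentiable; P' = λP + λF makes Pe^{-λt}
  -- nondecreasing.
  have hP : ∀ t ∈ Set.Icc 0 S, I * Real.exp (lam * t) ≤ I + lam ^ 2 * Y t + lam * y t := by
    intro t ht
    have hm := monotoneOn_of_hasDerivWithinAt_Icc
      (fun t ht => ((((hYd t ht).const_mul (lam ^ 2)).const_add I).add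
        ((hy t ht).const_mul lam)).mul (hexp (-lam) t)) (fun t ht => ?_) h0S ht ht.1
    · simp only [hY, intervalIntegral.integral_same, Pi.add_apply, Pi.mul_apply, mul_zero,
        Real.exp_zero, mul_one, add_zero] at hm
      rw [neg_mul, Real.exp_neg, ← div_eq_mul_inv, le_div_iff₀ (Real.exp_pos _)] at hm
      refine le_trans ?_ hm
      gcongr
      nlinarith
    · have e : (lam ^ 2 * y t + lam * (I + lam ^ 2 * Y t + F t)) * Real.exp (-lam * t) +
          (I + lam ^ 2 * Y t + lam * y t) * (Real.exp (-lam * t) * (-lam * 1)) =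
          lam * F t * Real.exp (-lam * t) := by ring
      have hFt := hF t ht
      have : 0 ≤ lam * F t * Real.exp (-lam * t) := by positivity
      exact le_of_le_of_eq this e.symm
  -- The bound y' + λy ≥ I e^{λt} is multiplied by e^{λt} and integrated. The constant of
  -- integration is absorbed by e^{λt} ≥ 2, valid for λ, t ≥ 1, and λ ≤ 2 gives I/(2λ) ≥ I/4;
  -- together they yield I/8.
  have hm := monotoneOn_of_hasDerivWithinAt_Icc
    (fun t ht => ((hy t ht).mul (hexp lam t)).sub ((hexp (2 * lam) t).const_mul (I / (2 * lam))))
    (fun t ht => ?_) h0S ht ht.1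
  · simp only [Pi.sub_apply, Pi.mul_apply, mul_zero, Real.exp_zero, mul_one] at hm
    have hlt : 1 ≤ lam * t := by nlinarith
    have e2 : Real.exp (2 * lam * t) = Real.exp (lam * t) * Real.exp (lam * t) := by
      rw [← Real.exp_add]; ring_nf
    have hE : 2 ≤ Real.exp (lam * t) := by linarith [Real.add_one_le_exp (lam * t)]
    rw [e2] at hm
    rw [mul_comm t lam]
    set E := Real.exp (lam * t)
    have h3 : I / (2 * lam) * (E * E) - I / (2 * lam) ≤ y t * E := by linarith
    have h4 : I / 4 ≤ I / (2 * lam) := by gcongr; linarith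
    have h5 : I / 4 * (E * E - 1) ≤ I / (2 * lam) * (E * E - 1) := by
      gcongr
      nlinarith
    have h6 : I / 8 * (E * E) ≤ I / 4 * (E * E - 1) := by
      have : 0 ≤ I * (E * E - 2) := mul_nonneg hI (by nlinarith)
      linarith
    have h7 : I / 8 * E * E ≤ y t * E := by linarith
    exact le_of_mul_le_mul_right h7 (by linarith)
  · have e2 : Real.exp (2 * lam * t) = Real.exp (lam * t) * Real.exp (lam * t) := by
      rw [← Real.exp_add]; ring_nf
    have hp := hP t ht
    have hf := hF t ht
    rw [e2]
    have e : (I + lam ^ 2 * (∫ s in (0 : ℝ)..t, y s) + F t) * Real.exp (lam * t) +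
        y t * (Real.exp (lam * t) * (lam * 1)) - I / (2 * lam) *
        (Real.exp (lam * t) * Real.exp (lam * t) * (2 * lam * 1)) =
        Real.exp (lam * t) * ((I + lam ^ 2 * Y t + lam * y t - I * Real.exp (lam * t)) + F t) := by
      simp only [hY]
      field_simp
      ring
    rw [e]
    have := Real.exp_pos (lam * t)
    apply mul_nonneg this.le
    linarith

/-- Integrating a second order lower bound twice. -/
theorem iterated_integral_le_of_hasDerivWithinAt {S I : ℝ} {y f : ℝ → ℝ} (hI : 0 ≤ I)
    (hf : ContinuousOn f (Set.Icc 0 S))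
    (hy : ∀ t ∈ Set.Icc 0 S, HasDerivWithinAt y (I + ∫ s in (0 : ℝ)..t, f s) (Set.Icc 0 S) t)
    (hy0 : 0 ≤ y 0) {t : ℝ} (ht : t ∈ Set.Icc 0 S) :
    ∫ s in (0 : ℝ)..t, ∫ r in (0 : ℝ)..s, f r ≤ y t := by
  have hS : 0 ≤ S := ht.1.trans ht.2
  have hc : ContinuousOn (fun s => ∫ r in (0 : ℝ)..s, f r) (Set.Icc 0 S) := fun t ht =>
    (hf.hasDerivWithinAt_primitive hS ht).continuousWithinAt
  have hm := monotoneOn_of_hasDerivWithinAt_Icc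
    (fun t ht => (hy t ht).sub (hc.hasDerivWithinAt_primitive hS ht)) (fun t ht => ?_) ⟨le_rfl, hS⟩ ht ht.1
  · simp only [Pi.sub_apply, intervalIntegral.integral_same] at hm
    linarith
  · simpa using hI

end ScalarGrowth

/-! ### Exponential moments of wave curves -/

section Moments

variable {n : ℕ}

/-- The function `exp ⟨x, ξ⟩`, cut off at scale `k + 1`. -/
noncomputable def expTest (k : ℕ) (ξ : EucSp n) : TestFun n :=
  (cutoff n k).mul (fun x => Real.exp (inner ℝ x ξ))
    (Real.contDiff_exp.comp (contDiff_id.inner ℝ contDiff_const))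

theorem expTest_apply {k : ℕ} {ξ x : EucSp n} (hx : ‖x‖ ≤ k + 1) :
    (expTest k ξ).toFun x = Real.exp (inner ℝ x ξ) := by
  simp [expTest, TestFun.mul, cutoff_eq_one hx]

theorem expTest_nonneg (k : ℕ) (ξ x : EucSp n) : 0 ≤ (expTest k ξ).toFun x :=
  mul_nonneg (Real.exp_pos _).le (cutoff_nonneg k x)

theorem hasFDerivAt_expTest {k : ℕ} {ξ x : EucSp n} (hx : ‖x‖ < k + 1) :
    HasFDerivAt (expTest k ξ).toFun (Real.exp (inner ℝ x ξ) • innerSL ℝ ξ) x := by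
  have h1 : HasFDerivAt (fun x : EucSp n => Real.exp (inner ℝ ξ x))
      (Real.exp (inner ℝ ξ x) • innerSL ℝ ξ) x := (innerSL ℝ ξ).hasFDerivAt.exp
  rw [real_inner_comm] at h1
  refine h1.congr_of_eventuallyEq ?_
  filter_upwards [(isOpen_lt continuous_norm continuous_const).mem_nhds hx] with y hy
  rw [expTest_apply (le_of_lt hy), real_inner_comm]

theorem gradient_expTest {k : ℕ} {ξ x : EucSp n} (hx : ‖x‖ < k + 1) :
    gradient (expTest k ξ).toFun x = Real.exp (inner ℝ x ξ) • ξ := by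
  rw [gradient, (hasFDerivAt_expTest hx).fderiv, map_smul]
  congr 1
  rw [LinearIsometryEquiv.symm_apply_eq]
  ext y
  simp

theorem inner_expTest {f : L2Sp n ℝ} {r : ℝ} (hf : ∀ᵐ x, r < ‖x‖ → f x = 0) {k : ℕ}
    (hk : r ≤ k + 1) (ξ : EucSp n) :
    inner ℝ f (expTest k ξ).toL2 = ∫ x, f x * Real.exp (inner ℝ x ξ) := by
  rw [TestFun.inner_toL2]
  refine integral_congr_ae ?_
  filter_upwards [hf] with x hx
  rcases le_or_gt ‖x‖ r with h | h
  · rw [expTest_apply (h.trans hk)]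
  · rw [hx h, zero_mul, zero_mul]

theorem inner_expTest_zero {f : L2Sp n ℝ} {r : ℝ} (hf : ∀ᵐ x, r < ‖x‖ → f x = 0) {k : ℕ}
    (hk : r ≤ k + 1) : inner ℝ f (expTest k (0 : EucSp n)).toL2 = ∫ x, f x := by
  rw [inner_expTest hf hk]
  simp

theorem inner_expTest_nonneg {f : L2Sp n ℝ} (hf : 0 ≤ᵐ[volume] f) (k : ℕ) (ξ : EucSp n) :
    0 ≤ inner ℝ f (expTest k ξ).toL2 := by
  rw [TestFun.inner_toL2]
  refine integral_nonneg_of_ae ?_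
  filter_upwards [hf] with x hx
  exact mul_nonneg hx (expTest_nonneg k ξ x)

/-- The function e^{⟨x,ξ⟩} is an eigenfunction of the Laplacian with eigenvalue |ξ|². Its gradient
points along ξ, so one integration by parts in that direction suffices. The strict inequality keeps
the cutoff equal to 1 near every point of the support, where derivatives are taken. -/
theorem IsWeakGrad.inner_expTest {W : L2Sp n ℝ} {D : L2Sp n (EucSp n)} (h : IsWeakGrad W D)
    {r : ℝ} (hW : ∀ᵐ x, r < ‖x‖ → W x = 0) {k : ℕ} (hk : r < k + 1) (ξ : EucSp n) :
    inner ℝ D (expTest k ξ).gradL2 = -(‖ξ‖ ^ 2 * inner ℝ W (expTest k ξ).toL2) := by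
  have hD := h.ae_eq_zero (isOpen_lt continuous_const continuous_norm) hW
  have h1 := h (expTest k ξ) ξ
  have e1 : inner ℝ D (expTest k ξ).gradL2 = ∫ x, (expTest k ξ).toFun x * inner ℝ (D x) ξ := by
    rw [TestFun.inner_gradL2]
    refine integral_congr_ae ?_
    filter_upwards [hD] with x hx
    rcases le_or_gt ‖x‖ r with h | h
    · have hxk := h.trans_lt hk
      rw [gradient_expTest hxk, expTest_apply hxk.le, inner_smul_right]
    · rw [hx h, inner_zero_left, inner_zero_left, mul_zero]
  have e2 : ∫ x, W x * fderiv ℝ (expTest k ξ).toFun x ξ =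
      ‖ξ‖ ^ 2 * inner ℝ W (expTest k ξ).toL2 := by
    rw [TestFun.inner_toL2, ← integral_const_mul]
    refine integral_congr_ae ?_
    filter_upwards [hW] with x hx
    rcases le_or_gt ‖x‖ r with h | h
    · have hxk := h.trans_lt hk
      rw [(hasFDerivAt_expTest hxk).fderiv, expTest_apply hxk.le]
      simp only [smul_apply, innerSL_apply_apply, real_inner_self_eq_norm_sq,
        smul_eq_mul]
      ring
    · rw [hx h, zero_mul, zero_mul, mul_zero]
  rw [e1, ← e2, h1, neg_neg]

theorem IsWaveCurve.hasDerivWithinAt_moment {S R : ℝ} {W Wt : ℝ → L2Sp n ℝ}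
    {D : ℝ → L2Sp n (EucSp n)} {f : ℝ → L2Sp n ℝ} (hW : IsWaveCurve S W Wt D f)
    (hsupp : ∀ t ∈ Set.Icc 0 S, ∀ᵐ x, R + t < ‖x‖ → W t x = 0) {k : ℕ} (hk : R + S < k + 1)
    (ξ : EucSp n) {t : ℝ} (ht : t ∈ Set.Icc 0 S) :
    HasDerivWithinAt (fun t => inner ℝ (W t) (expTest k ξ).toL2)
      (inner ℝ (Wt 0) (expTest k ξ).toL2 +
        ‖ξ‖ ^ 2 * (∫ s in (0 : ℝ)..t, inner ℝ (W s) (expTest k ξ).toL2) +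
        ∫ s in (0 : ℝ)..t, inner ℝ (f s) (expTest k ξ).toL2) (Set.Icc 0 S) t := by
  have h1 := (hW.hasDeriv t ht).inner ℝ (hasDerivWithinAt_const t (Set.Icc 0 S) (expTest k ξ).toL2)
  rw [inner_zero_right, zero_add] at h1
  refine h1.congr_deriv ?_
  have h2 := hW.relation t ht (expTest k ξ)
  have h3 : (∫ s in (0 : ℝ)..t, inner ℝ (D s) (expTest k ξ).gradL2) =
      -(‖ξ‖ ^ 2 * ∫ s in (0 : ℝ)..t, inner ℝ (W s) (expTest k ξ).toL2) := by
    rw [← intervalIntegral.integral_const_mul, ← intervalIntegral.integral_neg]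
    refine intervalIntegral.integral_congr fun s hs => ?_
    rw [Set.uIcc_of_le ht.1] at hs
    have hsS : s ∈ Set.Icc 0 S := ⟨hs.1, hs.2.trans ht.2⟩
    exact (hW.weakGrad s hsS).inner_expTest (hsupp s hsS) (by linarith [hsS.2]) ξ
  linarith

theorem inner_memoryL2 {H : Type*} [NormedAddCommGroup H] [InnerProductSpace ℝ H]
    [CompleteSpace H] {g : ℝ → ℝ} {N : ℝ → H} {S s : ℝ}
    (hg : IntegrableOn g (Set.Ioc 0 S) volume) (hN : ContinuousOn N (Set.Icc 0 S))
    (hs : s ∈ Set.Icc 0 S) (φ : H) :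
    inner ℝ (memoryL2 g N s) φ = memoryL2 g (fun τ => inner ℝ (N τ) φ) s := by
  have hi : IntervalIntegrable (fun τ => g (s - τ) • N τ) volume 0 s := by
    refine (intervalIntegrable_comp_sub_left hg hs).smul_continuousOn ?_
    rw [Set.uIcc_of_le hs.1]
    exact hN.mono (Set.Icc_subset_Icc_right hs.2)
  have h := (innerSL ℝ φ).intervalIntegral_comp_comm hi
  simp only [innerSL_apply_apply] at h
  rw [real_inner_comm, memoryL2, ← h, memoryL2]
  refine intervalIntegral.integral_congr fun τ _ => ?_
  rw [inner_smul_right, real_inner_comm, smul_eq_mul]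

theorem memoryL2_nonneg {g h : ℝ → ℝ} {s : ℝ} (hs : 0 ≤ s) (hg : ∀ t, 0 < t → 0 < g t)
    (hh : ∀ t, 0 ≤ t → 0 ≤ h t) : 0 ≤ memoryL2 g h s := by
  -- The endpoint τ = s is dropped because the sign of g at 0 is unknown.
  rw [memoryL2, intervalIntegral.integral_of_le hs, integral_Ioc_eq_integral_Ioo]
  refine setIntegral_nonneg measurableSet_Ioo fun τ hτ => ?_
  exact mul_nonneg (hg _ (by linarith [hτ.2])).le (hh τ hτ.1.le)

end Moments

theorem L2_integrable_of_support {n : ℕ} {f : L2Sp n ℝ} {r : ℝ} (hf : ∀ᵐ x, r < ‖x‖ → f x = 0) :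
    Integrable (f : EucSp n → ℝ) volume := by
  have h1 : IntegrableOn (f : EucSp n → ℝ) (Metric.closedBall 0 r) volume := by
    have : IsFiniteMeasure (volume.restrict (Metric.closedBall (0 : EucSp n) r)) :=
      ⟨by simpa using measure_closedBall_lt_top⟩
    exact MemLp.integrable (q := 2) (by norm_num) ((Lp.memLp f).restrict _)
  refine h1.integrable_of_ae_notMem_eq_zero ?_
  filter_upwards [hf] with x hx hxr
  exact hx (by simpa using hxr)

/-! ### Global solutions with nonnegative data -/

section GlobalCurve

variable {n : ℕ} {R : ℝ} {W Wt N : ℝ → L2Sp n ℝ} {D : ℝ → L2Sp n (EucSp n)} {g : ℝ → ℝ}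

/-- A global wave curve with nonnegative compactly supported data and a nonnegative memory
source with finite speed of propagation. -/
structure IsPositiveWaveCurve (R : ℝ) (W Wt N : ℝ → L2Sp n ℝ) (D : ℝ → L2Sp n (EucSp n))
    (g : ℝ → ℝ) : Prop where
  waveCurve : ∀ S, 0 < S → IsWaveCurve S W Wt D (memoryL2 g N)
  kernel_pos : ∀ t, 0 < t → 0 < g t
  kernel_integrable : ∀ S, 0 < S → IntegrableOn g (Set.Ioc 0 S) volume
  continuousOn_source : ∀ S, 0 < S → ContinuousOn N (Set.Icc 0 S)
  source_nonneg : ∀ t, 0 ≤ t → 0 ≤ᵐ[volume] N t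
  support : ∀ t, 0 ≤ t → ∀ᵐ x, R + t < ‖x‖ → W t x = 0
  source_support : ∀ t, 0 ≤ t → ∀ᵐ x, R + t < ‖x‖ → N t x = 0
  initial_nonneg : 0 ≤ᵐ[volume] W 0
  velocity_nonneg : 0 ≤ᵐ[volume] Wt 0
  velocity_support : ∀ᵐ x, R < ‖x‖ → Wt 0 x = 0
  velocity_ne : ¬ Wt 0 =ᵐ[volume] 0

namespace IsPositiveWaveCurve

theorem continuousOn_integral_source (h : IsPositiveWaveCurve R W Wt N D g) :
    ContinuousOn (fun t => ∫ x, N t x) (Set.Ici 0) := by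
  intro t ht
  have ht' : (0 : ℝ) ≤ t := ht
  have hS : 0 < t + 1 := by linarith
  obtain ⟨k, hk⟩ := exists_nat_gt (R + (t + 1))
  have hc : ContinuousOn (fun t => ∫ x, N t x) (Set.Icc 0 (t + 1)) := by
    refine ((h.continuousOn_source _ hS).inner (continuousOn_const
      (c := (expTest k (0 : EucSp n)).toL2))).congr fun s hs => ?_
    exact (inner_expTest_zero (h.source_support s hs.1) (by linarith [hs.2])).symm
  refine (hc t ⟨ht, by linarith⟩).mono_of_mem_nhdsWithin ?_
  rw [← Set.Ici_inter_Iic]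
  exact inter_mem self_mem_nhdsWithin (mem_nhdsWithin_of_mem_nhds (Iic_mem_nhds (by linarith)))

theorem integral_source_nonneg (h : IsPositiveWaveCurve R W Wt N D g) {t : ℝ} (ht : 0 ≤ t) :
    0 ≤ ∫ x, N t x := integral_nonneg_of_ae (h.source_nonneg t ht)

theorem integral_velocity_pos (h : IsPositiveWaveCurve R W Wt N D g) : 0 < ∫ x, Wt 0 x := by
  have hi := L2_integrable_of_support h.velocity_support
  rw [integral_pos_iff_support_of_nonneg_ae h.velocity_nonneg hi]
  refine pos_iff_ne_zero.mpr fun h0 => h.velocity_ne ?_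
  rw [EventuallyEq, ae_iff]
  exact h0

theorem iterated_integral_le (h : IsPositiveWaveCurve R W Wt N D g) {t : ℝ} (ht : 0 ≤ t) :
    ∫ s in (0 : ℝ)..t, ∫ r in (0 : ℝ)..s, memoryL2 g (fun τ => ∫ x, N τ x) r ≤ ∫ x, W t x := by
  have hS : 0 < t + 1 := by linarith
  obtain ⟨k, hk⟩ := exists_nat_gt (R + (t + 1))
  have hw := h.waveCurve _ hS
  have hNi : ∀ τ ∈ Set.Icc 0 (t + 1), inner ℝ (N τ) (expTest k (0 : EucSp n)).toL2 = ∫ x, N τ x :=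
    fun τ hτ => inner_expTest_zero (h.source_support τ hτ.1) (by linarith [hτ.2])
  have hm : ∀ s ∈ Set.Icc 0 (t + 1), inner ℝ (memoryL2 g N s) (expTest k (0 : EucSp n)).toL2 =
      memoryL2 g (fun τ => ∫ x, N τ x) s := by
    intro s hs
    rw [inner_memoryL2 (h.kernel_integrable _ hS) (h.continuousOn_source _ hS) hs]
    refine intervalIntegral.integral_congr fun τ hτ => ?_
    rw [Set.uIcc_of_le hs.1] at hτ
    simp only [hNi τ ⟨hτ.1, hτ.2.trans hs.2⟩]
  have key := iterated_integral_le_of_hasDerivWithinAt (S := t + 1)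
    (inner_expTest_nonneg h.velocity_nonneg k 0)
    (hw.continuousOn_source.inner (continuousOn_const (c := (expTest k (0 : EucSp n)).toL2)))
    (fun s hs => by
      have := hw.hasDerivWithinAt_moment (R := R) (fun s hs => h.support s hs.1)
        (by linarith) (0 : EucSp n) (k := k) hs
      simpa using this) (inner_expTest_nonneg h.initial_nonneg k 0) (t := t) ⟨ht, by linarith⟩
  rw [inner_expTest_zero (h.support t ht) (by linarith)] at key
  refine le_trans (le_of_eq ?_) key
  refine intervalIntegral.integral_congr fun s hs => ?_
  refine intervalIntegral.integral_congr fun r hr => ?_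
  rw [Set.uIcc_of_le ht] at hs
  rw [Set.uIcc_of_le hs.1] at hr
  exact (hm r ⟨hr.1, by linarith [hr.2, hs.2]⟩).symm

/-- The initial velocity alone starts the growth. On its support |x| ≤ R one has ⟨x, ξ⟩ ≥ -2R, which
makes the constant uniform in ξ; the 8 is that of the scalar estimate. -/
theorem exists_exp_le_moment (h : IsPositiveWaveCurve R W Wt N D g) (hR : 0 < R) :
    ∃ c > 0, ∀ t, 1 ≤ t → ∀ ξ : EucSp n, 1 ≤ ‖ξ‖ → ‖ξ‖ ≤ 2 →
      c * Real.exp (t * ‖ξ‖) ≤ ∫ x, W t x * Real.exp (inner ℝ x ξ) := by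
  have hI := h.integral_velocity_pos
  refine ⟨Real.exp (-(2 * R)) * (∫ x, Wt 0 x) / 8, by positivity, fun t ht ξ h1 h2 => ?_⟩
  have ht0 : 0 ≤ t := by linarith
  have hS : 0 < t + 1 := by linarith
  obtain ⟨k, hk⟩ := exists_nat_gt (R + (t + 1))
  have hw := h.waveCurve _ hS
  have key := exp_le_of_hasDerivWithinAt (S := t + 1) h1 h2
    (inner_expTest_nonneg h.velocity_nonneg k ξ)
    (fun s hs => hw.hasDerivWithinAt_moment (R := R) (fun s hs => h.support s hs.1)
      (by linarith) ξ (k := k) hs) (inner_expTest_nonneg h.initial_nonneg k ξ)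
    (fun s hs => ?_) (t := t) ⟨ht0, by linarith⟩ ht
  · rw [inner_expTest (h.support t ht0) (by linarith)] at key
    refine le_trans ?_ key
    gcongr
    rw [← inner_expTest_zero h.velocity_support (k := k) (by linarith), TestFun.inner_toL2,
      TestFun.inner_toL2, ← integral_const_mul]
    refine integral_mono_ae ?_ ?_ ?_
    · exact (integrable_mul_of_L2 (Lp.memLp _) (TestFun.memLp _ 2)).const_mul _
    · exact integrable_mul_of_L2 (Lp.memLp _) (TestFun.memLp _ 2)
    · filter_upwards [h.velocity_nonneg, h.velocity_support] with x hx hxR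
      rcases le_or_gt ‖x‖ R with hr | hr
      · have hxk : ‖x‖ ≤ k + 1 := by linarith
        simp only [expTest_apply hxk, inner_zero_right, Real.exp_zero, mul_one]
        rw [mul_comm]
        refine mul_le_mul_of_nonneg_left (Real.exp_le_exp.mpr ?_) hx
        have h3 := neg_le_of_abs_le (abs_real_inner_le_norm x ξ)
        have h4 : ‖x‖ * ‖ξ‖ ≤ R * 2 := by gcongr
        linarith
      · simp [hxR hr]
  · refine intervalIntegral.integral_nonneg hs.1 fun r hr => ?_
    rw [inner_memoryL2 (h.kernel_integrable _ hS) (h.continuousOn_source _ hS)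
      ⟨hr.1, hr.2.trans hs.2⟩]
    exact memoryL2_nonneg hr.1 h.kernel_pos
      fun τ hτ => inner_expTest_nonneg (h.source_nonneg τ hτ) k ξ

end IsPositiveWaveCurve

/-- Hölder's inequality on the ball `|x| ≤ t + R`. -/
theorem exists_abs_integral_rpow_le {n : ℕ} {q R : ℝ} (hq : 1 < q) (hR : 0 < R) :
    ∃ K > 0, ∀ t : ℝ, 1 ≤ t → ∀ w : EucSp n → ℝ, AEStronglyMeasurable w volume →
      Integrable (fun x => |w x| ^ q) volume → (∀ᵐ x, t + R < ‖x‖ → w x = 0) →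
      |∫ x, w x| ^ q ≤ K * t ^ ((n : ℝ) * (q - 1)) * ∫ x, |w x| ^ q := by
  set β := (volume (Metric.closedBall (0 : EucSp n) 1)).toReal with hβ
  have hβfin : volume (Metric.closedBall (0 : EucSp n) 1) ≠ ⊤ := measure_closedBall_lt_top.ne
  have hβ0 : 0 < β := ENNReal.toReal_pos (Metric.measure_closedBall_pos _ _ one_pos).ne' hβfin
  -- For t ≥ 1 the radius t + R is at most (1 + R)t, so the volume of the ball is at most (1+R)ⁿβ
  -- tⁿ.
  refine ⟨((1 + R) ^ n * β) ^ (q - 1), by positivity, fun t ht w hw hwi hws => ?_⟩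
  have ht0 : 0 < t := by linarith
  have hq0 : 0 < q := by linarith
  have hB : MeasurableSet {x : EucSp n | ‖x‖ ≤ t + R} :=
    measurableSet_le measurable_norm measurable_const
  have h1 := rpow_le_mul_of_lintegral_mul (μ := volume) (a := fun x => ENNReal.ofReal |w x|)
    (k := fun _ => 1) hq hw.norm.aemeasurable.ennreal_ofReal aemeasurable_const hB (by
      filter_upwards [hws] with x hx h
      simp [hx (not_le.mp h)])
  simp only [mul_one, lintegral_one, Measure.restrict_apply_univ] at h1
  have e1 : ∀ x, ENNReal.ofReal |w x| ^ q = ENNReal.ofReal (|w x| ^ q) := fun x =>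
    ENNReal.ofReal_rpow_of_nonneg (abs_nonneg _) hq0.le
  simp only [e1] at h1
  rw [← ofReal_integral_eq_lintegral_ofReal hwi (Eventually.of_forall fun x => by positivity)] at h1
  have e2 : volume {x : EucSp n | ‖x‖ ≤ t + R} = ENNReal.ofReal ((t + R) ^ n * β) := by
    have : {x : EucSp n | ‖x‖ ≤ t + R} = Metric.closedBall 0 (t + R) := by ext; simp
    rw [this, Measure.addHaar_closedBall' _ _ (by linarith), finrank_euclideanSpace_fin,
      ENNReal.ofReal_mul (by positivity), hβ, ENNReal.ofReal_toReal hβfin]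
  have h2 : ENNReal.ofReal |∫ x, w x| ≤ ∫⁻ x, ENNReal.ofReal |w x| :=
    ENNReal.ofReal_le_of_le_toReal (norm_integral_le_lintegral_norm w)
  have hI : 0 ≤ ∫ x, |w x| ^ q := integral_nonneg fun x => by positivity
  have h3 := (ENNReal.rpow_le_rpow h2 hq0.le).trans h1
  rw [e2, ENNReal.ofReal_rpow_of_nonneg (abs_nonneg _) hq0.le,
    ENNReal.ofReal_rpow_of_nonneg (by positivity) (by linarith), ← ENNReal.ofReal_mul hI,
    ENNReal.ofReal_le_ofReal_iff (by positivity)] at h3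
  refine h3.trans ?_
  rw [mul_comm]
  gcongr
  have e3 : t ^ ((n : ℝ) * (q - 1)) = (t ^ n) ^ (q - 1) := by
    rw [Real.rpow_mul ht0.le, Real.rpow_natCast]
  rw [e3, ← Real.mul_rpow (by positivity) (by positivity)]
  refine Real.rpow_le_rpow (by positivity) ?_ (by linarith)
  have : t + R ≤ (1 + R) * t := by nlinarith
  calc (t + R) ^ n * β ≤ ((1 + R) * t) ^ n * β := by gcongr
    _ = _ := by rw [mul_pow]; ring

end GlobalCurve

/-! ### Reduction to a scalar system -/

/-- The ordinary integro-differential inequalities satisfied by the averages `U`, `V` and the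
source integrals `A`, `B` of a global solution. -/
structure IsMemorySystem (n : ℕ) (p q κ : ℝ) (g₁ g₂ U V A B : ℝ → ℝ) : Prop where
  const_pos : 0 < κ
  continuous_fst : ContinuousOn A (Set.Ici 0)
  continuous_snd : ContinuousOn B (Set.Ici 0)
  nonneg_fst : ∀ t, 0 ≤ t → 0 ≤ A t
  nonneg_snd : ∀ t, 0 ≤ t → 0 ≤ B t
  growth_fst : ∀ t, 0 ≤ t → ∫ s in (0 : ℝ)..t, ∫ r in (0 : ℝ)..s, memoryL2 g₁ B r ≤ U t
  growth_snd : ∀ t, 0 ≤ t → ∫ s in (0 : ℝ)..t, ∫ r in (0 : ℝ)..s, memoryL2 g₂ A r ≤ V t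
  power_fst : ∀ t, 1 ≤ t → κ * (t ^ (-((n : ℝ) * (q - 1))) * |U t| ^ q) ≤ A t
  power_snd : ∀ t, 1 ≤ t → κ * (t ^ (-((n : ℝ) * (p - 1))) * |V t| ^ p) ≤ B t
  seed_fst : ∀ t, 1 ≤ t → κ * t ^ (((n : ℝ) - 1) * (1 - q / 2)) ≤ A t
  seed_snd : ∀ t, 1 ≤ t → κ * t ^ (((n : ℝ) - 1) * (1 - p / 2)) ≤ B t

theorem IsMemorySystem.swap {n : ℕ} {p q κ : ℝ} {g₁ g₂ U V A B : ℝ → ℝ}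
    (h : IsMemorySystem n p q κ g₁ g₂ U V A B) : IsMemorySystem n q p κ g₂ g₁ V U B A :=
  ⟨h.const_pos, h.continuous_snd, h.continuous_fst, h.nonneg_snd, h.nonneg_fst, h.growth_snd,
    h.growth_fst, h.power_snd, h.power_fst, h.seed_snd, h.seed_fst⟩

section Reduction

variable {n : ℕ}

theorem IsPositiveWaveCurve.exists_power_bounds {R q : ℝ} {W Wt N M : ℝ → L2Sp n ℝ}
    {D : ℝ → L2Sp n (EucSp n)} {g : ℝ → ℝ} (hn : 1 ≤ n) (hq : 1 < q) (hR : 0 < R)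
    (h : IsPositiveWaveCurve R W Wt N D g) (hM : ∀ t, 0 ≤ t → M t =ᵐ[volume] fun x => |W t x| ^ q) :
    ∃ κ > 0, ∀ t : ℝ, 1 ≤ t →
      κ * (t ^ (-((n : ℝ) * (q - 1))) * |∫ x, W t x| ^ q) ≤ ∫ x, M t x ∧
      κ * t ^ (((n : ℝ) - 1) * (1 - q / 2)) ≤ ∫ x, M t x := by
  obtain ⟨c, hc, hm⟩ := h.exists_exp_le_moment hR
  obtain ⟨δ, hδ, h1⟩ := exists_le_integral_rpow hn hq hR hc
  obtain ⟨K, hK, h2⟩ := exists_abs_integral_rpow_le (n := n) hq hR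
  refine ⟨min δ K⁻¹, by positivity, fun t ht => ?_⟩
  have ht0 : 0 < t := by linarith
  have hs : ∀ᵐ x, t + R < ‖x‖ → W t x = 0 := by
    filter_upwards [h.support t ht0.le] with x hx hr
    exact hx (by linarith)
  have hMs : ∀ᵐ x, t + R < ‖x‖ → M t x = 0 := by
    filter_upwards [hs, hM t ht0.le] with x hx hMx hr
    rw [hMx, hx hr, abs_zero, Real.zero_rpow (by linarith)]
  have hi : Integrable (fun x => |W t x| ^ q) volume :=
    (L2_integrable_of_support hMs).congr (hM t ht0.le)
  have hI : ∫ x, M t x = ∫ x, |W t x| ^ q := integral_congr_ae (hM t ht0.le)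
  have k1 := h1 t ht (W t) (Lp.aestronglyMeasurable _) hi hs (hm t ht)
  have k2 := h2 t ht (W t) (Lp.aestronglyMeasurable _) hi hs
  rw [hI]
  constructor
  · have h3 : t ^ (-((n : ℝ) * (q - 1))) * |∫ x, W t x| ^ q ≤ K * ∫ x, |W t x| ^ q := by
      rw [Real.rpow_neg ht0.le, inv_mul_le_iff₀ (by positivity)]
      linarith
    calc min δ K⁻¹ * (t ^ (-((n : ℝ) * (q - 1))) * |∫ x, W t x| ^ q)
        ≤ K⁻¹ * (t ^ (-((n : ℝ) * (q - 1))) * |∫ x, W t x| ^ q) := by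
          gcongr
          exact min_le_right _ _
      _ ≤ K⁻¹ * (K * ∫ x, |W t x| ^ q) := by gcongr
      _ = _ := by rw [inv_mul_cancel_left₀ hK.ne']
  · refine le_trans ?_ k1
    gcongr
    exact min_le_left _ _

/-- The witnesses are U = ∫W, V = ∫Z, A = ∫|W|^q and B = ∫|Z|^p. Each equation yields one growth
inequality, and finite speed supplies the supports that Hölder and the moment estimates need. -/
theorem exists_isMemorySystem {p q R C C' : ℝ} (hn : 1 ≤ n) (hp : 1 < p) (hq : 1 < q) (hR : 0 < R)
    (hC0 : 0 < C) (hC : IsSobolevConst n p C) (hC0' : 0 < C') (hC' : IsSobolevConst n q C')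
    {g₁ g₂ : ℝ → ℝ} (hg₁ : IsMemoryKernel ⊤ g₁) (hg₂ : IsMemoryKernel ⊤ g₂)
    {W Wt Z Zt : ℝ → L2Sp n ℝ} {D DZ : ℝ → L2Sp n (EucSp n)}
    (hW : ∀ S : ℝ, 0 < S → IsWaveCurve S W Wt D (memoryL2 g₁ fun t => powL2 p (Z t)))
    (hZ : ∀ S : ℝ, 0 < S → IsWaveCurve S Z Zt DZ (memoryL2 g₂ fun t => powL2 q (W t)))
    (h0 : ∀ᵐ x, R < ‖x‖ → W 0 x = 0 ∧ Wt 0 x = 0 ∧ Z 0 x = 0 ∧ Zt 0 x = 0)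
    (hW0 : 0 ≤ᵐ[volume] W 0) (hWt0 : 0 ≤ᵐ[volume] Wt 0)
    (hZ0 : 0 ≤ᵐ[volume] Z 0) (hZt0 : 0 ≤ᵐ[volume] Zt 0)
    (hWne : ¬ Wt 0 =ᵐ[volume] 0) (hZne : ¬ Zt 0 =ᵐ[volume] 0) :
    ∃ (κ : ℝ) (U V A B : ℝ → ℝ), IsMemorySystem n p q κ g₁ g₂ U V A B := by
  have htop : ∀ s : ℝ, (s : EReal) < ⊤ := EReal.coe_lt_top
  have hsupp : ∀ t, 0 ≤ t → ∀ᵐ x, R + t < ‖x‖ → W t x = 0 ∧ Z t x = 0 := fun t ht =>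
    ae_eq_zero_of_lt_norm (S := t + 1) hp hq hC0 hC hC0' hC'
      (hg₁.integrable _ (by linarith) (htop _)) (hg₂.integrable _ (by linarith) (htop _))
      (hW _ (by linarith)) (hZ _ (by linarith)) h0 ht (by linarith)
  have hM : ∀ t, 0 ≤ t → powL2 q (W t) =ᵐ[volume] fun x => |W t x| ^ q := fun t ht =>
    hC'.coeFn_powL2 hq ((hW (t + 1) (by linarith)).weakGrad t ⟨ht, by linarith⟩)
  have hN : ∀ t, 0 ≤ t → powL2 p (Z t) =ᵐ[volume] fun x => |Z t x| ^ p := fun t ht =>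
    hC.coeFn_powL2 hp ((hZ (t + 1) (by linarith)).weakGrad t ⟨ht, by linarith⟩)
  have cW : IsPositiveWaveCurve R W Wt (fun t => powL2 p (Z t)) D g₁ := by
    refine ⟨hW, fun t ht => hg₁.pos t ht (htop t), fun S hS => hg₁.integrable S hS (htop S),
      fun S hS => hC.continuousOn_powL2 hC0 hp (hZ S hS).continuousOn (hZ S hS).continuousOn_grad
        (hZ S hS).weakGrad, fun t ht => ?_, fun t ht => ?_, fun t ht => ?_, hW0, hWt0, ?_, hWne⟩
    · filter_upwards [hN t ht] with x hx
      rw [hx]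
      positivity
    · filter_upwards [hsupp t ht] with x hx hr using (hx hr).1
    · filter_upwards [hsupp t ht, hN t ht] with x hx hNx hr
      rw [hNx, (hx hr).2, abs_zero, Real.zero_rpow (by linarith)]
    · filter_upwards [h0] with x hx hr using (hx hr).2.1
  have cZ : IsPositiveWaveCurve R Z Zt (fun t => powL2 q (W t)) DZ g₂ := by
    refine ⟨hZ, fun t ht => hg₂.pos t ht (htop t), fun S hS => hg₂.integrable S hS (htop S),
      fun S hS => hC'.continuousOn_powL2 hC0' hq (hW S hS).continuousOn (hW S hS).continuousOn_grad
        (hW S hS).weakGrad, fun t ht => ?_, fun t ht => ?_, fun t ht => ?_, hZ0, hZt0, ?_, hZne⟩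
    · filter_upwards [hM t ht] with x hx
      rw [hx]
      positivity
    · filter_upwards [hsupp t ht] with x hx hr using (hx hr).2
    · filter_upwards [hsupp t ht, hM t ht] with x hx hMx hr
      rw [hMx, (hx hr).1, abs_zero, Real.zero_rpow (by linarith)]
    · filter_upwards [h0] with x hx hr using (hx hr).2.2.2
  obtain ⟨κ₁, hκ₁, b₁⟩ := cW.exists_power_bounds hn hq hR hM
  obtain ⟨κ₂, hκ₂, b₂⟩ := cZ.exists_power_bounds hn hp hR hN
  have l1 : min κ₁ κ₂ ≤ κ₁ := min_le_left _ _
  have l2 : min κ₁ κ₂ ≤ κ₂ := min_le_right _ _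
  refine ⟨min κ₁ κ₂, fun t => ∫ x, W t x, fun t => ∫ x, Z t x, fun t => ∫ x, powL2 q (W t) x,
    fun t => ∫ x, powL2 p (Z t) x, lt_min hκ₁ hκ₂, cZ.continuousOn_integral_source,
    cW.continuousOn_integral_source, fun t ht => cZ.integral_source_nonneg ht,
    fun t ht => cW.integral_source_nonneg ht, fun t ht => cW.iterated_integral_le ht,
    fun t ht => cZ.iterated_integral_le ht, fun t ht => le_trans ?_ (b₁ t ht).1,
    fun t ht => le_trans ?_ (b₂ t ht).1, fun t ht => le_trans ?_ (b₁ t ht).2,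
    fun t ht => le_trans ?_ (b₂ t ht).2⟩
  all_goals
    have ht0 : 0 < t := by linarith
    gcongr

end Reduction

/-! ### Iteration of the scalar system -/

section ScalarBlowUp

theorem mul_pow_le_integral {f : ℝ → ℝ} {a c τ s : ℝ} {k : ℕ} (ha : 0 ≤ a)
    (hf : ContinuousOn f (Set.Icc 0 τ)) (h0 : ∀ r ∈ Set.Icc 0 τ, 0 ≤ f r)
    (hc : ∀ r ∈ Set.Icc a τ, c * (r - a) ^ k ≤ f r) (hs : s ∈ Set.Icc a τ) :
    c / (k + 1) * (s - a) ^ (k + 1) ≤ ∫ r in (0 : ℝ)..s, f r := by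
  have hi : ∀ x y : ℝ, 0 ≤ x → x ≤ y → y ≤ s → IntervalIntegrable f volume x y := by
    intro x y hx hxy hy
    refine (hf.mono ?_).intervalIntegrable
    rw [Set.uIcc_of_le hxy]
    exact Set.Icc_subset_Icc hx (hy.trans hs.2)
  rw [← intervalIntegral.integral_add_adjacent_intervals (hi 0 a le_rfl ha hs.1)
    (hi a s ha hs.1 le_rfl)]
  have h1 : 0 ≤ ∫ r in (0 : ℝ)..a, f r :=
    intervalIntegral.integral_nonneg ha fun r hr => h0 r ⟨hr.1, hr.2.trans (hs.1.trans hs.2)⟩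
  have h2 : ∫ r in a..s, c * (r - a) ^ k ≤ ∫ r in a..s, f r :=
    intervalIntegral.integral_mono_on hs.1
      (by apply Continuous.intervalIntegrable; fun_prop) (hi a s ha hs.1 le_rfl)
      fun r hr => hc r ⟨hr.1, hr.2.trans hs.2⟩
  rw [intervalIntegral.integral_const_mul,
    intervalIntegral.integral_comp_sub_right (fun x => x ^ k) a, integral_pow] at h2
  have h3 : c / (k + 1) * (s - a) ^ (k + 1) =
      c * (((s - a) ^ (k + 1) - (a - a) ^ (k + 1)) / (k + 1)) := by
    rw [sub_self, zero_pow (Nat.succ_ne_zero k)]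
    ring
  linarith

/-- Only times in [a, r] are kept, where h ≥ m; the kernel then contributes its mass on [0, r - a].
-/
theorem mul_pow_le_memoryL2 {g h : ℝ → ℝ} {a τ Γ m r : ℝ} (ha : 0 ≤ a) (hm : 0 ≤ m)
    (hg : ∀ t, 0 < t → 0 < g t) (hgi : IntegrableOn g (Set.Ioc 0 τ) volume)
    (hΓ : ∀ s ∈ Set.Icc 0 τ, Γ * s ^ 3 ≤ ∫ x in (0 : ℝ)..s, g x)
    (hh : ContinuousOn h (Set.Icc 0 τ)) (h0 : ∀ t ∈ Set.Icc 0 τ, 0 ≤ h t)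
    (hma : ∀ t ∈ Set.Icc a τ, m ≤ h t) (hr : r ∈ Set.Icc a τ) :
    m * Γ * (r - a) ^ 3 ≤ memoryL2 g h r := by
  have hr0 : 0 ≤ r := ha.trans hr.1
  have hgr : IntervalIntegrable (fun σ => g (r - σ)) volume 0 r :=
    intervalIntegrable_comp_sub_left hgi ⟨hr0, hr.2⟩
  have hi : IntervalIntegrable (fun σ => g (r - σ) • h σ) volume 0 r := by
    refine hgr.smul_continuousOn ?_
    rw [Set.uIcc_of_le hr0]
    exact hh.mono (Set.Icc_subset_Icc_right hr.2)
  have hsub1 : Set.uIcc 0 a ⊆ Set.uIcc 0 r := by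
    rw [Set.uIcc_of_le ha, Set.uIcc_of_le hr0]
    exact Set.Icc_subset_Icc_right hr.1
  have hsub2 : Set.uIcc a r ⊆ Set.uIcc 0 r := by
    rw [Set.uIcc_of_le hr.1, Set.uIcc_of_le hr0]
    exact Set.Icc_subset_Icc_left ha
  rw [memoryL2, ← intervalIntegral.integral_add_adjacent_intervals (hi.mono_set hsub1)
    (hi.mono_set hsub2)]
  have h1 : 0 ≤ ∫ σ in (0 : ℝ)..a, g (r - σ) • h σ := by
    rw [intervalIntegral.integral_of_le ha, integral_Ioc_eq_integral_Ioo]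
    refine setIntegral_nonneg measurableSet_Ioo fun σ hσ => ?_
    exact mul_nonneg (hg _ (by linarith [hσ.2, hr.1])).le
      (h0 σ ⟨hσ.1.le, by linarith [hσ.2, hr.1, hr.2]⟩)
  have h2 : ∫ σ in a..r, g (r - σ) * m ≤ ∫ σ in a..r, g (r - σ) • h σ := by
    refine intervalIntegral.integral_mono_on_of_le_Ioo hr.1 ((hgr.mono_set hsub2).mul_const m)
      (hi.mono_set hsub2) fun σ hσ => ?_
    exact mul_le_mul_of_nonneg_left (hma σ ⟨hσ.1.le, by linarith [hσ.2, hr.2]⟩)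
      (hg _ (by linarith [hσ.2])).le
  rw [intervalIntegral.integral_mul_const, intervalIntegral.integral_comp_sub_left (fun x => g x) r,
    sub_self] at h2
  have h3 := mul_le_mul_of_nonneg_left
    (hΓ (r - a) ⟨by linarith [hr.1], by linarith [hr.2]⟩) hm
  linarith

/-- Two integrations of the cubic lower bound give the fifth power and the factor 1/(4·5). -/
theorem mul_pow_le_iterated_integral {g h : ℝ → ℝ} {a τ Γ m t : ℝ} (ha : 0 ≤ a) (hτ : 0 < τ)
    (hm : 0 ≤ m) (hg : ∀ t, 0 < t → 0 < g t) (hgi : IntegrableOn g (Set.Ioc 0 τ) volume)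
    (hΓ : ∀ s ∈ Set.Icc 0 τ, Γ * s ^ 3 ≤ ∫ x in (0 : ℝ)..s, g x)
    (hh : ContinuousOn h (Set.Ici 0)) (h0 : ∀ t, 0 ≤ t → 0 ≤ h t)
    (hma : ∀ t ∈ Set.Icc a τ, m ≤ h t) (ht : t ∈ Set.Icc a τ) :
    m * Γ / 20 * (t - a) ^ 5 ≤ ∫ s in (0 : ℝ)..t, ∫ r in (0 : ℝ)..s, memoryL2 g h r := by
  have hhc : ContinuousOn h (Set.Icc 0 τ) := hh.mono Set.Icc_subset_Ici_self
  have hc := continuousOn_memoryL2 hτ hgi hhc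
  have hn : ∀ r ∈ Set.Icc 0 τ, 0 ≤ memoryL2 g h r := fun r hr => memoryL2_nonneg hr.1 hg h0
  have h3 : ∀ r ∈ Set.Icc a τ, m * Γ * (r - a) ^ 3 ≤ memoryL2 g h r := fun r hr =>
    mul_pow_le_memoryL2 ha hm hg hgi hΓ hhc (fun t ht => h0 t ht.1) hma hr
  have h5 := mul_pow_le_integral (k := 4) (c := m * Γ / ((3 : ℕ) + 1)) ha
    (fun s hs => (hc.hasDerivWithinAt_primitive hτ.le hs).continuousWithinAt)
    (fun s hs => intervalIntegral.integral_nonneg hs.1 fun r hr => hn r ⟨hr.1, hr.2.trans hs.2⟩)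
    (fun s hs => mul_pow_le_integral (k := 3) ha hc hn h3 hs) ht
  refine le_trans (le_of_eq ?_) h5
  push_cast
  ring

/-- The kernel has at least the mass of `G s² / τ²` on `[0, τ]`, up to a constant. -/
def HasKernelMass (g : ℝ → ℝ) (τ G : ℝ) : Prop :=
  ∀ s ∈ Set.Icc 0 τ, G / τ ^ 2 * s ^ 3 ≤ ∫ x in (0 : ℝ)..s, g x

/-- Half a turn of the loop: a bound for B on [a, τ] passes through g₁ to U and then to A, at the
cost of shortening the window by l so that (t - a)⁵ ≥ l⁵. The other half follows by
`IsMemorySystem.swap`. -/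
theorem IsMemorySystem.lower_bound_fst {n : ℕ} {p q κ : ℝ} {g₁ g₂ U V A B : ℝ → ℝ}
    (h : IsMemorySystem n p q κ g₁ g₂ U V A B) (hg₁ : IsMemoryKernel ⊤ g₁) (hq : 1 < q)
    {τ G m a l : ℝ} (hG : HasKernelMass g₁ τ G) (hG0 : 0 < G) (ha : 1 ≤ a) (hl : 0 ≤ l)
    (hal : a + l ≤ τ) (hm : 0 < m) (hB : ∀ t ∈ Set.Icc a τ, m ≤ B t) :
    ∀ t ∈ Set.Icc (a + l) τ,
      κ * (τ ^ (-((n : ℝ) * (q - 1))) * (m * (G / τ ^ 2) / 20 * l ^ 5) ^ q) ≤ A t := by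
  intro t ht
  have htop : ∀ s : ℝ, (s : EReal) < ⊤ := EReal.coe_lt_top
  have hτ : 0 < τ := by linarith
  have ht1 : 1 ≤ t := by linarith [ht.1]
  have h1 := mul_pow_le_iterated_integral (t := t) (by linarith) hτ hm.le
    (fun t ht => hg₁.pos t ht (htop t)) (hg₁.integrable τ hτ (htop τ)) hG h.continuous_snd
    h.nonneg_snd hB ⟨by linarith [ht.1], ht.2⟩
  have h2 : m * (G / τ ^ 2) / 20 * l ^ 5 ≤ |U t| := by
    refine le_trans ?_ ((h1.trans (h.growth_fst t (by linarith))).trans (le_abs_self _))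
    gcongr
    linarith [ht.1]
  refine le_trans ?_ (h.power_fst t ht1)
  have := h.const_pos
  have h3 : τ ^ (-((n : ℝ) * (q - 1))) ≤ t ^ (-((n : ℝ) * (q - 1))) := by
    refine Real.rpow_le_rpow_of_nonpos (by linarith) ht.2 ?_
    have : 0 ≤ (n : ℝ) * (q - 1) := mul_nonneg (Nat.cast_nonneg n) (by linarith)
    linarith
  gcongr

/-- A bounded sequence with superlinear recursion `m_{j+1} ≥ Λ θ^j m_j^r` has small initial
value. -/
theorem log_add_mul_log_le {m : ℕ → ℝ} {Λ θ r b : ℝ} (hr : 1 < r) (hΛ : 0 < Λ) (hθ : 0 < θ)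
    (hθ1 : θ ≤ 1) (hm : ∀ j, 0 < m j) (hrec : ∀ j, m (j + 1) = Λ * θ ^ j * m j ^ r)
    (hb : ∀ j, m j ≤ b) :
    Real.log Λ + (r - 1) * Real.log (m 0) ≤ -(Real.log θ / (r - 1)) := by
  have hr1 : 0 < r - 1 := by linarith
  have hT : Real.log θ ≤ 0 := Real.log_nonpos hθ.le hθ1
  -- The affine shift in j makes the recursion for log m homogeneous, z(j+1) = r·z(j). If z 0 were
  -- positive, z would grow like r^j, against the bound b.
  set z : ℕ → ℝ := fun j => Real.log (m j) + (Real.log Λ + j * Real.log θ) / (r - 1) +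
    Real.log θ / (r - 1) ^ 2 with hz
  have hzrec : ∀ j, z (j + 1) = r * z j := by
    intro j
    simp only [hz]
    rw [hrec, Real.log_mul (by positivity) (Real.rpow_pos_of_pos (hm j) r).ne',
      Real.log_mul hΛ.ne' (by positivity), Real.log_pow, Real.log_rpow (hm j)]
    push_cast
    field_simp
    ring
  have hzpow : ∀ j, z j = r ^ j * z 0 := by
    intro j
    induction j with
    | zero => simp
    | succ j ih => rw [hzrec, ih]; ring
  have hzb : ∀ j, r ^ j * z 0 ≤ Real.log b + Real.log Λ / (r - 1) := by
    intro j
    rw [← hzpow]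
    simp only [hz]
    have h1 := Real.log_le_log (hm j) (hb j)
    have h2 : (Real.log Λ + j * Real.log θ) / (r - 1) ≤ Real.log Λ / (r - 1) := by
      gcongr
      have : (j : ℝ) * Real.log θ ≤ 0 := mul_nonpos_of_nonneg_of_nonpos (Nat.cast_nonneg j) hT
      linarith
    have h3 : Real.log θ / (r - 1) ^ 2 ≤ 0 := div_nonpos_of_nonpos_of_nonneg hT (by positivity)
    linarith
  have hz0 : z 0 ≤ 0 := by
    by_contra! hpos
    have ht := (tendsto_pow_atTop_atTop_of_one_lt hr).atTop_mul_const hpos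
    obtain ⟨j, hj⟩ := (ht.eventually_gt_atTop (Real.log b + Real.log Λ / (r - 1))).exists
    exact absurd (hzb j) (not_le.mpr hj)
  have h1 : (r - 1) * z 0 ≤ 0 := mul_nonpos_of_nonneg_of_nonpos hr1.le hz0
  have h2 : (r - 1) * z 0 = (r - 1) * Real.log (m 0) + Real.log Λ + Real.log θ / (r - 1) := by
    simp only [hz]
    push_cast
    field_simp
    ring
  linarith

/-- The absolute value covers both signs of e: the seed exponent (n-1)(1-p/2) may have either. -/
theorem half_rpow_abs_le {x e : ℝ} (hx : 1 / 2 ≤ x) (hx1 : x ≤ 1) :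
    (1 / 2 : ℝ) ^ |e| ≤ x ^ e := by
  rcases le_total 0 e with h | h
  · rw [abs_of_nonneg h]
    exact Real.rpow_le_rpow (by norm_num) hx h
  · rw [abs_of_nonpos h]
    exact (Real.rpow_le_one (by norm_num) (by norm_num) (by linarith)).trans
      (Real.one_le_rpow_of_pos_of_le_one_of_nonpos (by linarith) hx1 h)

/-- A global memory system bounds the kernels from above. -/
theorem IsMemorySystem.exists_log_le {n : ℕ} {p q κ : ℝ} {g₁ g₂ U V A B : ℝ → ℝ}
    (h : IsMemorySystem n p q κ g₁ g₂ U V A B) (hg₁ : IsMemoryKernel ⊤ g₁)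
    (hg₂ : IsMemoryKernel ⊤ g₂) (hp : 1 < p) (hq : 1 < q) :
    ∃ K : ℝ, ∀ τ G₁ G₂ : ℝ, 2 ≤ τ → 0 < G₁ → 0 < G₂ → HasKernelMass g₁ τ G₁ →
      HasKernelMass g₂ τ G₂ →
      q * Real.log G₁ + Real.log G₂ +
        (2 * q + 1 / p + 3 - ((n : ℝ) - 1) / 2 * (p * q - 1)) * Real.log τ ≤ K := by
  have hκ := h.const_pos
  have hpq : 1 < p * q := by nlinarith
  set e : ℝ := ((n : ℝ) - 1) * (1 - p / 2) with he
  set δ : ℝ := (1 / 2 : ℝ) ^ |e| with hδ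
  have hδ0 : 0 < δ := by positivity
  -- Numerical part of a half turn: the window shrinks by l = τ2^{-j}/8, and l⁵/20 = τ⁵·2^{-5j}·ε.
  set ε : ℝ := (1 / 8) ^ 5 / 20 with hε
  have hε0 : 0 < ε := by positivity
  -- The factor 2^{-5j} appears raised to the power pq from the first half turn and p from the
  -- second.
  set θ : ℝ := (1 / 32 : ℝ) ^ (p * q + p) with hθ
  have hθ0 : 0 < θ := by positivity
  have hθ1 : θ ≤ 1 := Real.rpow_le_one (by norm_num) (by norm_num) (by nlinarith)
  refine ⟨(-(Real.log θ / (p * q - 1)) - (Real.log κ + p * Real.log κ + (p * q + p) * Real.log ε +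
    (p * q - 1) * (Real.log κ + Real.log δ))) / p, fun τ G₁ G₂ hτ hG₁ hG₂ hm₁ hm₂ => ?_⟩
  have hτ0 : 0 < τ := by linarith
  -- The outcome of a full turn from m = 1 without the factor 2^{-5j}; τ³ is τ⁵ from l⁵ over the τ²
  -- in the kernel mass.
  set Λ : ℝ := κ * (τ ^ (-((n : ℝ) * (p - 1))) *
    (κ * (τ ^ (-((n : ℝ) * (q - 1))) * (G₁ * τ ^ 3 * ε) ^ q) * (G₂ * τ ^ 3 * ε)) ^ p) with hΛ
  have hΛ0 : 0 < Λ := by positivity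
  let m : ℕ → ℝ := fun j => Nat.rec (κ * (δ * τ ^ e)) (fun j x => Λ * θ ^ j * x ^ (p * q)) j
  have hm0 : m 0 = κ * (δ * τ ^ e) := rfl
  have hrec : ∀ j, m (j + 1) = Λ * θ ^ j * m j ^ (p * q) := fun j => rfl
  have hmpos : ∀ j, 0 < m j := by
    intro j
    induction j with
    | zero =>
      rw [hm0]
      exact mul_pos hκ (mul_pos hδ0 (Real.rpow_pos_of_pos hτ0 e))
    | succ j ih =>
      rw [hrec]
      exact mul_pos (mul_pos hΛ0 (pow_pos hθ0 j)) (Real.rpow_pos_of_pos ih _)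
  -- Each turn advances the left end from τ(1 - x/2) to τ(1 - x/4), x = 2^{-j}, in two steps of
  -- length τx/8. For j = 0 the window is [τ/2, τ] and the seed applies because τ ≥ 2.
  have hstep : ∀ j, ∀ t ∈ Set.Icc (τ * (1 - (1 / 2) ^ (j + 1))) τ, m j ≤ B t := by
    intro j
    induction j with
    | zero =>
      intro t ht
      have ht2 : τ / 2 ≤ t := by linarith [ht.1]
      have h1 := h.seed_snd t (by linarith)
      refine le_trans ?_ h1
      rw [hm0]
      gcongr
      have hx : t = t / τ * τ := by field_simp
      have hx0 : 0 ≤ t / τ := div_nonneg (by linarith) hτ0.le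
      rw [hx, Real.mul_rpow hx0 hτ0.le]
      gcongr
      refine half_rpow_abs_le ?_ ((div_le_one hτ0).mpr ht.2)
      rw [le_div_iff₀ hτ0]
      linarith
    | succ j ih =>
      have hx1 : (1 / 2 : ℝ) ^ j ≤ 1 := pow_le_one₀ (by norm_num) (by norm_num)
      have hx0 : (0 : ℝ) < (1 / 2) ^ j := by positivity
      set x : ℝ := (1 / 2) ^ j with hx
      have e1 : (1 / 2 : ℝ) ^ (j + 1) = x / 2 := by rw [pow_succ]; ring
      have e2 : (1 / 2 : ℝ) ^ (j + 1 + 1) = x / 4 := by rw [pow_succ, pow_succ]; ring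
      rw [e1] at ih
      rw [e2]
      have hτx : 0 < τ * x := by positivity
      have hτx1 : τ * x ≤ τ := by nlinarith
      have s1 := h.lower_bound_fst hg₁ hq hm₁ hG₁ (a := τ * (1 - x / 2)) (l := τ * (x / 8))
        (by nlinarith) (by positivity) (by nlinarith) (hmpos j) ih
      have s2 := h.swap.lower_bound_fst hg₂ hp hm₂ hG₂ (l := τ * (x / 8))
        (by nlinarith) (by positivity) (by nlinarith) (by have := hmpos j; positivity) s1
      intro t ht
      refine le_trans (le_of_eq ?_) (s2 t ⟨by linarith [ht.1], ht.2⟩)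
      have hmj := hmpos j
      have c1 : m j * (G₁ / τ ^ 2) / 20 * (τ * (x / 8)) ^ 5 = m j * (G₁ * τ ^ 3 * ε) * x ^ 5 := by
        rw [hε]; field_simp
      have c2 : ∀ y : ℝ, y * (G₂ / τ ^ 2) / 20 * (τ * (x / 8)) ^ 5 =
          y * (G₂ * τ ^ 3 * ε) * x ^ 5 := fun y => by
        rw [hε]; field_simp
      have c3 : θ ^ j = (x ^ 5) ^ (p * q + p) := by
        rw [hθ, ← Real.rpow_mul_natCast (by norm_num), mul_comm (p * q + p),
          Real.rpow_natCast_mul (by norm_num), hx, ← pow_mul, mul_comm j 5, pow_mul]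
        norm_num
      rw [c2, c1, hrec, hΛ, c3, Real.rpow_add (by positivity), mul_comm p q,
        Real.rpow_mul hmj.le, Real.rpow_mul (x := x ^ 5) (by positivity),
        Real.mul_rpow (x := m j * (G₁ * τ ^ 3 * ε)) (by positivity) (by positivity),
        Real.mul_rpow (x := m j) (by positivity) (by positivity)]
      set X := (G₁ * τ ^ 3 * ε) ^ q
      set M := m j ^ q
      set Q := (x ^ 5) ^ q
      have c4 : κ * (τ ^ (-((n : ℝ) * (q - 1))) * (M * X * Q)) * (G₂ * τ ^ 3 * ε) * x ^ 5 =
          κ * (τ ^ (-((n : ℝ) * (q - 1))) * X) * (G₂ * τ ^ 3 * ε) * M * Q * x ^ 5 := by ring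
      rw [c4, Real.mul_rpow (y := x ^ 5) (by positivity) (by positivity),
        Real.mul_rpow (y := Q) (by positivity) (by positivity),
        Real.mul_rpow (y := M) (by positivity) (by positivity)]
      ring
  -- The time τ lies in every window, so the single number B τ bounds the whole sequence.
  have hbdd : ∀ j, m j ≤ B τ := fun j => hstep j τ
    ⟨by have : (0 : ℝ) < (1 / 2) ^ (j + 1) := by positivity
        nlinarith, le_rfl⟩
  have key := log_add_mul_log_le hpq hΛ0 hθ0 hθ1 hmpos hrec hbdd
  have l1 : ∀ x G : ℝ, 0 < x → 0 < G → Real.log (x * (G * τ ^ 3 * ε)) =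
      Real.log x + (Real.log G + 3 * Real.log τ + Real.log ε) := by
    intro x G hx hG
    rw [Real.log_mul (by positivity) (by positivity), Real.log_mul (by positivity) (by positivity),
      Real.log_mul (by positivity) (by positivity), Real.log_pow]
    push_cast
    ring
  have l2 : ∀ y r : ℝ, 0 < y → Real.log (κ * (τ ^ (-((n : ℝ) * (r - 1))) * y ^ r)) =
      Real.log κ + (-((n : ℝ) * (r - 1)) * Real.log τ + r * Real.log y) := by
    intro y r hy
    rw [Real.log_mul (by positivity) (by positivity), Real.log_mul (by positivity) (by positivity),
      Real.log_rpow hτ0, Real.log_rpow hy]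
  have l3 := l1 1 G₁ one_pos hG₁
  rw [one_mul, Real.log_one, zero_add] at l3
  -- Powers of τ: Λ carries -n(pq-1) + 3pq + 3p and m 0 carries (n-1)(1-p/2), the latter weighted by
  -- pq - 1. The sum is p times the stated coefficient.
  rw [hΛ, l2 _ _ (by positivity), l1 _ _ (by positivity) hG₂, l2 _ _ (by positivity), l3, hm0,
    Real.log_mul (by positivity) (by positivity), Real.log_mul (by positivity) (by positivity),
    Real.log_rpow hτ0, he] at key
  rw [le_div_iff₀ (by linarith)]
  have hp1 : p * (1 / p) = 1 := by field_simp
  refine le_trans (le_of_eq ?_) (sub_le_sub_right key _)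
  linear_combination (Real.log τ) * hp1

end ScalarBlowUp

/-! ### Mass of slowly and rapidly decaying kernels -/

section Kernels

/-- Monotonicity gives ∫₀ˢ g ≥ s·g(τ), and s ≥ s³/τ². The cubic form is wasteful here but also
accommodates kernels vanishing at 0. -/
theorem HasKernelMass.of_antitoneOn {g : ℝ → ℝ} (hg : IsMemoryKernel ⊤ g)
    (hanti : AntitoneOn g (Set.Ioi 0)) {τ : ℝ} (hτ : 0 < τ) : HasKernelMass g τ (g τ) := by
  intro s hs
  rcases hs.1.eq_or_lt with rfl | hs0
  · simp
  have hi := hg.integrable s hs0 (EReal.coe_lt_top s)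
  have h1 : ∫ _ in (0 : ℝ)..s, g τ ≤ ∫ x in (0 : ℝ)..s, g x := by
    refine intervalIntegral.integral_mono_on_of_le_Ioo hs.1 intervalIntegrable_const
      ((intervalIntegrable_iff_integrableOn_Ioc_of_le hs.1).mpr hi) fun x hx => ?_
    exact hanti hx.1 hτ (hx.2.le.trans hs.2)
  rw [intervalIntegral.integral_const, sub_zero, smul_eq_mul] at h1
  refine le_trans ?_ h1
  have hgτ := hg.pos τ hτ (EReal.coe_lt_top τ)
  rw [div_mul_eq_mul_div, div_le_iff₀ (by positivity)]
  have : s ^ 2 ≤ τ ^ 2 := by gcongr; exact hs.2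
  calc g τ * s ^ 3 = g τ * s * s ^ 2 := by ring
    _ ≤ g τ * s * τ ^ 2 := by gcongr
    _ = _ := by ring

/-- Positivity on t > 0 forces g(0) ≥ 0. If g(0) > 0, continuity suffices. If g(0) = 0, the
difference quotients give g'(0) ≥ 0, and g'' ≥ g''(0)/2 near 0 is integrated twice. -/
theorem exists_mul_sq_le {g : ℝ → ℝ} (hpos : ∀ t, 0 < t → 0 < g t)
    (hg : ContDiffOn ℝ 2 g (Set.Ici 0)) (h2 : 0 < iteratedDerivWithin 2 g (Set.Ici 0) 0) :
    ∃ c > 0, ∃ δ > 0, δ ≤ 1 ∧ ∀ s ∈ Set.Icc 0 δ, c * s ^ 2 ≤ g s := by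
  have hu : UniqueDiffOn ℝ (Set.Ici (0 : ℝ)) := uniqueDiffOn_Ici 0
  have h0m : (0 : ℝ) ∈ Set.Ici (0 : ℝ) := Set.self_mem_Ici
  have d1 : ∀ t ∈ Set.Ici (0 : ℝ), HasDerivWithinAt g (derivWithin g (Set.Ici 0) t) (Set.Ici 0) t :=
    fun t ht => (hg.differentiableOn (by norm_num) t ht).hasDerivWithinAt
  have d2 : ∀ t ∈ Set.Ici (0 : ℝ), HasDerivWithinAt (derivWithin g (Set.Ici 0))
      (iteratedDerivWithin 2 g (Set.Ici 0) t) (Set.Ici 0) t := by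
    intro t ht
    have := (hg.differentiableOn_iteratedDerivWithin (m := 1) (by norm_num) hu t ht).hasDerivWithinAt
    rwa [← iteratedDerivWithin_succ, iteratedDerivWithin_one] at this
  have c2 : ContinuousOn (iteratedDerivWithin 2 g (Set.Ici 0)) (Set.Ici 0) :=
    hg.continuousOn_iteratedDerivWithin (by norm_num) hu
  have hg0 : 0 ≤ g 0 := by
    have hlim : Tendsto g (𝓝[>] 0) (𝓝 (g 0)) :=
      (hg.continuousOn 0 h0m).mono Set.Ioi_subset_Ici_self
    exact ge_of_tendsto hlim (eventually_nhdsWithin_of_forall fun t ht => (hpos t ht).le)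
  have hloc : ∀ f : ℝ → ℝ, ContinuousOn f (Set.Ici 0) → 0 < f 0 →
      ∃ δ > 0, δ ≤ 1 ∧ ∀ s ∈ Set.Icc 0 δ, f 0 / 2 ≤ f s := by
    intro f hf hf0
    have hev : ∀ᶠ s in 𝓝[≥] (0 : ℝ), f 0 / 2 < f s :=
      (hf 0 h0m).eventually (lt_mem_nhds (by linarith))
    obtain ⟨δ, hδ, hsub⟩ := mem_nhdsGE_iff_exists_Icc_subset.mp hev
    exact ⟨min δ 1, lt_min hδ one_pos, min_le_right _ _,
      fun s hs => le_of_lt (hsub ⟨hs.1, hs.2.trans (min_le_left _ _)⟩)⟩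
  rcases hg0.lt_or_eq with hgp | hgz
  · obtain ⟨δ, hδ, hδ1, hb⟩ := hloc g hg.continuousOn hgp
    refine ⟨g 0 / 2, by linarith, δ, hδ, hδ1, fun s hs => le_trans ?_ (hb s hs)⟩
    have : s ^ 2 ≤ 1 := pow_le_one₀ hs.1 (hs.2.trans hδ1)
    nlinarith
  · obtain ⟨δ, hδ, hδ1, hb⟩ := hloc _ c2 h2
    set b := iteratedDerivWithin 2 g (Set.Ici 0) 0 with hbdef
    have hd0 : 0 ≤ derivWithin g (Set.Ici 0) 0 := by
      have hs := (hasDerivWithinAt_iff_tendsto_slope' Set.self_notMem_Ioi).mp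
        (hasDerivWithinAt_Ioi_iff_Ici.mpr (d1 0 h0m))
      refine ge_of_tendsto hs (eventually_nhdsWithin_of_forall fun t ht => ?_)
      rw [slope_def_field, ← hgz, sub_zero, sub_zero]
      exact (div_pos (hpos t ht) ht).le
    have hsub : Set.Icc 0 δ ⊆ Set.Ici (0 : ℝ) := Set.Icc_subset_Ici_self
    have m1 : ∀ s ∈ Set.Icc 0 δ, b / 2 * s ≤ derivWithin g (Set.Ici 0) s := by
      intro s hs
      have := monotoneOn_of_hasDerivWithinAt_Icc
        (fun t ht => ((d2 t (hsub ht)).mono hsub).sub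
          ((hasDerivWithinAt_id t (Set.Icc 0 δ)).const_mul (b / 2)))
        (fun t ht => by have := hb t ht; linarith) ⟨le_rfl, hδ.le⟩ hs hs.1
      simp only [Pi.sub_apply, id_eq, mul_zero, sub_zero] at this
      linarith
    refine ⟨b / 4, by linarith, δ, hδ, hδ1, fun s hs => ?_⟩
    have := monotoneOn_of_hasDerivWithinAt_Icc
      (fun t ht => ((d1 t (hsub ht)).mono hsub).sub
        (((hasDerivAt_pow 2 t).hasDerivWithinAt (s := Set.Icc 0 δ)).const_mul (b / 4)))
      (fun t ht => by
        have := m1 t ht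
        push_cast
        rw [pow_one]
        linarith) ⟨le_rfl, hδ.le⟩ hs hs.1
    simp only [Pi.sub_apply] at this
    rw [← hgz] at this
    nlinarith

/-- Only the behaviour near 0 is used: the mass is at least (c/3)s³ up to δ and never falls below
(c/3)δ³ afterwards. Since (δs/τ)³ is at most both s³ and δ³, the mass parameter is proportional to
1/τ. -/
theorem exists_hasKernelMass_div {g : ℝ → ℝ} (hpos : ∀ t, 0 < t → 0 < g t)
    (hg : ContDiffOn ℝ 2 g (Set.Ici 0)) (h2 : 0 < iteratedDerivWithin 2 g (Set.Ici 0) 0) :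
    ∃ c > 0, ∀ τ, 1 ≤ τ → HasKernelMass g τ (c / τ) := by
  obtain ⟨c, hc, δ, hδ, hδ1, hb⟩ := exists_mul_sq_le hpos hg h2
  have hcont : ∀ x, ContinuousOn g (Set.Icc 0 x) := fun x =>
    hg.continuousOn.mono Set.Icc_subset_Ici_self
  have hnn : ∀ t, 0 ≤ t → 0 ≤ g t := by
    intro t ht
    rcases ht.eq_or_lt with rfl | h
    · simpa using hb 0 ⟨le_rfl, hδ.le⟩
    · exact (hpos t h).le
  have hsmall : ∀ s ∈ Set.Icc 0 δ, c / 3 * s ^ 3 ≤ ∫ x in (0 : ℝ)..s, g x := by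
    intro s hs
    have := mul_pow_le_integral (k := 2) (c := c) le_rfl (hcont δ) (fun r hr => hnn r hr.1)
      (fun r hr => by simpa using hb r hr) hs
    refine le_trans (le_of_eq ?_) this
    push_cast
    ring
  refine ⟨c * δ ^ 3 / 3, by positivity, fun τ hτ s hs => ?_⟩
  have hτ0 : 0 < τ := by linarith
  have e : c * δ ^ 3 / 3 / τ / τ ^ 2 * s ^ 3 = c / 3 * (δ * (s / τ)) ^ 3 := by
    field_simp
  have hsτ : 0 ≤ s / τ := div_nonneg hs.1 hτ0.le
  have hsτ1 : s / τ ≤ 1 := (div_le_one hτ0).mpr hs.2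
  rw [e]
  rcases le_total s δ with h | h
  · refine le_trans ?_ (hsmall s ⟨hs.1, h⟩)
    have h1 : s / τ ≤ s := div_le_self hs.1 hτ
    have h3 : δ * (s / τ) ≤ s := by nlinarith
    gcongr
  · have h1 := hsmall δ ⟨hδ.le, le_rfl⟩
    have hii : IntervalIntegrable g volume 0 s := by
      refine ContinuousOn.intervalIntegrable ?_
      rw [Set.uIcc_of_le hs.1]
      exact hcont s
    have h3 : ∫ x in (0 : ℝ)..δ, g x ≤ ∫ x in (0 : ℝ)..s, g x := by
      refine intervalIntegral.integral_mono_interval le_rfl hδ.le h ?_ hii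
      exact (ae_restrict_iff' measurableSet_Ioc).mpr
        (Eventually.of_forall fun x hx => hnn x hx.1.le)
    refine le_trans ?_ (h1.trans h3)
    have h4 : δ * (s / τ) ≤ δ := by nlinarith
    gcongr

theorem tendsto_slowLog (r : ℕ) : Tendsto (slowLog r) atTop atTop :=
  (Real.tendsto_log_atTop.iterate (r + 1)).comp (tendsto_atTop_add_const_left _ _ tendsto_id)

theorem timeInterval_top : timeInterval ⊤ = Set.Ici 0 := by
  ext t
  simp [timeInterval, EReal.coe_lt_top]

theorem log_add_log_le_of_mul_le {c t E L a b q e : ℝ} (hc : 0 < c) (ht : 0 < t) (hL : 0 < L)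
    (ha : 0 < a) (hb : 0 < b) (h : c * (t ^ E * L) ≤ a * b * (a ^ (q - 1) * t ^ e)) :
    Real.log c + Real.log L ≤ q * Real.log a + Real.log b + (e - E) * Real.log t := by
  have h1 := Real.log_le_log (by positivity) h
  rw [Real.log_mul hc.ne' (by positivity), Real.log_mul (by positivity) hL.ne', Real.log_rpow ht,
    Real.log_mul (by positivity) (by positivity), Real.log_mul ha.ne' hb.ne',
    Real.log_mul (by positivity) (by positivity), Real.log_rpow ha, Real.log_rpow ht] at h1
  linarith

end Kernels

/-! ### Both decay conditions exclude global systems -/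

section NoGlobalSystem

variable {n : ℕ} {p q κ : ℝ} {g₁ g₂ U V A B : ℝ → ℝ}

/-- At G_k = g_k(t) the logarithm of the interplay condition is exactly the left side of the
iteration bound, so ln 𝓛_r(t) + ln c stays below K₁ or K₂ according to which member of the maximum
is larger. A large t contradicts this. -/
theorem IsMemorySystem.not_slowDecayCondition (h : IsMemorySystem n p q κ g₁ g₂ U V A B)
    (hg₁ : IsMemoryKernel ⊤ g₁) (hg₂ : IsMemoryKernel ⊤ g₂) (hp : 1 < p) (hq : 1 < q) (r : ℕ) :
    ¬ SlowDecayCondition n ⊤ g₁ g₂ p q r := by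
  rintro ⟨a₁, a₂, t₀, -, c, hc, hb⟩
  have hset : {t : ℝ | 0 < t ∧ (t : EReal) < ⊤} = Set.Ioi 0 := by
    ext t
    simp [EReal.coe_lt_top]
  rw [hset] at a₁ a₂
  obtain ⟨K₁, hK₁⟩ := h.exists_log_le hg₁ hg₂ hp hq
  obtain ⟨K₂, hK₂⟩ := h.swap.exists_log_le hg₂ hg₁ hq hp
  obtain ⟨t, hL, htt, ht2⟩ := ((tendsto_slowLog r).eventually_gt_atTop
    (Real.exp (max K₁ K₂ - Real.log c))).and
      ((eventually_ge_atTop t₀).and (eventually_ge_atTop 2)) |>.exists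
  have ht : 0 < t := by linarith
  have htop := EReal.coe_lt_top t
  have p₁ := hg₁.pos t ht htop
  have p₂ := hg₂.pos t ht htop
  have m₁ := HasKernelMass.of_antitoneOn hg₁ a₁ ht
  have m₂ := HasKernelMass.of_antitoneOn hg₂ a₂ ht
  have k₁ := hK₁ t _ _ ht2 p₁ p₂ m₁ m₂
  have k₂ := hK₂ t _ _ ht2 p₂ p₁ m₂ m₁
  have hLpos : 0 < slowLog r t := (Real.exp_pos _).trans hL
  have hlog := (Real.lt_log_iff_exp_lt hLpos).mpr hL
  obtain ⟨-, -, hmax⟩ := hb t ht htt htop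
  rcases max_choice (g₁ t ^ (q - 1) * t ^ (2 * q + 1 / p))
    (g₂ t ^ (p - 1) * t ^ (2 * p + 1 / q)) with hm | hm
  · rw [hm] at hmax
    have := log_add_log_le_of_mul_le hc ht hLpos p₁ p₂ hmax
    have := le_max_left K₁ K₂
    linarith
  · rw [hm, mul_comm (g₁ t)] at hmax
    have := log_add_log_le_of_mul_le hc ht hLpos p₂ p₁ hmax
    have := le_max_right K₁ K₂
    rw [mul_comm q p] at k₂
    linarith

/-- With G_k = c_k/τ the kernels subtract (q + 1) ln τ, leaving the coefficient q + 2 + 1/p -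
(n-1)/2·(pq-1); were it positive, ln τ would be bounded. -/
theorem IsMemorySystem.le_of_hasKernelMass (h : IsMemorySystem n p q κ g₁ g₂ U V A B)
    (hg₁ : IsMemoryKernel ⊤ g₁) (hg₂ : IsMemoryKernel ⊤ g₂) (hp : 1 < p) (hq : 1 < q)
    {c₁ c₂ : ℝ} (hc₁ : 0 < c₁) (hc₂ : 0 < c₂) (m₁ : ∀ τ, 1 ≤ τ → HasKernelMass g₁ τ (c₁ / τ))
    (m₂ : ∀ τ, 1 ≤ τ → HasKernelMass g₂ τ (c₂ / τ)) :
    (q + 2 + p⁻¹) / (p * q - 1) ≤ ((n : ℝ) - 1) / 2 := by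
  by_contra! hlt
  rw [lt_div_iff₀ (by nlinarith)] at hlt
  obtain ⟨K, hK⟩ := h.exists_log_le hg₁ hg₂ hp hq
  have hE : 0 < q + 2 + p⁻¹ - ((n : ℝ) - 1) / 2 * (p * q - 1) := by linarith
  obtain ⟨t, hL, ht2⟩ := (((Real.tendsto_log_atTop.const_mul_atTop hE).eventually_gt_atTop
    (K - q * Real.log c₁ - Real.log c₂)).and (eventually_ge_atTop 2)).exists
  have ht : 0 < t := by linarith
  have k := hK t _ _ ht2 (div_pos hc₁ ht) (div_pos hc₂ ht) (m₁ t (by linarith))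
    (m₂ t (by linarith))
  rw [Real.log_div hc₁.ne' ht.ne', Real.log_div hc₂.ne' ht.ne', one_div] at k
  linarith

theorem IsMemorySystem.not_fastDecayCondition (h : IsMemorySystem n p q κ g₁ g₂ U V A B)
    (hg₁ : IsMemoryKernel ⊤ g₁) (hg₂ : IsMemoryKernel ⊤ g₂) (hp : 1 < p) (hq : 1 < q) :
    ¬ FastDecayCondition n ⊤ g₁ g₂ p q := by
  rintro ⟨-, s₁, s₂, d₁, d₂, hlt⟩
  rw [timeInterval_top] at s₁ s₂ d₁ d₂
  have htop : ∀ s : ℝ, (s : EReal) < ⊤ := EReal.coe_lt_top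
  obtain ⟨c₁, hc₁, m₁⟩ := exists_hasKernelMass_div (fun t ht => hg₁.pos t ht (htop t)) s₁ d₁
  obtain ⟨c₂, hc₂, m₂⟩ := exists_hasKernelMass_div (fun t ht => hg₂.pos t ht (htop t)) s₂ d₂
  have h1 := h.le_of_hasKernelMass hg₁ hg₂ hp hq hc₁ hc₂ m₁ m₂
  have h2 := h.swap.le_of_hasKernelMass hg₂ hg₁ hq hp hc₂ hc₁ m₂ m₁
  rw [mul_comm q p] at h2
  exact absurd hlt (not_lt.mpr (max_le h2 h1))

end NoGlobalSystem

/-! ### The theorem -/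

theorem theorem2p2 (n : ℕ) (hn : 1 ≤ n) (p q : ℝ) (hp : 1 < p) (hq : 1 < q)
    (hpq : 3 ≤ n → p ≤ (n : ℝ) / ((n : ℝ) - 2) ∧ q ≤ (n : ℝ) / ((n : ℝ) - 2))
    (T : EReal) (hT : 0 < T) (g₁ g₂ : ℝ → ℝ)
    (hg₁ : IsMemoryKernel T g₁) (hg₂ : IsMemoryKernel T g₂)
    (hcase : (∃ r : ℕ, SlowDecayCondition n T g₁ g₂ p q r) ∨ FastDecayCondition n T g₁ g₂ p q)
    (u₀ u₁ v₀ v₁ : EucSp n → ℝ)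
    (hu₀ : MemH1 u₀) (hu₁ : MemLp u₁ 2 volume) (hv₀ : MemH1 v₀) (hv₁ : MemLp v₁ 2 volume)
    (hu₀_nonneg : 0 ≤ᵐ[volume] u₀) (hu₁_nonneg : 0 ≤ᵐ[volume] u₁)
    (hv₀_nonneg : 0 ≤ᵐ[volume] v₀) (hv₁_nonneg : 0 ≤ᵐ[volume] v₁)
    (R : ℝ) (hR : 0 < R)
    (hsupp : ∀ᵐ x : EucSp n, R < ‖x‖ → u₀ x = 0 ∧ u₁ x = 0 ∧ v₀ x = 0 ∧ v₁ x = 0)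
    (hu₁_ne : ¬ u₁ =ᵐ[volume] 0) (hv₁_ne : ¬ v₁ =ᵐ[volume] 0)
    (u v : ℝ → EucSp n → ℝ) (hsol : IsEnergySolution T g₁ g₂ p q u₀ u₁ v₀ v₁ u v) :
    (∀ t ∈ timeInterval T, ∀ᵐ x : EucSp n, R + t < ‖x‖ → u t x = 0 ∧ v t x = 0) ∧
      T < ⊤ := by
  obtain ⟨C, hC0, hC⟩ := exists_sobolev hn hp fun h3 => (hpq h3).1
  obtain ⟨C', hC0', hC'⟩ := exists_sobolev hn hq fun h3 => (hpq h3).2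
  obtain ⟨W, Wt, Z, Zt, D, DZ, hrep, hW0, hWt0, hZ0, hZt0, hcurve⟩ :=
    hsol.exists_isWaveCurve hT hp hq hC0 hC hC0' hC' hg₁ hg₂ hu₁ hv₁
  have h0 : ∀ᵐ x, R < ‖x‖ → W 0 x = 0 ∧ Wt 0 x = 0 ∧ Z 0 x = 0 ∧ Zt 0 x = 0 := by
    filter_upwards [hsupp, hW0, hWt0, hZ0, hZt0] with x hx h1 h2 h3 h4 hR
    rw [h1, h2, h3, h4]
    exact hx hR
  refine ⟨fun t ht => ?_, ?_⟩
  -- An intermediate time S is needed because the energy estimate reaches only t < S, with kernels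
  -- integrable up to S.
  · obtain ⟨S, htS, hST⟩ := EReal.lt_iff_exists_real_btwn.mp ht.2
    have htS' : t < S := EReal.coe_lt_coe_iff.mp htS
    have hS : 0 < S := ht.1.trans_lt htS'
    have key := ae_eq_zero_of_lt_norm hp hq hC0 hC hC0' hC' (hg₁.integrable S hS hST)
      (hg₂.integrable S hS hST) (hcurve S hS hST).1 (hcurve S hS hST).2 h0 ht.1 htS'
    filter_upwards [key, (hrep t ht).1, (hrep t ht).2] with x hx h1 h2 hR
    rw [h1, h2]
    exact hx hR
  · rw [lt_top_iff_ne_top]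
    rintro rfl
    have htop : ∀ s : ℝ, (s : EReal) < ⊤ := EReal.coe_lt_top
    obtain ⟨κ, U, V, A, B, hsys⟩ := exists_isMemorySystem hn hp hq hR hC0 hC hC0' hC' hg₁ hg₂
      (fun S hS => (hcurve S hS (htop S)).1) (fun S hS => (hcurve S hS (htop S)).2) h0
      (by filter_upwards [hW0, hu₀_nonneg] with x h1 h2; rwa [h1])
      (by filter_upwards [hWt0, hu₁_nonneg] with x h1 h2; rwa [h1])
      (by filter_upwards [hZ0, hv₀_nonneg] with x h1 h2; rwa [h1])
      (by filter_upwards [hZt0, hv₁_nonneg] with x h1 h2; rwa [h1])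
      (fun h => hu₁_ne (hWt0.symm.trans h)) (fun h => hv₁_ne (hZt0.symm.trans h))
    rcases hcase with ⟨r, hr⟩ | hf
    · exact hsys.not_slowDecayCondition hg₁ hg₂ hp hq r hr
    · exact hsys.not_fastDecayCondition hg₁ hg₂ hp hq hf
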